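/- **Conventions.** A code is a set $C\subseteq\Sigma^n$, $\Sigma$ finite; its rate is $\log|C|/(n\log|\Sigma|)$. For $x\in\Sigma^n$ and lists $S_1,\dots,S_n\subseteq\Sigma$ let $\operatorname{dist}(x,S)$ be the fraction of $i$ with $x_i\notin S_i$. $C$ is $(\alpha,\ell,L)$-list-recoverable if for all $S$ with $|S_i|\le\ell$ at most $L$ codewords $c$ have $\operatorname{dist}(c,S)\le\alpha$. $C$ is $(t,\alpha,\ell,L)$-locally list-recoverable if a randomized algorithm with at most $t$ queries to $S$ (a query to $i$ returns $S_i$) outputs $L$ randomized algorithms $A_1,\dots,A_L$, each taking a coordinate $i$ and making at most $t$ queries, such that for every $c\in C$ with $\operatorname{dist}(c,S)\le\alpha$, with probability at least $2/3$ there is a $j$ with $\Pr[A_j(i)=c_i]\ge 2/3$ for all $i$. The time of a list-recovery algorithm (global, outputting $L$ messages that include every message whose codeword is within $\alpha$ of the lists; or local) is the number of operations of a straight-line program over words, where a word holds one symbol of $\Sigma_0$ or of $\Sigma_1$ or one coordinate, and one operation is a binary word operation, a constant, or one oracle query. Construction time is the running time, at logarithmic cost, of a deterministic while-program on natural-number registers.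 **Construction.** Let $E_1:M\to\Sigma_1^{n_1}$ and $E_0:\Sigma_1\to\Sigma_0^{n_0}$ be injective encoders with images $C_1$ and $C_0$ (so $|C_0|=|\Sigma_1|$), let $D\mid n_0$ and $N=n_1n_0/D$, and let $\pi:[n_1]\times[n_0]\to[N]\times[D]$ be a bijection (a bipartite graph of degree $n_0$ on the left and $D$ on the right). The wired code $C=C(\pi,E_1,E_0)\subseteq(\Sigma_0^D)^N$ is the image of the encoder that sends $z$ to the word whose $j$-th symbol has $p$-th component $E_0(E_1(z)_b)_q$, where $\pi(b,q)=(j,p)$. **Theorem.** There are an absolute constant $K$ and a fixed program $P$ such that for all $\varepsilon,\gamma\in(0,1)$ there are integers $1\le D\le K/(\varepsilon^3\gamma)$ and $0\le d\le K/(\varepsilon\gamma)^K$ with the following property. For all $n_1\ge1$ and all $n_0\ge d$ divisible by $D$ there is a bijection $\pi$ as above, whose table $P$ outputs on input $(n_1,n_0,D)$ within $K(n_1n_0+1)^K$ steps; moreover, whenever some program outputs a description $\mathrm{desc}$ (of $C_0$, say) in time $T$, some program outputs $\mathrm{desc}$ followed by the table of $\pi$ in time $T+K(n_1n_0+1)^K$.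 For all $\zeta,R\in(0,1)$ and all $E_1,E_0$ as above such that $C_1$ has rate $1-\zeta$ and $C_0$ has rate $R$, the wired code $C$ has the same number of codewords as $C_1$, rate $(1-\zeta)R$, an alphabet of size $|\Sigma_0|^D$ and block length $$N\le K\cdot\frac{n_1\log|\Sigma_1|\,\varepsilon^3\gamma}{R\log|\Sigma_0|},$$ and for all $\ell,\ell_1$: 1. If $C_0$ is $(1-R-\varepsilon,\ell,\ell_1)$-list-recoverable and $C_1$ is $(\gamma,\ell_1,L)$-list-recoverable, then $C$ is $(1-R-4\varepsilon,\ell,L)$-list-recoverable. Suppose moreover that $C_0$ is $(1-R-\varepsilon,\ell,\ell_1)$-list-recoverable in time $T(C_0)$, on words that also hold every number below $n_1n_0$. Then: 2. If $C_1$ is $(\gamma,\ell_1,L)$-list-recoverable in time $T(C_1)$, then $C$ is $(1-R-4\varepsilon,\ell,L)$-list-recoverable in time at most $K(n_1T(C_0)+T(C_1))$. 3. If $C_1$ is $(t,\gamma,\ell_1,L)$-locally list-recoverable in time $T'(C_1)$, then $C$ is $(t',1-R-4\varepsilon,\ell,L)$-locally list-recoverable in time $T'$ for some $$t'\le K\,\frac{\log(2/(\varepsilon\gamma))}{\varepsilon^3\gamma}\cdot\frac{t\log|\Sigma_1|}{R\log|\Sigma_0|},\qquad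 T'\le K\,\frac{\log(2/(\varepsilon\gamma))}{\varepsilon^3\gamma}\bigl(t\,(n_0+T(C_0))+T'(C_1)+1\bigr).$$ -/

import Mathlib

/-! ## Codes, rate, list-recoverability -/

/-- The rate `log |C| / log (|A| ^ n)` of a code `C ⊆ A ^ n`. -/
noncomputable def codeRate {A : Type} [Fintype A] {n : ℕ} (C : Set (Fin n → A)) : ℝ :=
  Real.log (C.ncard : ℝ) / ((n : ℝ) * Real.log (Fintype.card A : ℝ))

/-- The fraction of coordinates `i` for which `x i` does not belong to the list `S i`. -/
noncomputable def listDist {A : Type} {n : ℕ} (x : Fin n → A) (S : Fin n → Set A) : ℝ :=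
  (({i | x i ∉ S i} : Set (Fin n)).ncard : ℝ) / (n : ℝ)

/-- `(α, ℓ, L)`-list-recoverability: for all input lists of at most `ℓ` symbols each, at most `L`
codewords are within relative distance `α` of the lists. -/
def ListRecoverable {A : Type} {n : ℕ} (C : Set (Fin n → A)) (α : ℝ) (ℓ L : ℕ) : Prop :=
  ∀ S : Fin n → Finset A, (∀ i, (S i).card ≤ ℓ) →
    ({c | c ∈ C ∧ listDist c (fun i => (S i : Set A)) ≤ α} : Set (Fin n → A)).encard ≤ (L : ℕ∞)

/-! ## Straight-line programs over machine words

The running time of a decoder of a given code is measured on straight-line programs whose wires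
carry words from a finite set `W`. One time step is one binary word operation (any such operation
is a look-up in a table with `|W| ^ 2` entries), the loading of a constant, or one query to an
oracle which is addressed by a word and answers with a tuple of words indexed by `ρ`. Copying,
permuting and discarding wires takes no time. -/

/-- `WordProg W ρ a b`: programs with input wires `a` and output wires `b`. -/
inductive WordProg (W : Type) (ρ : Type) : Type → Type → Type 1
  | wire {a b : Type} (f : b → a) : WordProg W ρ a b
  | const (w : W) : WordProg W ρ Empty Unit
  | gate (f : W → W → W) : WordProg W ρ Bool Unit
  | query : WordProg W ρ Unit ρ
  | seq {a b c : Type} (p : WordProg W ρ a b) (q : WordProg W ρ b c) : WordProg W ρ a c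
  | par {a b c d : Type} (p : WordProg W ρ a b) (q : WordProg W ρ c d) :
      WordProg W ρ (a ⊕ c) (b ⊕ d)

namespace WordProg

/-- The output words of a program, for the oracle `O` and given input words. -/
def eval {W ρ : Type} (O : W → ρ → W) : {a b : Type} → WordProg W ρ a b → (a → W) → (b → W)
  | _, _, wire f, x => fun i => x (f i)
  | _, _, const w, _ => fun _ => w
  | _, _, gate f, x => fun _ => f (x false) (x true)
  | _, _, query, x => O (x ())
  | _, _, seq p q, x => eval O q (eval O p x)
  | _, _, par p q, x => Sum.elim (eval O p (fun i => x (Sum.inl i))) (eval O q (fun i => x (Sum.inr i)))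

/-- The number of time steps. -/
def time {W ρ : Type} : {a b : Type} → WordProg W ρ a b → ℕ
  | _, _, wire _ => 0
  | _, _, const _ => 1
  | _, _, gate _ => 1
  | _, _, query => 1
  | _, _, seq p q => time p + time q
  | _, _, par p q => time p + time q

/-- The number of oracle queries. -/
def queries {W ρ : Type} : {a b : Type} → WordProg W ρ a b → ℕ
  | _, _, wire _ => 0
  | _, _, const _ => 0
  | _, _, gate _ => 0
  | _, _, query => 1
  | _, _, seq p q => queries p + queries q
  | _, _, par p q => queries p + queries q

end WordProg

/-- A representation of the elements of `A` by tuples of words from `{0, …, B - 1}`, the words of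
one element being indexed by `κ`. -/
abbrev WordEnc (A κ : Type) (B : ℕ) : Type := A ↪ (κ → Fin B)

/-- The representation of a vector of `D` symbols, symbol by symbol. -/
def WordEnc.vec {A κ : Type} {B : ℕ} (e : WordEnc A κ B) (D : ℕ) :
    WordEnc (Fin D → A) (Fin D × κ) B where
  toFun v x := e (v x.1) x.2
  inj' v w h := by
    funext p
    apply e.injective
    funext k
    exact congrFun h (p, k)

/-- The code with encoder `E` is `(α, ℓ, L)`-list-recoverable in time `T`: some deterministic
program of at most `T` steps (without oracle) receives `n` lists of `ℓ` symbols and outputs `L`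
messages, among which are all those whose encodings are within relative distance `α` of the
lists. Repetitions within a list are allowed. -/
def ListRecoverableInTime {A M κ μ : Type} {n B : ℕ} (E : M → Fin n → A) (e : WordEnc A κ B)
    (eM : WordEnc M μ B) (α : ℝ) (ℓ L T : ℕ) : Prop :=
  ∃ p : WordProg (Fin B) Empty (Fin n × Fin ℓ × κ) (Fin L × μ), p.time ≤ T ∧
    ∀ S : Fin n → Fin ℓ → A, ∃ out : Fin L → M,
      p.eval (fun _ r => r.elim) (fun x => e (S x.1 x.2.1) x.2.2) = (fun y => eM (out y.1) y.2) ∧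
      ∀ z : M, listDist (E z) (fun i => Set.range (S i)) ≤ α → ∃ k, out k = z

/-- The probability of `P` under the uniform distribution on a finite set. -/
noncomputable def unifProb {Ω : Type} [Fintype Ω] (P : Ω → Prop) : ℝ :=
  (({ω | P ω} : Set Ω).ncard : ℝ) / (Fintype.card Ω : ℝ)

/-- Query access to `n` lists of `ℓ` symbols: the word `w` is answered by the whole list of
coordinate `w` (addresses are reduced modulo `n`). -/
def listOracle {A κ : Type} {n ℓ B : ℕ} (e : WordEnc A κ B) (S : Fin n → Fin ℓ → A) :
    Fin B → Fin ℓ × κ → Fin B :=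
  fun w x => if h : 0 < n then e (S ⟨w.val % n, Nat.mod_lt _ h⟩ x.1) x.2 else w

/-- `C` is `(t, α, ℓ, L)`-locally list-recoverable in time `T`. The randomized algorithm `alg`
(its coins are `a` uniform words) makes at most `t` queries and outputs the descriptions
`(s` words each) of `L` randomized algorithms. The `j`-th of them is run by `run` on the `j`-th
description, a coordinate and `b` fresh uniform words; it makes at most `t` queries and outputs a
symbol. For each codeword `c` within relative distance `α` of the lists, with probability at least
`2/3` over the coins of `alg` there is `j` such that for every coordinate `i` the `j`-th algorithm
outputs `c i` with probability at least `2/3`. -/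
def LocallyListRecoverableInTime {A κ : Type} {n B : ℕ} (C : Set (Fin n → A)) (e : WordEnc A κ B)
    (t : ℕ) (α : ℝ) (ℓ L T : ℕ) : Prop :=
  ∃ (hB : n ≤ B) (a b s : ℕ) (alg : WordProg (Fin B) (Fin ℓ × κ) (Fin a) (Fin L × Fin s))
    (run : WordProg (Fin B) (Fin ℓ × κ) (Fin s ⊕ Unit ⊕ Fin b) κ),
    alg.queries ≤ t ∧ run.queries ≤ t ∧ alg.time ≤ T ∧ run.time ≤ T ∧
    ∀ S : Fin n → Fin ℓ → A, ∀ c ∈ C, listDist c (fun i => Set.range (S i)) ≤ α →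
      2 / 3 ≤ unifProb (fun ω : Fin a → Fin B => ∃ j : Fin L, ∀ i : Fin n,
        2 / 3 ≤ unifProb (fun η : Fin b → Fin B =>
          run.eval (listOracle e S)
            (Sum.elim (fun k => alg.eval (listOracle e S) ω (j, k))
              (Sum.elim (fun _ => Fin.castLE hB i) η)) = e (c i)))

/-! ## Construction time

Constructions are carried out by while-programs over registers that hold natural numbers, with
logarithmic cost: an instruction costs one plus the bit lengths of the numbers it handles. -/

/-- The arithmetic operations (truncated subtraction, division with `y / 0 = 0`). -/
inductive ArithOp
  | add | sub | mul | div | mod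

/-- The value of an arithmetic operation. -/
def ArithOp.apply : ArithOp → ℕ → ℕ → ℕ
  | add, y, z => y + z
  | sub, y, z => y - z
  | mul, y, z => y * z
  | div, y, z => y / z
  | mod, y, z => y % z

/-- While-programs; `loop x body` repeats `body` as long as register `x` is not zero, and `emit x`
appends the content of register `x` to the output. -/
inductive WhileProg
  | const (x v : ℕ)
  | arith (op : ArithOp) (x y z : ℕ)
  | emit (x : ℕ)
  | seq (p q : WhileProg)
  | loop (x : ℕ) (body : WhileProg)

/-- The registers and the output written so far. -/
structure MachineState where
  reg : ℕ → ℕ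
  out : List ℕ

/-- Writing the value `v` into register `x`. -/
def MachineState.set (s : MachineState) (x v : ℕ) : MachineState :=
  { s with reg := Function.update s.reg x v }

/-- `WhileProg.Run p s s' k`: started in state `s`, the program `p` halts in state `s'` after
`k` steps. -/
inductive WhileProg.Run : WhileProg → MachineState → MachineState → ℕ → Prop
  | const (x v : ℕ) (s : MachineState) : Run (.const x v) s (s.set x v) (1 + v.size)
  | arith (op : ArithOp) (x y z : ℕ) (s : MachineState) :
      Run (.arith op x y z) s (s.set x (op.apply (s.reg y) (s.reg z)))
        (1 + (s.reg y).size + (s.reg z).size + (op.apply (s.reg y) (s.reg z)).size)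
  | emit (x : ℕ) (s : MachineState) :
      Run (.emit x) s { s with out := s.out ++ [s.reg x] } (1 + (s.reg x).size)
  | seq {p q : WhileProg} {s s' s'' : MachineState} {k k' : ℕ} :
      Run p s s' k → Run q s' s'' k' → Run (.seq p q) s s'' (k + k')
  | loop_exit {x : ℕ} {body : WhileProg} {s : MachineState} :
      s.reg x = 0 → Run (.loop x body) s s 1
  | loop_next {x : ℕ} {body : WhileProg} {s s' s'' : MachineState} {k k' : ℕ} :
      s.reg x ≠ 0 → Run body s s' k → Run (.loop x body) s' s'' k' →
      Run (.loop x body) s s'' (1 + k + k')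

/-- Started with `input` in its first registers and zero in all others, `p` outputs the list
`output` and halts within `T` steps. -/
def WhileProg.Outputs (p : WhileProg) (input output : List ℕ) (T : ℕ) : Prop :=
  ∃ (s : MachineState) (k : ℕ),
    WhileProg.Run p { reg := fun i => input.getD i 0, out := [] } s k ∧ s.out = output ∧ k ≤ T

/-! ## The construction -/

/-- The code obtained from an outer encoder `E₁`, an inner encoder `E₀` and a wiring `π`: each of
the `n₁` symbols of the outer codeword is encoded by `E₀` into a block of `n₀` symbols; the symbol
`q` of the block `b` becomes the component `p` of the symbol `j` of the new codeword, where
`π (b, q) = (j, p)`. The wiring amounts to a bipartite multigraph between blocks and new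
coordinates, with degrees `n₀` and `D` and with numbered edges at each vertex. -/
def wiredEncoder {M A₀ A₁ : Type} {n₁ n₀ N D : ℕ} (π : Fin n₁ × Fin n₀ ≃ Fin N × Fin D)
    (E₁ : M → Fin n₁ → A₁) (E₀ : A₁ → Fin n₀ → A₀) : M → Fin N → (Fin D → A₀) :=
  fun z j p => E₀ (E₁ z (π.symm (j, p)).1) (π.symm (j, p)).2

/-- The table of a wiring, listed block by block. -/
def wiringTable {n₁ n₀ N D : ℕ} (π : Fin n₁ × Fin n₀ ≃ Fin N × Fin D) : List ℕ :=
  (List.finRange n₁).flatMap fun b => (List.finRange n₀).flatMap fun q =>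
    [(π (b, q)).1.val, (π (b, q)).2.val]

/-! Everything reduces to one property of the wiring, `IsWiringSampler`: if a set X of new
coordinates has density at most β, then all but a fraction γ of the blocks have at most a fraction β
+ 3ε of their edges in X. Take β = 1 - R - 4ε and let X be the coordinates where a wired codeword
misses its lists. In all but a fraction γ of the blocks the inner word is then within 1 - R - ε of
the projected lists, so inner list recovery returns the right outer symbol, and outer list recovery
with error γ finishes. The global algorithm runs this reduction directly. The local one answers each
outer query by n₀ queries and one inner decoding; it recovers the D components of a symbol
separately, each by a majority over O(log D) runs of the outer local decoder.

The sampler comes from an explicit expander on the torus (ℤ/m)². A map is a shear and translation in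
x followed by one in y, with six parameters in [0, D). On functions of mean zero the sum over all D⁶
such maps has squared norm at most 4D¹¹, against the trivial D¹²
(`sum_norm_sq_shearSum_shearSum_le`). On the Fourier side translations become Dirichlet kernels,
small at large frequencies, and shears act on the dual plane, where they move a cone to disjoint
places at small frequencies. The first shear handles one of the cones |a| < |b|, |b| ≤ |a|, the
second the other.

To get degree D instead of D⁶, a new coordinate is a point of the torus together with a seed in [0,
D)¹², and its D edges use parameters that are pairwise independent over the seeds (D is prime). Only
pairs of edges enter a second moment, so averaging over seeds gives 5D for the squared norm, against
the trivial D² (`sum_sq_sum_seedHash_le`). By Cauchy–Schwarz, as in the expander mixing lemma, at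
most 10n₁/(ε²D) ≤ γn₁ blocks are exceptional.

General n₁ and n₀ are reached by reducing torus points modulo n₁ and by padding every block with
arbitrary edges to the exact degree. Rounding and padding cost ε each, and the deviation itself
costs the third ε. The edges are given by a fixed arithmetic expression, so a while-program can list
them by exhaustive search in polynomial time. -/

namespace WordProg

/-! ### Combinators for straight-line programs -/

/-- Independent programs run side by side. -/
def bigPar {W ρ a b : Type} :
    (n : ℕ) → (Fin n → WordProg W ρ a b) → WordProg W ρ (Fin n × a) (Fin n × b)
  | 0, _ => wire fun y => y.1.elim0
  | n + 1, p =>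
    seq (wire fun x : a ⊕ Fin n × a => Sum.elim (fun i => (0, i)) (fun i => (i.1.succ, i.2)) x)
      (seq (par (p 0) (bigPar n fun i => p i.succ))
        (wire fun y : Fin (n + 1) × b =>
          Fin.cases (motive := fun _ => b ⊕ Fin n × b) (Sum.inl y.2)
            (fun i => Sum.inr (i, y.2)) y.1))

theorem eval_bigPar {W ρ a b : Type} (O : W → ρ → W) (n : ℕ) (p : Fin n → WordProg W ρ a b)
    (x : Fin n × a → W) :
    (bigPar n p).eval O x = fun y => (p y.1).eval O (fun i => x (y.1, i)) y.2 := by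
  induction n with
  | zero => funext y; exact y.1.elim0
  | succ n ih =>
    funext ⟨i, k⟩
    simp only [bigPar, eval, ih]
    refine Fin.cases ?_ (fun i => ?_) i <;> simp

theorem time_bigPar {W ρ a b : Type} (n : ℕ) (p : Fin n → WordProg W ρ a b) :
    (bigPar n p).time = ∑ i, (p i).time := by
  induction n with
  | zero => simp [bigPar, time]
  | succ n ih => simp [bigPar, time, ih, Fin.sum_univ_succ]

theorem queries_bigPar {W ρ a b : Type} (n : ℕ) (p : Fin n → WordProg W ρ a b) :
    (bigPar n p).queries = ∑ i, (p i).queries := by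
  induction n with
  | zero => simp [bigPar, queries]
  | succ n ih => simp [bigPar, queries, ih, Fin.sum_univ_succ]

/-- Every query is answered by a program `q` instead of the oracle. -/
def subst {W ρ ρ' : Type} (q : WordProg W ρ' Unit ρ) :
    {a b : Type} → WordProg W ρ a b → WordProg W ρ' a b
  | _, _, wire f => wire f
  | _, _, const w => const w
  | _, _, gate f => gate f
  | _, _, query => q
  | _, _, seq p p' => seq (subst q p) (subst q p')
  | _, _, par p p' => par (subst q p) (subst q p')

theorem eval_subst {W ρ ρ' : Type} (O : W → ρ' → W) (q : WordProg W ρ' Unit ρ) {a b : Type}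
    (p : WordProg W ρ a b) (x : a → W) :
    (subst q p).eval O x = p.eval (fun w => q.eval O fun _ => w) x := by
  induction p with
  | wire f => rfl
  | const w => rfl
  | gate f => rfl
  | query => simp only [subst, eval]
  | seq p p' h h' => simp only [subst, eval, h, h']
  | par p p' h h' => simp only [subst, eval, h, h']

theorem time_subst {W ρ ρ' : Type} (q : WordProg W ρ' Unit ρ) {a b : Type}
    (p : WordProg W ρ a b) : (subst q p).time ≤ p.time + p.queries * q.time := by
  induction p with
  | wire f => simp [subst, time]
  | const w => simp [subst, time]
  | gate f => simp [subst, time]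
  | query => simp [subst, time, queries]
  | seq p p' h h' => simp only [subst, time, queries, add_mul]; omega
  | par p p' h h' => simp only [subst, time, queries, add_mul]; omega

theorem queries_subst {W ρ ρ' : Type} (q : WordProg W ρ' Unit ρ) {a b : Type}
    (p : WordProg W ρ a b) : (subst q p).queries = p.queries * q.queries := by
  induction p with
  | wire f => simp [subst, queries]
  | const w => simp [subst, queries]
  | gate f => simp [subst, queries]
  | query => simp [subst, queries]
  | seq p p' h h' => simp only [subst, queries, h, h', add_mul]
  | par p p' h h' => simp only [subst, queries, h, h', add_mul]

/-- A program without oracle, regarded as a program with an oracle that is never queried. -/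
def lift {W ρ a b : Type} (p : WordProg W Empty a b) : WordProg W ρ a b :=
  subst (wire Empty.elim) p

theorem eval_lift {W ρ a b : Type} (O : W → ρ → W) (p : WordProg W Empty a b) (x : a → W) :
    (lift p).eval O x = p.eval (fun _ r => r.elim) x := by
  rw [lift, eval_subst]
  congr 1
  funext w r
  exact r.elim

theorem time_lift {W ρ a b : Type} (p : WordProg W Empty a b) :
    (lift p : WordProg W ρ a b).time ≤ p.time :=
  (time_subst (wire Empty.elim : WordProg W ρ Unit Empty) p).trans (by simp [time])

theorem queries_lift {W ρ a b : Type} (p : WordProg W Empty a b) :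
    (lift p : WordProg W ρ a b).queries = 0 := by
  simp [lift, queries_subst, queries]

/-- The value of a unary word operation. -/
def unary {W ρ : Type} (f : W → W) : WordProg W ρ Unit Unit :=
  seq (wire fun _ : Bool => ()) (gate fun w _ => f w)

theorem eval_unary {W ρ : Type} (O : W → ρ → W) (f : W → W) (x : Unit → W) :
    (unary f : WordProg W ρ Unit Unit).eval O x = fun _ => f (x ()) := rfl

/-- One gate applied to two of the present wires, its result being added as a further wire. -/
def push {W ρ a : Type} (f : W → W → W) (i j : a) : WordProg W ρ a (a ⊕ Unit) :=
  seq (wire (Sum.elim id fun c : Bool => bif c then j else i)) (par (wire id) (gate f))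

theorem eval_push {W ρ a : Type} (O : W → ρ → W) (f : W → W → W) (i j : a) (x : a → W) :
    (push f i j : WordProg W ρ a _).eval O x = Sum.elim x fun _ => f (x i) (x j) := by
  funext y
  rcases y with y | y <;> rfl

theorem time_push {W ρ a : Type} (f : W → W → W) (i j : a) :
    (push f i j : WordProg W ρ a _).time = 1 := rfl

theorem queries_push {W ρ a : Type} (f : W → W → W) (i j : a) :
    (push f i j : WordProg W ρ a _).queries = 0 := rfl

/-! ### Majority vote as a straight-line program -/

section Majority

variable {B : ℕ} {ρ : Type}

/-- One step of the majority vote of Boyer and Moore: from a candidate, its counter and the next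
vote to the new candidate and counter. -/
def voteStep (hB : 1 < B) : WordProg (Fin B) ρ (Bool ⊕ Unit) Bool :=
  have : NeZero B := ⟨by omega⟩
  -- Gates are binary, so the choice between vote and old candidate is the maximum of two gates, one
  -- of which is 0. The new candidate equals the vote exactly when the counter was 0 or the old
  -- candidate agreed, so this one comparison decides between increment and decrement.
  seq (push (fun c x => if c = 0 then x else 0) (Sum.inl true) (Sum.inr ()))
  (seq (push (fun c y => if c = 0 then 0 else y) (Sum.inl (Sum.inl true)) (Sum.inl (Sum.inl false)))
  (seq (push (fun u v => max u v) (Sum.inl (Sum.inr ())) (Sum.inr ()))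
  (seq (push (fun y x => if y = x then ⟨1, hB⟩ else 0) (Sum.inr ())
    (Sum.inl (Sum.inl (Sum.inl (Sum.inr ())))))
  (seq (push (fun c q => if q = 0 then ⟨c.val - 1, by omega⟩ else
      if h : c.val + 1 < B then ⟨c.val + 1, h⟩ else c)
    (Sum.inl (Sum.inl (Sum.inl (Sum.inl (Sum.inl true))))) (Sum.inr ()))
  (wire fun b : Bool => bif b then Sum.inr () else Sum.inl (Sum.inl (Sum.inr ())))))))

theorem time_voteStep (hB : 1 < B) : (voteStep hB : WordProg (Fin B) ρ _ _).time = 5 := rfl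

theorem queries_voteStep (hB : 1 < B) : (voteStep hB : WordProg (Fin B) ρ _ _).queries = 0 := rfl

theorem eval_voteStep (hB : 1 < B) (O : Fin B → ρ → Fin B) (x : Bool ⊕ Unit → Fin B)
    (hc : (x (Sum.inl true)).val + 1 < B) :
    ∃ y : Bool → Fin B, (voteStep hB).eval O x = y ∧
      y false = (if (x (Sum.inl true)).val = 0 then x (Sum.inr ()) else x (Sum.inl false)) ∧
      (y true).val = (if (x (Sum.inl true)).val = 0 ∨ x (Sum.inl false) = x (Sum.inr ())
        then (x (Sum.inl true)).val + 1 else (x (Sum.inl true)).val - 1) := by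
  have : NeZero B := ⟨by omega⟩
  have h10 : (⟨1, hB⟩ : Fin B) ≠ 0 := by
    intro h
    have := congrArg Fin.val h
    simp at this
  refine ⟨_, rfl, ?_, ?_⟩
  · simp only [voteStep, eval, eval_push, cond_false, Sum.elim_inl, Sum.elim_inr]
    by_cases h : x (Sum.inl true) = 0
    · simp [h]
    · have h' : (x (Sum.inl true)).val ≠ 0 := fun h' => h (Fin.ext (by simpa using h'))
      simp [h, h']
  · simp only [voteStep, eval, eval_push, cond_true, Sum.elim_inl, Sum.elim_inr]
    by_cases h : x (Sum.inl true) = 0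
    · have h1 : (0 : ℕ) + 1 < B := by omega
      simp [h, h10, hB]
    · have h' : (x (Sum.inl true)).val ≠ 0 := fun h' => h (Fin.ext (by simpa using h'))
      by_cases h2 : x (Sum.inl false) = x (Sum.inr ())
      · simp [h, h', h2, h10, hc]
      · simp [h, h', h2]

/-- The Boyer–Moore invariant. If k of m votes are for v, the surplus 2k - m is at most c when v is
the candidate and at most -c otherwise. A strict majority has positive surplus and therefore must be
the candidate. -/
theorem voteStep_invariant {α : Type} [DecidableEq α] {c m : ℕ} {k : ℤ} {d w v : α} (h : c ≤ m)
    (hk : 2 * k - m ≤ if d = v then (c : ℤ) else -(c : ℤ)) :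
    (if c = 0 ∨ d = w then c + 1 else c - 1) ≤ m + 1 ∧
    2 * (k + if w = v then 1 else 0) - (m + 1 : ℤ) ≤
      if (if c = 0 then w else d) = v then ((if c = 0 ∨ d = w then c + 1 else c - 1 : ℕ) : ℤ)
      else -((if c = 0 ∨ d = w then c + 1 else c - 1 : ℕ) : ℤ) := by
  by_cases hc : c = 0
  · subst hc
    by_cases hw : w = v <;> by_cases hd : d = v <;> simp [hw, hd] at hk ⊢ <;> omega
  · by_cases hw : w = v
    · subst hw
      by_cases hd : d = w <;> simp [hc, hd] at hk ⊢ <;> omega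
    · by_cases hd : d = v
      · subst hd
        have hw' : d ≠ w := fun h => hw h.symm
        simp [hc, hw, hw'] at hk ⊢
        omega
      · by_cases hdw : d = w
        · subst hdw
          simp [hc, hd] at hk ⊢
          omega
        · simp [hc, hd, hw, hdw] at hk ⊢
          omega

/-- Candidate and counter after `m` votes. -/
def voteState (hB : 1 < B) : (m : ℕ) → WordProg (Fin B) ρ (Fin m) Bool
  | 0 => seq (wire Empty.elim) (seq (const ⟨0, by omega⟩) (wire fun _ => ()))
  | m + 1 =>
    seq (wire (Sum.elim Fin.castSucc fun _ : Unit => Fin.last m))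
      (seq (par (voteState hB m) (wire id)) (voteStep hB))

theorem time_voteState (hB : 1 < B) (m : ℕ) :
    (voteState hB m : WordProg (Fin B) ρ _ _).time = 5 * m + 1 := by
  induction m with
  | zero => rfl
  | succ m ih => simp only [voteState, time, time_voteStep, ih]; ring

theorem queries_voteState (hB : 1 < B) (m : ℕ) :
    (voteState hB m : WordProg (Fin B) ρ _ _).queries = 0 := by
  induction m with
  | zero => rfl
  | succ m ih => simp only [voteState, queries, queries_voteStep, ih]

theorem eval_voteState (hB : 1 < B) (O : Fin B → ρ → Fin B) (v : Fin B) (m : ℕ) (hm : m < B)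
    (x : Fin m → Fin B) :
    (((voteState hB m).eval O x) true).val ≤ m ∧
    2 * (((Finset.univ.filter fun i => x i = v).card : ℕ) : ℤ) - m ≤
      if (voteState hB m).eval O x false = v then ((((voteState hB m).eval O x) true).val : ℤ)
      else -((((voteState hB m).eval O x) true).val : ℤ) := by
  induction m with
  | zero => simp [voteState, eval]
  | succ m ih =>
    obtain ⟨h1, h2⟩ := ih (by omega) (fun i => x i.castSucc)
    set st := (voteState hB m).eval O (fun i => x i.castSucc) with hst
    obtain ⟨y, hy, hy1, hy2⟩ := eval_voteStep (ρ := ρ) hB O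
      (Sum.elim st fun _ => x (Fin.last m)) (by simp only [Sum.elim_inl]; omega)
    have he : (voteState hB (m + 1)).eval O x = y := by
      rw [← hy]
      rfl
    have hcard : ((Finset.univ.filter fun i => x i = v).card : ℤ) =
        (Finset.univ.filter fun i : Fin m => x i.castSucc = v).card +
          (if x (Fin.last m) = v then 1 else 0) := by
      rw [Finset.card_filter, Finset.card_filter, Fin.sum_univ_castSucc]
      push_cast
      rfl
    rw [he, hcard]
    simp only [Sum.elim_inl, Sum.elim_inr] at hy1 hy2
    push_cast
    rw [hy1, hy2]
    exact voteStep_invariant h1 h2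

/-- A value taken by more than half of `m` wires is the result of the vote. -/
def vote (hB : 1 < B) (m : ℕ) : WordProg (Fin B) ρ (Fin m) Unit :=
  seq (voteState hB m) (wire fun _ => false)

theorem eval_vote (hB : 1 < B) (O : Fin B → ρ → Fin B) (v : Fin B) (m : ℕ) (hm : m < B)
    (x : Fin m → Fin B) (hv : m < 2 * (Finset.univ.filter fun i => x i = v).card) :
    (vote hB m).eval O x = fun _ => v := by
  funext u
  have h := (eval_voteState hB O v m hm x).2
  show (voteState hB m).eval O x false = v
  by_contra hne
  rw [if_neg hne] at h
  omega

theorem time_vote (hB : 1 < B) (m : ℕ) :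
    (vote hB m : WordProg (Fin B) ρ _ _).time = 5 * m + 1 := by
  simp [vote, time, time_voteState]

theorem queries_vote (hB : 1 < B) (m : ℕ) :
    (vote hB m : WordProg (Fin B) ρ _ _).queries = 0 := by
  simp [vote, queries, queries_voteState]

end Majority

end WordProg

/-! ### Uniform probability and amplification by voting -/

section UniformProbability

theorem unifProb_eq {Ω : Type} [Fintype Ω] (P : Ω → Prop) [DecidablePred P] :
    unifProb P = ((Finset.univ.filter P).card : ℝ) / Fintype.card Ω := by
  rw [unifProb]
  congr 2
  rw [← Set.ncard_coe_finset]
  congr 1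
  ext
  simp

theorem unifProb_mono {Ω : Type} [Fintype Ω] {P Q : Ω → Prop} (h : ∀ ω, P ω → Q ω) :
    unifProb P ≤ unifProb Q := by
  unfold unifProb
  gcongr
  · exact Set.toFinite _
  · exact h _

theorem unifProb_equiv {Ω Ω' : Type} [Fintype Ω] [Fintype Ω'] (e : Ω ≃ Ω') (P : Ω' → Prop) :
    unifProb (fun ω => P (e ω)) = unifProb P := by
  unfold unifProb
  rw [Fintype.card_congr e]
  congr 2
  exact Set.ncard_congr' (e.subtypeEquiv fun _ => Iff.rfl)

theorem unifProb_not {Ω : Type} [Fintype Ω] [Nonempty Ω] (P : Ω → Prop) :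
    unifProb (fun ω => ¬ P ω) = 1 - unifProb P := by
  classical
  rw [unifProb_eq, unifProb_eq, Finset.filter_not, Finset.card_sdiff_of_subset (Finset.filter_subset _ _),
    Nat.cast_sub (Finset.card_le_card (Finset.filter_subset _ _)), Finset.card_univ, sub_div,
    div_self (by exact_mod_cast Fintype.card_ne_zero)]

theorem unifProb_exists_le {Ω ι : Type} [Fintype Ω] [Fintype ι] (P : ι → Ω → Prop) :
    unifProb (fun ω => ∃ i, P i ω) ≤ ∑ i, unifProb (P i) := by
  classical
  simp only [unifProb_eq]
  rw [← Finset.sum_div]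
  gcongr
  have : (Finset.univ.filter fun ω => ∃ i, P i ω) =
      Finset.univ.biUnion fun i => Finset.univ.filter (P i) := by
    ext; simp
  rw [this]
  exact_mod_cast Finset.card_biUnion_le

theorem unifProb_coord {Ω ι : Type} [Fintype Ω] [Nonempty Ω] [Fintype ι] [DecidableEq ι] (i : ι)
    (P : Ω → Prop) : unifProb (fun η : ι → Ω => P (η i)) = unifProb P := by
  classical
  rw [← unifProb_equiv (Equiv.funSplitAt i Ω).symm]
  have : ∀ x : Ω × ({j // j ≠ i} → Ω), ((Equiv.funSplitAt i Ω).symm x) i = x.1 := by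
    intro x; simp [Equiv.funSplitAt]
  simp only [this]
  rw [unifProb_eq, unifProb_eq, Fintype.card_prod]
  have h : (Finset.univ.filter fun x : Ω × ({j // j ≠ i} → Ω) => P x.1) =
      (Finset.univ.filter P) ×ˢ Finset.univ := by
    ext; simp
  rw [h, Finset.card_product, Finset.card_univ]
  push_cast
  rw [mul_div_mul_right]
  exact_mod_cast Fintype.card_ne_zero

/-- An exponential moment bound. A failing run has weight 2 and a successful one weight 1, so the
mean weight is at most 4/3. If at least r of the 2r runs fail, the product of the weights is at
least 2 ^ r; Markov's inequality gives (4/3) ^ (2r) / 2 ^ r = (8/9) ^ r. -/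
theorem unifProb_votes_le {Ω : Type} [Fintype Ω] [Nonempty Ω] (P : Ω → Prop)
    [DecidablePred P] (hP : 2 / 3 ≤ unifProb P) (r : ℕ) :
    unifProb (fun η : Fin (2 * r) → Ω =>
      2 * (Finset.univ.filter fun k => P (η k)).card ≤ 2 * r) ≤ (8 / 9) ^ r := by
  have hΩ : (0 : ℝ) < Fintype.card Ω := by exact_mod_cast Fintype.card_pos
  set w : Ω → ℝ := fun ω => if P ω then 1 else 2 with hw
  have hw0 : ∀ ω, 0 ≤ w ω := fun ω => by simp only [hw]; split_ifs <;> norm_num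
  have hsum : ∑ ω, w ω ≤ 4 / 3 * Fintype.card Ω := by
    have h1 : ∑ ω, w ω = 2 * Fintype.card Ω - (Finset.univ.filter P).card := by
      have : ∀ ω, w ω = 2 - if P ω then 1 else 0 := fun ω => by
        simp only [hw]; split_ifs <;> norm_num
      simp only [this, Finset.sum_sub_distrib, Finset.sum_const, Finset.card_univ, nsmul_eq_mul,
        Finset.sum_boole]
      ring
    have h2 := hP
    rw [unifProb_eq, le_div_iff₀ hΩ] at h2
    rw [h1]
    linarith
  have hprod : ∑ η : Fin (2 * r) → Ω, ∏ k, w (η k) = (∑ ω, w ω) ^ (2 * r) := by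
    have := Finset.prod_univ_sum (fun _ : Fin (2 * r) => (Finset.univ : Finset Ω))
      (fun _ ω => w ω)
    simp only [Finset.prod_const, Finset.card_univ, Fintype.card_fin, Fintype.piFinset_univ] at this
    exact this.symm
  have hlow : ∀ η : Fin (2 * r) → Ω, 2 * (Finset.univ.filter fun k => P (η k)).card ≤ 2 * r →
      (2 : ℝ) ^ r ≤ ∏ k, w (η k) := by
    intro η hη
    have h1 : ∏ k, w (η k) = 2 ^ (Finset.univ.filter fun k => ¬ P (η k)).card := by
      simp only [hw, Finset.prod_ite, Finset.prod_const, one_pow, one_mul]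
    rw [h1]
    apply pow_le_pow_right₀ (by norm_num)
    have := Finset.card_filter_add_card_filter_not (s := Finset.univ) (fun k => P (η k))
    simp only [Finset.card_univ, Fintype.card_fin] at this
    omega
  rw [unifProb_eq, div_le_iff₀ (by exact_mod_cast Fintype.card_pos)]
  set bad := Finset.univ.filter fun η : Fin (2 * r) → Ω =>
      2 * (Finset.univ.filter fun k => P (η k)).card ≤ 2 * r with hbad
  have h1 : (bad.card : ℝ) * 2 ^ r ≤ (4 / 3 * Fintype.card Ω) ^ (2 * r) := by
    calc (bad.card : ℝ) * 2 ^ r = ∑ η ∈ bad, (2 : ℝ) ^ r := by simp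
      _ ≤ ∑ η ∈ bad, ∏ k, w (η k) := Finset.sum_le_sum fun η hη => hlow η (by simpa [hbad] using hη)
      _ ≤ ∑ η : Fin (2 * r) → Ω, ∏ k, w (η k) := Finset.sum_le_sum_of_subset_of_nonneg (Finset.subset_univ _)
          fun η _ _ => Finset.prod_nonneg fun k _ => hw0 _
      _ = (∑ ω, w ω) ^ (2 * r) := hprod
      _ ≤ _ := pow_le_pow_left₀ (Finset.sum_nonneg fun ω _ => hw0 ω) hsum _
  have h2 : (4 / 3 * (Fintype.card Ω : ℝ)) ^ (2 * r) =
      (8 / 9) ^ r * (Fintype.card Ω : ℝ) ^ (2 * r) * 2 ^ r := by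
    rw [mul_pow, pow_mul (4 / 3 : ℝ), mul_right_comm, ← mul_pow]
    norm_num
  rw [h2] at h1
  rw [Fintype.card_fun, Fintype.card_fin, Nat.cast_pow]
  exact le_of_mul_le_mul_right h1 (by positivity)

theorem unifProb_forall_votes {Ω : Type} [Fintype Ω] [Nonempty Ω] {D r : ℕ}
    (P : Fin D → Ω → Prop) [∀ p, DecidablePred (P p)] (hP : ∀ p, 2 / 3 ≤ unifProb (P p))
    (hr : (D : ℝ) * (8 / 9) ^ r ≤ 1 / 3) :
    2 / 3 ≤ unifProb (fun η : Fin D → Fin (2 * r) → Ω =>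
      ∀ p, 2 * r < 2 * (Finset.univ.filter fun k => P p (η p k)).card) := by
  have h1 : unifProb (fun η : Fin D → Fin (2 * r) → Ω =>
      ¬ ∀ p, 2 * r < 2 * (Finset.univ.filter fun k => P p (η p k)).card) ≤ 1 / 3 := by
    simp only [not_forall, not_lt]
    refine (unifProb_exists_le _).trans (le_trans ?_ hr)
    calc _ ≤ ∑ _p : Fin D, ((8 : ℝ) / 9) ^ r := by
          refine Finset.sum_le_sum fun p _ => ?_
          rw [unifProb_coord p fun η : Fin (2 * r) → Ω =>
            2 * (Finset.univ.filter fun k => P p (η k)).card ≤ 2 * r]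
          exact unifProb_votes_le (P p) (hP p) r
      _ = _ := by simp
  rw [unifProb_not] at h1
  linarith

end UniformProbability

/-! ### From a sampling wiring to list recovery -/

section ListRecovery

/-- For each set `X` of new coordinates of density at most `β`, all but a fraction `γ` of the
blocks have at most a fraction `α` of their edges in `X`. -/
def IsWiringSampler {n₁ n₀ N D : ℕ} (π : Fin n₁ × Fin n₀ ≃ Fin N × Fin D) (β α γ : ℝ) : Prop :=
  ∀ X : Set (Fin N), (X.ncard : ℝ) / N ≤ β →
    (({b | ¬ (({q | (π (b, q)).1 ∈ X} : Set (Fin n₀)).ncard : ℝ) / n₀ ≤ α} :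
      Set (Fin n₁)).ncard : ℝ) / n₁ ≤ γ

variable {M A₀ A₁ : Type} {n₁ n₀ N D : ℕ} {π : Fin n₁ × Fin n₀ ≃ Fin N × Fin D}
  {E₁ : M → Fin n₁ → A₁} {E₀ : A₁ → Fin n₀ → A₀} {β α γ : ℝ}

theorem wiredEncoder_apply (z : M) (b : Fin n₁) (q : Fin n₀) :
    wiredEncoder π E₁ E₀ z (π (b, q)).1 (π (b, q)).2 = E₀ (E₁ z b) q := by
  simp [wiredEncoder]

theorem wiredEncoder_injective (h₁ : Function.Injective E₁) (h₀ : Function.Injective E₀) :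
    Function.Injective (wiredEncoder π E₁ E₀) := by
  intro z z' h
  apply h₁
  funext b
  apply h₀
  funext q
  rw [← wiredEncoder_apply (π := π) (E₁ := E₁) (E₀ := E₀), h, wiredEncoder_apply]

/-- The sampler is applied to the set of new coordinates at which the codeword of z misses its list.
A position of a block can only be wrong if its edge ends in this set, so every unexceptional block
satisfies the premise of `hU`. -/
theorem IsWiringSampler.listDist_le (hπ : IsWiringSampler π β α γ)
    (S : Fin N → Set (Fin D → A₀)) (U : Fin n₁ → Set A₁)
    (hU : ∀ b a, listDist (E₀ a) (fun q => (fun v => v (π (b, q)).2) '' S (π (b, q)).1) ≤ α →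
      a ∈ U b) (z : M) (hz : listDist (wiredEncoder π E₁ E₀ z) S ≤ β) :
    listDist (E₁ z) U ≤ γ := by
  refine le_trans ?_ (hπ _ hz)
  unfold listDist
  refine div_le_div_of_nonneg_right ?_ (Nat.cast_nonneg _)
  refine Nat.cast_le.2 (Set.ncard_le_ncard (fun b hb h => hb (hU b _ (le_trans ?_ h)))
    (Set.toFinite _))
  unfold listDist
  refine div_le_div_of_nonneg_right ?_ (Nat.cast_nonneg _)
  exact Nat.cast_le.2 (Set.ncard_le_ncard
    (fun q hq hS => hq ⟨_, hS, wiredEncoder_apply z b q⟩) (Set.toFinite _))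

theorem IsWiringSampler.listRecoverable [Fintype A₀] [Fintype A₁] (hπ : IsWiringSampler π β α γ)
    (hE₀ : Function.Injective E₀) {ℓ ℓ₁ L : ℕ}
    (h₀ : ListRecoverable (Set.range E₀) α ℓ ℓ₁) (h₁ : ListRecoverable (Set.range E₁) γ ℓ₁ L) :
    ListRecoverable (Set.range (wiredEncoder π E₁ E₀)) β ℓ L := by
  classical
  intro S hS
  set T : Fin n₁ → Fin n₀ → Finset A₀ := fun b q =>
    (S (π (b, q)).1).image fun v => v (π (b, q)).2 with hT
  set U : Fin n₁ → Finset A₁ := fun b =>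
    Finset.univ.filter fun a => listDist (E₀ a) (fun q => (T b q : Set A₀)) ≤ α with hU
  have hUcard : ∀ b, (U b).card ≤ ℓ₁ := by
    intro b
    have h := h₀ (T b) fun q => Finset.card_image_le.trans (hS _)
    have h2 : ((U b : Set A₁)).encard ≤
        ({c | c ∈ Set.range E₀ ∧ listDist c (fun i => (T b i : Set A₀)) ≤ α} :
          Set (Fin n₀ → A₀)).encard := by
      rw [← hE₀.encard_image]
      apply Set.encard_le_encard
      rintro _ ⟨a, ha, rfl⟩
      exact ⟨⟨a, rfl⟩, by simpa [hU] using ha⟩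
    have h3 := h2.trans h
    rw [Set.encard_coe_eq_coe_finsetCard] at h3
    exact_mod_cast h3
  refine le_trans ?_ (h₁ U hUcard)
  -- A wired codeword is a function of the outer codeword alone, so the wired candidates lie in the
  -- image of the outer ones and there are no more of them.
  have hsub : {c | c ∈ Set.range (wiredEncoder π E₁ E₀) ∧
      listDist c (fun i => (S i : Set (Fin D → A₀))) ≤ β} ⊆
      (fun (x : Fin n₁ → A₁) (j : Fin N) (p : Fin D) =>
        E₀ (x (π.symm (j, p)).1) (π.symm (j, p)).2) ''
      {c | c ∈ Set.range E₁ ∧ listDist c (fun i => (U i : Set A₁)) ≤ γ} := by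
    rintro _ ⟨⟨z, rfl⟩, hz⟩
    refine ⟨E₁ z, ⟨⟨z, rfl⟩, hπ.listDist_le _ _ (fun b a h => ?_) z hz⟩, rfl⟩
    simpa [hU, hT] using h
  exact (Set.encard_le_encard hsub).trans (Set.encard_image_le _ _)

/-- The input lists of the block `b`. -/
def blockLists {ℓ : ℕ} (π : Fin n₁ × Fin n₀ ≃ Fin N × Fin D) (S : Fin N → Fin ℓ → Fin D → A₀)
    (b : Fin n₁) (q : Fin n₀) (k : Fin ℓ) : A₀ :=
  S (π (b, q)).1 k (π (b, q)).2

theorem IsWiringSampler.listDist_range_le (hπ : IsWiringSampler π β α γ) {ℓ ℓ₁ : ℕ}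
    (S : Fin N → Fin ℓ → Fin D → A₀) (out : Fin n₁ → Fin ℓ₁ → A₁)
    (hout : ∀ b a, listDist (E₀ a) (fun q => Set.range (blockLists π S b q)) ≤ α →
      ∃ k, out b k = a)
    (z : M) (hz : listDist (wiredEncoder π E₁ E₀ z) (fun j => Set.range (S j)) ≤ β) :
    listDist (E₁ z) (fun b => Set.range (out b)) ≤ γ := by
  refine hπ.listDist_le (fun j => Set.range (S j)) _ (fun b a h => hout b a ?_) z hz
  simp only [← Set.range_comp] at h
  exact h

theorem IsWiringSampler.listRecoverableInTime (hπ : IsWiringSampler π β α γ) {B : ℕ} {μ : Type}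
    {e₀ : WordEnc A₀ Unit B} {e₁ : WordEnc A₁ Unit B} {eM : WordEnc M μ B} {ℓ ℓ₁ L T₀ T₁ : ℕ}
    (h₀ : ListRecoverableInTime E₀ e₀ e₁ α ℓ ℓ₁ T₀)
    (h₁ : ListRecoverableInTime E₁ e₁ eM γ ℓ₁ L T₁) :
    ListRecoverableInTime (wiredEncoder π E₁ E₀) (e₀.vec D) eM β ℓ L (n₁ * T₀ + T₁) := by
  obtain ⟨p₀, hp₀, h₀⟩ := h₀
  obtain ⟨p₁, hp₁, h₁⟩ := h₁
  refine ⟨.seq (.wire fun x : Fin n₁ × Fin n₀ × Fin ℓ × Unit =>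
      ((π (x.1, x.2.1)).1, x.2.2.1, ((π (x.1, x.2.1)).2, x.2.2.2)))
    (.seq (.bigPar n₁ fun _ => p₀) p₁), ?_, fun S => ?_⟩
  · simp only [WordProg.time, WordProg.time_bigPar, Finset.sum_const, Finset.card_univ,
      Fintype.card_fin, smul_eq_mul, zero_add]
    gcongr
  · choose out hout hout' using fun b => h₀ (blockLists π S b)
    obtain ⟨res, hres, hres'⟩ := h₁ out
    refine ⟨res, ?_, fun z hz => hres' z (hπ.listDist_range_le S out hout' z hz)⟩
    rw [← hres]
    simp only [WordProg.eval, WordProg.eval_bigPar]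
    congr 1
    funext y
    exact congrFun (hout y.1) y.2

/-- A query to a list of the outer code is answered by means of queries to the lists of the wired
code and of the list-recovery program of the inner code. -/
def outerQuery {B ℓ ℓ₁ : ℕ} (addr : Fin n₀ → Fin B → Fin B) (comp : Fin n₀ → Fin D)
    (p₀ : WordProg (Fin B) Empty (Fin n₀ × Fin ℓ × Unit) (Fin ℓ₁ × Unit)) :
    WordProg (Fin B) (Fin ℓ × Fin D × Unit) Unit (Fin ℓ₁ × Unit) :=
  .seq (.wire fun _ : Fin n₀ × Unit => ())
    (.seq (.bigPar n₀ fun q => .seq (.unary (addr q)) .query)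
      (.seq (.wire fun x : Fin n₀ × Fin ℓ × Unit => (x.1, x.2.1, (comp x.1, x.2.2)))
        (.lift p₀)))

theorem time_outerQuery {B ℓ ℓ₁ : ℕ} (addr : Fin n₀ → Fin B → Fin B) (comp : Fin n₀ → Fin D)
    (p₀ : WordProg (Fin B) Empty (Fin n₀ × Fin ℓ × Unit) (Fin ℓ₁ × Unit)) :
    (outerQuery addr comp p₀).time ≤ 2 * n₀ + p₀.time := by
  have h := WordProg.time_lift (ρ := Fin ℓ × Fin D × Unit) p₀
  simp only [outerQuery, WordProg.time, WordProg.time_bigPar, WordProg.unary, Finset.sum_const,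
    Finset.card_univ, Fintype.card_fin, smul_eq_mul]
  omega

theorem queries_outerQuery {B ℓ ℓ₁ : ℕ} (addr : Fin n₀ → Fin B → Fin B) (comp : Fin n₀ → Fin D)
    (p₀ : WordProg (Fin B) Empty (Fin n₀ × Fin ℓ × Unit) (Fin ℓ₁ × Unit)) :
    (outerQuery addr comp p₀).queries = n₀ := by
  simp only [outerQuery, WordProg.queries, WordProg.queries_bigPar, WordProg.unary,
    WordProg.queries_lift, Finset.sum_const,
    Finset.card_univ, Fintype.card_fin, smul_eq_mul]
  omega

/-- The local decoder of one component of a symbol: `r` independent runs of a local decoder of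
the outer code, followed by a majority vote and by the inner encoder. -/
def componentDecoder {ρ : Type} {B s c : ℕ} (hB : 1 < B) (r : ℕ) (blk : Fin B → Fin B)
    (fin : Fin B → Fin B → Fin B)
    (run : WordProg (Fin B) ρ (Fin s ⊕ Unit ⊕ Fin c) Unit) :
    WordProg (Fin B) ρ (Fin s ⊕ Unit ⊕ Fin r × Fin c) Unit :=
  .seq (.push (fun w _ => blk w) (Sum.inr (Sum.inl ())) (Sum.inr (Sum.inl ())))
    (.seq (.wire fun x : Unit ⊕ Fin r × (Fin s ⊕ Unit ⊕ Fin c) =>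
        Sum.elim (fun _ => Sum.inl (Sum.inr (Sum.inl ())))
          (fun y => Sum.elim (fun k => Sum.inl (Sum.inl k))
            (Sum.elim (fun _ => Sum.inr ()) fun k => Sum.inl (Sum.inr (Sum.inr (y.1, k)))) y.2) x)
      (.seq (.par (.wire id)
          (.seq (.bigPar r fun _ => run) (.seq (.wire fun k => (k, ())) (.vote hB r))))
        (.seq (.wire fun b : Bool => bif b then Sum.inl () else Sum.inr ()) (.gate fin))))

theorem time_componentDecoder {ρ : Type} {B s c : ℕ} (hB : 1 < B) (r : ℕ) (blk : Fin B → Fin B)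
    (fin : Fin B → Fin B → Fin B)
    (run : WordProg (Fin B) ρ (Fin s ⊕ Unit ⊕ Fin c) Unit) :
    (componentDecoder hB r blk fin run).time = r * run.time + 5 * r + 3 := by
  simp only [componentDecoder, WordProg.time, WordProg.time_push, WordProg.time_bigPar,
    WordProg.time_vote, Finset.sum_const, Finset.card_univ, Fintype.card_fin, smul_eq_mul]
  omega

theorem queries_componentDecoder {ρ : Type} {B s c : ℕ} (hB : 1 < B) (r : ℕ)
    (blk : Fin B → Fin B) (fin : Fin B → Fin B → Fin B)
    (run : WordProg (Fin B) ρ (Fin s ⊕ Unit ⊕ Fin c) Unit) :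
    (componentDecoder hB r blk fin run).queries = r * run.queries := by
  simp only [componentDecoder, WordProg.queries, WordProg.queries_push, WordProg.queries_bigPar,
    WordProg.queries_vote, Finset.sum_const, Finset.card_univ, Fintype.card_fin, smul_eq_mul]
  omega

theorem eval_componentDecoder {ρ : Type} {B s c : ℕ} (hB : 1 < B) {r : ℕ} (hr : r < B)
    (blk : Fin B → Fin B) (fin : Fin B → Fin B → Fin B)
    (run : WordProg (Fin B) ρ (Fin s ⊕ Unit ⊕ Fin c) Unit) (O : Fin B → ρ → Fin B)
    (σ : Fin s → Fin B) (i : Fin B) (η : Fin r → Fin c → Fin B) (v : Fin B)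
    (hv : r < 2 * (Finset.univ.filter fun k =>
      run.eval O (Sum.elim σ (Sum.elim (fun _ => blk i) (η k))) () = v).card) :
    (componentDecoder hB r blk fin run).eval O
      (Sum.elim σ (Sum.elim (fun _ => i) fun x => η x.1 x.2)) = fun _ => fin v i := by
  have h := WordProg.eval_vote hB O v r hr _ hv
  funext u
  simp only [componentDecoder, WordProg.eval, WordProg.eval_push, WordProg.eval_bigPar, cond_true,
    cond_false, Sum.elim_inl, Sum.elim_inr, id]
  have key : (fun k : Fin r => WordProg.eval O run
      (fun y : Fin s ⊕ Unit ⊕ Fin c =>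
        (Sum.elim (Sum.elim σ (Sum.elim (fun _ : Unit => i) fun x : Fin r × Fin c => η x.1 x.2))
          fun _ : Unit => blk i) (Sum.elim (fun k => Sum.inl (Sum.inl k))
            (Sum.elim (fun _ => Sum.inr ()) fun z => Sum.inl (Sum.inr (Sum.inr (k, z)))) y)) ()) =
      fun k => run.eval O (Sum.elim σ (Sum.elim (fun _ => blk i) (η k))) () := by
    funext k
    congr 2
    funext y
    rcases y with y | y | y <;> rfl
  rw [key, h]

/-- The D components of a symbol may lie in D different blocks; each is decoded by 2r runs of the
outer local decoder, and `hrD` makes all D majorities right together with probability 2/3. The block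
of a simulated outer query is known only at run time whereas wires are fixed in advance, so `hcomp`
is essential: the component to be read must depend on the position q only. -/
theorem IsWiringSampler.locallyListRecoverableInTime (hπ : IsWiringSampler π β α γ)
    (hn₁ : 0 < n₁) (hD : 0 < D) {comp : Fin n₀ → Fin D} (hcomp : ∀ b q, (π (b, q)).2 = comp q)
    {B : ℕ} {e₀ : WordEnc A₀ Unit B} {e₁ : WordEnc A₁ Unit B} {ℓ ℓ₁ L T₀ T₁ t r : ℕ}
    (hN : N ≤ B) (hr : 0 < r) (hrB : 2 * r < B) (hrD : (D : ℝ) * (8 / 9) ^ r ≤ 1 / 3)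
    (h₀ : ListRecoverableInTime E₀ e₀ e₁ α ℓ ℓ₁ T₀)
    (h₁ : LocallyListRecoverableInTime (Set.range E₁) e₁ t γ ℓ₁ L T₁) :
    LocallyListRecoverableInTime (Set.range (wiredEncoder π E₁ E₀)) (e₀.vec D)
      (D * (2 * r) * (t * n₀)) β ℓ L (D * (2 * r) * (7 * (t * (n₀ + T₀) + T₁ + 1))) := by
  classical
  obtain ⟨p₀, hp₀, h₀⟩ := h₀
  obtain ⟨hB, a, c, s, alg, run, halgq, hrunq, halgt, hrunt, h₁⟩ := h₁
  have hB1 : 1 < B := by omega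
  have hNpos : ∀ j : Fin N, 0 < N := fun j => j.pos
  -- The address is reduced modulo n₁ exactly as in `listOracle`, so the simulated oracle is right
  -- on every word and not only on valid coordinates.
  set addr : Fin n₀ → Fin B → Fin B := fun q w =>
    Fin.castLE hN (π (⟨w.val % n₁, Nat.mod_lt _ hn₁⟩, q)).1 with haddr
  set sub := outerQuery (ℓ := ℓ) addr comp p₀ with hsub
  have hblk : ∃ blk : Fin D → Fin B → Fin B, ∀ p j,
      blk p (Fin.castLE hN j) = Fin.castLE hB (π.symm (j, p)).1 :=
    ⟨fun p w => if h : w.val < N then Fin.castLE hB (π.symm (⟨w, h⟩, p)).1 else w,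
      fun p j => by simp⟩
  -- The final gate decodes the word of an outer symbol and applies the inner encoder. A gate may be
  -- any binary function, so the inverse of `e₁` can be taken by choice.
  have hfin : ∃ fin : Fin D → Fin B → Fin B → Fin B, ∀ p j x,
      fin p (e₁ x ()) (Fin.castLE hN j) = e₀ (E₀ x (π.symm (j, p)).2) () := by
    refine ⟨fun p w i => if h : i.val < N ∧ ∃ x, e₁ x () = w then
      e₀ (E₀ h.2.choose (π.symm (⟨i, h.1⟩, p)).2) () else w, fun p j x => ?_⟩
    have hx : (Fin.castLE hN j).val < N ∧ ∃ y, e₁ y () = e₁ x () := ⟨j.2, x, rfl⟩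
    have : hx.2.choose = x := e₁.injective (funext fun _ => hx.2.choose_spec)
    refine (dif_pos hx).trans ?_
    rw [this]
    rfl
  obtain ⟨blk, hblk⟩ := hblk
  obtain ⟨fin, hfin⟩ := hfin
  -- One fresh batch of c coins for each component and each repetition.
  let ec : Fin (D * (2 * r * c)) ≃ Fin D × Fin (2 * r) × Fin c :=
    finProdFinEquiv.symm.trans (Equiv.prodCongr (Equiv.refl _) finProdFinEquiv.symm)
  set run' := WordProg.subst sub run with hrun'
  have hsubt : sub.time ≤ 2 * n₀ + T₀ := (time_outerQuery addr comp p₀).trans (by omega)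
  have hsubq : sub.queries = n₀ := queries_outerQuery addr comp p₀
  have hDr : 1 ≤ D * (2 * r) := Nat.mul_pos hD (by omega)
  have key : ∀ (q : ℕ) (T : ℕ), q ≤ t → T ≤ T₁ → T + q * sub.time ≤
      T₁ + t * (2 * n₀ + T₀) := fun q T hq hT => add_le_add hT (Nat.mul_le_mul hq hsubt)
  have key2 : T₁ + t * (2 * n₀ + T₀) ≤ 2 * (t * (n₀ + T₀) + T₁) := by
    have : t * (2 * n₀ + T₀) ≤ t * (2 * (n₀ + T₀)) := Nat.mul_le_mul_left _ (by omega)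
    have h2 : t * (2 * (n₀ + T₀)) = 2 * (t * (n₀ + T₀)) := by ring
    omega
  refine ⟨hN, a, D * (2 * r * c), s, WordProg.subst sub alg,
    .seq (.wire fun x : Fin D × (Fin s ⊕ Unit ⊕ Fin (2 * r) × Fin c) =>
      Sum.elim (fun k => Sum.inl k) (Sum.elim (fun u => Sum.inr (Sum.inl u))
        fun k => Sum.inr (Sum.inr (ec.symm (x.1, k)))) x.2)
      (.bigPar D fun p => componentDecoder hB1 (2 * r) (blk p) (fin p) run'), ?_, ?_, ?_, ?_, ?_⟩
  · rw [WordProg.queries_subst, hsubq]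
    exact (Nat.mul_le_mul_right n₀ halgq).trans (Nat.le_mul_of_pos_left _ hDr)
  · simp only [WordProg.queries, WordProg.queries_bigPar, queries_componentDecoder, hrun',
      WordProg.queries_subst, hsubq, Finset.sum_const, Finset.card_univ, Fintype.card_fin,
      smul_eq_mul, zero_add]
    rw [mul_assoc D]
    exact Nat.mul_le_mul_left _ (Nat.mul_le_mul_left _ (Nat.mul_le_mul_right _ hrunq))
  · refine (WordProg.time_subst _ _).trans ((key _ _ halgq halgt).trans (key2.trans ?_))
    refine le_trans ?_ (Nat.le_mul_of_pos_left _ hDr)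
    omega
  · simp only [WordProg.time, WordProg.time_bigPar, time_componentDecoder, Finset.sum_const,
      Finset.card_univ, Fintype.card_fin, smul_eq_mul, zero_add]
    rw [mul_assoc D]
    refine Nat.mul_le_mul_left _ ?_
    have h := (WordProg.time_subst sub run).trans ((key _ _ hrunq hrunt).trans key2)
    -- Five steps per vote and three further steps are absorbed by the 7, since 3 ≤ 2 · (2r) for r >
    -- 0.
    calc 2 * r * run'.time + 5 * (2 * r) + 3
        ≤ 2 * r * (2 * (t * (n₀ + T₀) + T₁)) + 5 * (2 * r) + 2 * (2 * r) := by gcongr; omega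
      _ = 2 * r * (2 * (t * (n₀ + T₀) + T₁) + 7) := by ring
      _ ≤ _ := Nat.mul_le_mul_left _ (by omega)
  · rintro S _ ⟨z, rfl⟩ hz
    choose out hout hout' using fun b => h₀ (blockLists π S b)
    -- The simulated oracle is literally the oracle of the lists `out`, so both outer programs
    -- behave as they would on these lists.
    have hor : (fun w => sub.eval (listOracle (e₀.vec D) S) fun _ => w) = listOracle e₁ out := by
      funext w y
      rw [listOracle, dif_pos hn₁, ← congrFun (hout ⟨w.val % n₁, Nat.mod_lt _ hn₁⟩) y]
      simp only [hsub, outerQuery, WordProg.eval, WordProg.eval_lift, WordProg.eval_bigPar,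
        WordProg.eval_unary]
      congr 1
      funext x
      have hj := (π (⟨w.val % n₁, Nat.mod_lt _ hn₁⟩, x.1)).1
      simp only [listOracle, dif_pos (hNpos hj), haddr, blockLists, hcomp]
      simp only [Fin.val_castLE, Nat.mod_eq_of_lt (Fin.is_lt _)]
      rfl
    have hd := h₁ out (E₁ z) ⟨z, rfl⟩ (hπ.listDist_range_le S out hout' z hz)
    simp only [WordProg.eval_subst, hor]
    -- The first-stage coins and the index j are those of the outer algorithm; only the second-stage
    -- probability has to be amplified.
    refine hd.trans (unifProb_mono fun ω => ?_)
    rintro ⟨j, hj⟩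
    refine ⟨j, fun i => ?_⟩
    set σ : Fin s → Fin B := fun k => alg.eval (listOracle e₁ out) ω (j, k) with hσ
    let P : Fin D → (Fin c → Fin B) → Prop := fun p η =>
      run.eval (listOracle e₁ out) (Sum.elim σ (Sum.elim
        (fun _ => Fin.castLE hB (π.symm (i, p)).1) η)) () = e₁ (E₁ z (π.symm (i, p)).1) ()
    have : Nonempty (Fin B) := ⟨⟨0, by omega⟩⟩
    have hP : ∀ p, 2 / 3 ≤ unifProb (P p) := fun p =>
      (hj (π.symm (i, p)).1).trans (unifProb_mono fun η hη => congrFun hη ())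
    refine (unifProb_forall_votes P hP hrD).trans ?_
    let eη : (Fin (D * (2 * r * c)) → Fin B) ≃ (Fin D → Fin (2 * r) → Fin c → Fin B) :=
      (Equiv.arrowCongr ec (Equiv.refl _)).trans ((Equiv.curry _ _ _).trans
        (Equiv.arrowCongr (Equiv.refl _) (Equiv.curry _ _ _)))
    rw [← unifProb_equiv eη]
    refine unifProb_mono fun η hη => ?_
    simp only [WordProg.eval, WordProg.eval_bigPar]
    funext ⟨p, u⟩
    have hv := hη p
    have := eval_componentDecoder hB1 hrB (blk p) (fin p) run' (listOracle (e₀.vec D) S) σ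
      (Fin.castLE hN i) (eη η p) (e₁ (E₁ z (π.symm (i, p)).1) ())
      (by simpa only [hrun', WordProg.eval_subst, hor, hblk] using hv)
    rw [hfin] at this
    have h2 := congrFun this u
    refine Eq.trans ?_ h2
    congr 1
    funext y
    rcases y with y | y | y <;> rfl

end ListRecovery

/-! ### Spectral bound for shears of the torus -/

section ShearExpander

open Finset ComplexConjugate

variable {m : ℕ} [NeZero m]

/-- The Fourier transform on `(ℤ / m) ^ 2`. -/
noncomputable def planeFourier (f : ZMod m → ZMod m → ℂ) (a b : ZMod m) : ℂ :=
  ∑ x, (∑ y, f x y * ZMod.stdAddChar (-(b * y))) * ZMod.stdAddChar (-(a * x))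

theorem norm_stdAddChar (x : ZMod m) : ‖(ZMod.stdAddChar x : ℂ)‖ = 1 :=
  AddChar.norm_apply _ _

theorem sum_norm_sq_fourier (g : ZMod m → ℂ) :
    ∑ a : ZMod m, ‖∑ x, g x * ZMod.stdAddChar (-(a * x))‖ ^ 2 = m * ∑ x, ‖g x‖ ^ 2 := by
  have horth : ∀ x y : ZMod m, ∑ a : ZMod m, ZMod.stdAddChar (a * (y - x)) =
      if x = y then (m : ℂ) else 0 := by
    intro x y
    rw [AddChar.sum_mulShift _ (ZMod.isPrimitive_stdAddChar m), ZMod.card]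
    simp only [sub_eq_zero, eq_comm]
    split_ifs <;> simp
  have hC : ((∑ a : ZMod m, ‖∑ x, g x * ZMod.stdAddChar (-(a * x))‖ ^ 2 : ℝ) : ℂ) =
      ((m * ∑ x, ‖g x‖ ^ 2 : ℝ) : ℂ) := by
    push_cast
    have hterm : ∀ a : ZMod m, ((‖∑ x, g x * ZMod.stdAddChar (-(a * x))‖ : ℝ) : ℂ) ^ 2 =
        ∑ x, ∑ y, g x * conj (g y) * ZMod.stdAddChar (a * (y - x)) := by
      intro a
      rw [← Complex.mul_conj', map_sum, sum_mul_sum]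
      refine sum_congr rfl fun x _ => sum_congr rfl fun y _ => ?_
      rw [map_mul, ← AddChar.map_neg_eq_conj, mul_sub, sub_eq_add_neg, AddChar.map_add_eq_mul]
      ring_nf
    simp only [hterm]
    rw [sum_comm]
    simp only [sum_comm (s := (univ : Finset (ZMod m))) (t := (univ : Finset (ZMod m)))
      (f := fun a y => g _ * conj (g y) * ZMod.stdAddChar (a * (y - _)))]
    simp only [← mul_sum, horth]
    rw [mul_sum]
    refine sum_congr rfl fun x _ => ?_
    simp only [mul_ite, mul_zero, sum_ite_eq, mem_univ, if_true]
    rw [Complex.mul_conj']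
    ring
  exact_mod_cast hC

theorem sum_norm_sq_planeFourier (f : ZMod m → ZMod m → ℂ) :
    ∑ a, ∑ b, ‖planeFourier f a b‖ ^ 2 = m ^ 2 * ∑ x, ∑ y, ‖f x y‖ ^ 2 := by
  rw [sum_comm]
  simp only [planeFourier, sum_norm_sq_fourier]
  rw [← mul_sum, sum_comm]
  simp only [sum_norm_sq_fourier]
  rw [← mul_sum]
  ring

theorem planeFourier_swap (f : ZMod m → ZMod m → ℂ) (a b : ZMod m) :
    planeFourier (fun x y => f y x) a b = planeFourier f b a := by
  simp only [planeFourier, sum_mul]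
  rw [sum_comm]
  refine sum_congr rfl fun x _ => sum_congr rfl fun y _ => ?_
  ring

theorem planeFourier_zero (f : ZMod m → ZMod m → ℂ) :
    planeFourier f 0 0 = ∑ x, ∑ y, f x y := by
  simp [planeFourier]

/-- The sum of `f` over `D ^ 3` sheared and translated copies. -/
noncomputable def shearSum (D : ℕ) (f : ZMod m → ZMod m → ℂ) (x y : ZMod m) : ℂ :=
  ∑ k ∈ range D, ∑ l ∈ range (D ^ 2), f (x + 3 * (k : ZMod m) * y + (l : ZMod m)) y

/-- The Dirichlet kernel. -/
noncomputable def dirichletSum (L : ℕ) (a : ZMod m) : ℂ :=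
  ∑ l ∈ range L, ZMod.stdAddChar (a * (l : ZMod m))

/-- Translation by l multiplies the transform by a character of a, and summing over l gives the
Dirichlet kernel. The shear x ↦ x + 3ky acts on frequencies by the transposed shear, which leaves a
fixed and moves b by a multiple of a. -/
theorem planeFourier_shearSum (D : ℕ) (f : ZMod m → ZMod m → ℂ) (a b : ZMod m) :
    planeFourier (shearSum D f) a b =
      dirichletSum (D ^ 2) a * ∑ k ∈ range D, planeFourier f a (b - 3 * (k : ZMod m) * a) := by
  have h1 : planeFourier (shearSum D f) a b = ∑ k ∈ range D, ∑ l ∈ range (D ^ 2),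
      ∑ y, ∑ x, f (x + 3 * (k : ZMod m) * y + (l : ZMod m)) y * ZMod.stdAddChar (-(b * y)) *
        ZMod.stdAddChar (-(a * x)) := by
    simp only [planeFourier, shearSum, sum_mul]
    rw [sum_comm]
    simp only [sum_comm (t := range D)]
    refine sum_congr rfl fun k _ => ?_
    simp only [sum_comm (t := range (D ^ 2))]
  rw [h1, dirichletSum, mul_sum]
  refine sum_congr rfl fun k _ => ?_
  rw [sum_mul]
  refine sum_congr rfl fun l _ => ?_
  simp only [planeFourier, sum_mul, mul_sum]
  conv_rhs => rw [sum_comm]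
  refine sum_congr rfl fun y _ => ?_
  rw [← Equiv.sum_comp (Equiv.addRight (3 * (k : ZMod m) * y + (l : ZMod m)))
    fun x => ZMod.stdAddChar (a * (l : ZMod m)) * (f x y * ZMod.stdAddChar (-((b - 3 * (k : ZMod m) * a) * y)) *
        ZMod.stdAddChar (-(a * x)))]
  refine sum_congr rfl fun x _ => ?_
  simp only [Equiv.coe_addRight, ← add_assoc]
  have : (ZMod.stdAddChar (-(b * y)) * ZMod.stdAddChar (-(a * x)) : ℂ) =
      ZMod.stdAddChar (a * (l : ZMod m)) * (ZMod.stdAddChar (-((b - 3 * (k : ZMod m) * a) * y)) *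
        ZMod.stdAddChar (-(a * (x + 3 * (k : ZMod m) * y + (l : ZMod m))))) := by
    rw [← AddChar.map_add_eq_mul, ← AddChar.map_add_eq_mul, ← AddChar.map_add_eq_mul]
    congr 1
    ring
  rw [mul_assoc, this]
  ring

/-- The distance to zero in `ℤ / m`. -/
def cycAbs (a : ZMod m) : ℕ := a.valMinAbs.natAbs

theorem norm_dirichletSum_le (L : ℕ) (a : ZMod m) : ‖dirichletSum L a‖ ≤ L := by
  refine (norm_sum_le _ _).trans ?_
  simp

/-- The geometric series gives ‖dirichletSum L a‖ · |z - 1| ≤ 2 for z the character value at a, and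
|z - 1| = 2|sin(πa/m)| ≥ 4|a|/m by Jordan's inequality, |a| being the cyclic distance to 0. -/
theorem norm_dirichletSum_mul_le (L : ℕ) (a : ZMod m) :
    ‖dirichletSum L a‖ * (2 * cycAbs a) ≤ m := by
  have hm : (0 : ℝ) < m := by exact_mod_cast Nat.pos_of_ne_zero (NeZero.ne m)
  set z : ℂ := ZMod.stdAddChar a with hz
  have hgeom : dirichletSum L a = ∑ l ∈ range L, z ^ l := by
    refine sum_congr rfl fun l _ => ?_
    rw [hz, ← AddChar.map_nsmul_eq_pow, nsmul_eq_mul, mul_comm]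
  have h1 : ‖dirichletSum L a‖ * ‖z - 1‖ ≤ 2 := by
    rw [hgeom, ← norm_mul, geom_sum_mul]
    refine (norm_sub_le _ _).trans ?_
    rw [norm_pow, norm_stdAddChar]
    norm_num
  have hza : z = Complex.exp (Complex.I * ((2 * Real.pi * a.valMinAbs / m : ℝ) : ℂ)) := by
    have h := ZMod.stdAddChar_coe (N := m) a.valMinAbs
    rw [ZMod.coe_valMinAbs] at h
    rw [hz, h]
    congr 1
    push_cast
    ring
  have h2 : 4 * (cycAbs a : ℝ) / m ≤ ‖z - 1‖ := by
    rw [hza, Complex.norm_exp_I_mul_ofReal_sub_one, Real.norm_eq_abs, abs_mul, abs_two,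
      show 2 * Real.pi * (a.valMinAbs : ℝ) / m / 2 = Real.pi * a.valMinAbs / m by ring]
    have habs : |Real.sin (Real.pi * a.valMinAbs / m)| = Real.sin (Real.pi * cycAbs a / m) := by
      have hc : (cycAbs a : ℝ) = |(a.valMinAbs : ℝ)| := by
        rw [cycAbs, Nat.cast_natAbs, Int.cast_abs]
      have hle : (cycAbs a : ℝ) ≤ m / 2 := by
        have := ZMod.natAbs_valMinAbs_le a
        have h2 : cycAbs a * 2 ≤ m := (Nat.mul_le_mul_right 2 this).trans (Nat.div_mul_le_self _ _)
        have h3 : (cycAbs a : ℝ) * 2 ≤ m := by exact_mod_cast h2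
        linarith
      have hx0 : 0 ≤ Real.pi * cycAbs a / m := by positivity
      have hx1 : Real.pi * cycAbs a / m ≤ Real.pi := by
        rw [div_le_iff₀ hm]
        exact mul_le_mul_of_nonneg_left (by linarith) Real.pi_pos.le
      rw [← abs_of_nonneg (Real.sin_nonneg_of_nonneg_of_le_pi hx0 hx1), hc]
      rcases abs_choice (a.valMinAbs : ℝ) with h | h
      · rw [h]
      · rw [h, mul_neg, neg_div, Real.sin_neg, abs_neg]
    have hle : (cycAbs a : ℝ) ≤ m / 2 := by
      have := ZMod.natAbs_valMinAbs_le a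
      have h2 : cycAbs a * 2 ≤ m := (Nat.mul_le_mul_right 2 this).trans (Nat.div_mul_le_self _ _)
      have h3 : (cycAbs a : ℝ) * 2 ≤ m := by exact_mod_cast h2
      linarith
    rw [habs]
    have h3 := Real.mul_le_sin (x := Real.pi * cycAbs a / m) (by positivity) (by
      rw [div_le_iff₀ hm]
      nlinarith [Real.pi_pos])
    have h4 : 2 / Real.pi * (Real.pi * cycAbs a / m) = 2 * (cycAbs a : ℝ) / m := by
      field_simp
    rw [h4] at h3
    calc 4 * (cycAbs a : ℝ) / m = 2 * (2 * (cycAbs a : ℝ) / m) := by ring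
      _ ≤ _ := by gcongr
  have h5 : ‖dirichletSum L a‖ * (4 * (cycAbs a : ℝ) / m) ≤ 2 :=
    (mul_le_mul_of_nonneg_left h2 (norm_nonneg _)).trans h1
  rw [← mul_div_assoc, div_le_iff₀ hm] at h5
  linarith

/-- Two frequencies b, b' in the cone differ by at most 2|a|, while different multiples of 3a are at
least 3|a| apart; this is why the shears carry the factor 3. `hD` excludes wrap-around: all
differences are below 3D|a| ≤ m, so the congruence is an equality of integers. -/
theorem cycAbs_shift_inj {D : ℕ} {a b b' : ZMod m} {k k' : ℕ} (ha : a ≠ 0)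
    (hD : 3 * D * cycAbs a ≤ m) (hb : cycAbs b ≤ cycAbs a) (hb' : cycAbs b' ≤ cycAbs a)
    (hk : k < D) (hk' : k' < D) (h : b - 3 * (k : ZMod m) * a = b' - 3 * (k' : ZMod m) * a) : k = k' := by
  have ha0 : 0 < cycAbs a := by
    rw [cycAbs, Int.natAbs_pos]
    rwa [Ne, ZMod.valMinAbs_eq_zero]
  unfold cycAbs at *
  have h1 : ((b.valMinAbs - b'.valMinAbs - 3 * ((k : ℤ) - k') * a.valMinAbs : ℤ) : ZMod m) = 0 := by
    push_cast [ZMod.coe_valMinAbs]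
    linear_combination h
  rw [ZMod.intCast_zmod_eq_zero_iff_dvd] at h1
  generalize b.valMinAbs = u at *
  generalize b'.valMinAbs = u' at *
  generalize a.valMinAbs = w at *
  by_contra hne
  have hkk : 1 ≤ |(k : ℤ) - k'| := Int.one_le_abs (by omega)
  have hkD : |(k : ℤ) - k'| ≤ D - 1 := by rw [abs_le]; omega
  have hu : |u - u'| ≤ 2 * |w| := by
    rw [abs_le]
    constructor <;> cases abs_cases w <;> omega
  have hw : 0 < |w| := by rw [abs_pos]; omega
  have hDm : 3 * (D : ℤ) * |w| ≤ m := by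
    have : (3 * (D : ℤ) * (w.natAbs : ℤ)) ≤ m := by exact_mod_cast hD
    rwa [Int.natCast_natAbs] at this
  have hz := Int.eq_zero_of_abs_lt_dvd h1 (by
    calc |u - u' - 3 * ((k : ℤ) - k') * w| ≤ |u - u'| + |3 * ((k : ℤ) - k') * w| := abs_sub _ _
      _ = |u - u'| + 3 * |(k : ℤ) - k'| * |w| := by rw [abs_mul, abs_mul]; norm_num
      _ ≤ 2 * |w| + 3 * (D - 1) * |w| := by gcongr
      _ < 3 * D * |w| := by linarith
      _ ≤ m := hDm)
  have h3 : |u - u'| = 3 * |(k : ℤ) - k'| * |w| := by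
    rw [sub_eq_zero.1 hz, abs_mul, abs_mul]
    norm_num
  nlinarith

theorem norm_sq_sum_le {ι : Type} (s : Finset ι) (g : ι → ℂ) :
    ‖∑ i ∈ s, g i‖ ^ 2 ≤ s.card * ∑ i ∈ s, ‖g i‖ ^ 2 :=
  (pow_le_pow_left₀ (norm_nonneg _) (norm_sum_le _ _) 2).trans sq_sum_le_card_mul_sum_sq

theorem sum_norm_sq_shift_le (D : ℕ) (g : ZMod m → ℂ) (a : ZMod m) :
    ∑ b, ‖∑ k ∈ range D, g (b - 3 * (k : ZMod m) * a)‖ ^ 2 ≤ (D : ℝ) ^ 2 * ∑ b, ‖g b‖ ^ 2 := by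
  calc ∑ b, ‖∑ k ∈ range D, g (b - 3 * (k : ZMod m) * a)‖ ^ 2
      ≤ ∑ b, (D : ℝ) * ∑ k ∈ range D, ‖g (b - 3 * (k : ZMod m) * a)‖ ^ 2 := by
        gcongr with b
        simpa using norm_sq_sum_le (range D) fun k : ℕ => g (b - 3 * (k : ZMod m) * a)
    _ = (D : ℝ) * ∑ k ∈ range D, ∑ b, ‖g (b - 3 * (k : ZMod m) * a)‖ ^ 2 := by rw [← mul_sum, sum_comm]
    _ = (D : ℝ) * ∑ k ∈ range D, ∑ b, ‖g b‖ ^ 2 := by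
        congr 1
        exact sum_congr rfl fun k _ => Equiv.sum_comp (Equiv.subRight (3 * (k : ZMod m) * a))
          fun b => ‖g b‖ ^ 2
    _ = _ := by rw [sum_const, card_range, nsmul_eq_mul]; ring

/-- For g supported in the cone at most one of the D shifted terms is nonzero at each b, so the
squares add up without the loss of Cauchy–Schwarz, and D replaces D². -/
theorem sum_norm_sq_shift_near_le {D : ℕ} (g : ZMod m → ℂ) {a : ZMod m} (ha : a ≠ 0)
    (hD : 3 * D * cycAbs a ≤ m) (hg : ∀ b, ¬ cycAbs b ≤ cycAbs a → g b = 0) :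
    ∑ b, ‖∑ k ∈ range D, g (b - 3 * (k : ZMod m) * a)‖ ^ 2 ≤ D * ∑ b, ‖g b‖ ^ 2 := by
  calc ∑ b, ‖∑ k ∈ range D, g (b - 3 * (k : ZMod m) * a)‖ ^ 2
      ≤ ∑ b, ∑ k ∈ range D, ‖g (b - 3 * (k : ZMod m) * a)‖ ^ 2 := by
        gcongr with b
        by_cases h : ∃ k ∈ range D, g (b - 3 * (k : ZMod m) * a) ≠ 0
        · obtain ⟨k, hk, hgk⟩ := h
          have hk0 : cycAbs (b - 3 * (k : ZMod m) * a) ≤ cycAbs a := by_contra fun h => hgk (hg _ h)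
          have huniq : ∀ k' ∈ range D, k' ≠ k → g (b - 3 * (k' : ZMod m) * a) = 0 := by
            intro k' hk' hne
            by_contra hg'
            have hk1 : cycAbs (b - 3 * (k' : ZMod m) * a) ≤ cycAbs a := by_contra fun h => hg' (hg _ h)
            refine hne (cycAbs_shift_inj (D := D) ha hD hk0 hk1 (mem_range.1 hk') (mem_range.1 hk) ?_)
            ring
          rw [sum_eq_single_of_mem k hk huniq]
          exact single_le_sum (f := fun k : ℕ => ‖g (b - 3 * (k : ZMod m) * a)‖ ^ 2)
            (fun _ _ => sq_nonneg _) hk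
        · push Not at h
          rw [sum_congr rfl h]
          simp only [sum_const_zero, norm_zero, ne_eq, OfNat.ofNat_ne_zero, not_false_eq_true,
            zero_pow]
          exact sum_nonneg fun _ _ => sq_nonneg _
    _ = ∑ k ∈ range D, ∑ b, ‖g (b - 3 * (k : ZMod m) * a)‖ ^ 2 := sum_comm
    _ = ∑ k ∈ range D, ∑ b, ‖g b‖ ^ 2 := sum_congr rfl fun k _ =>
        Equiv.sum_comp (Equiv.subRight (3 * (k : ZMod m) * a)) fun b => ‖g b‖ ^ 2
    _ = _ := by rw [sum_const, card_range, nsmul_eq_mul]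

/-- The dual gain: now the output frequency b is in the cone. Cauchy–Schwarz costs one factor D, but
the points b - 3ka are pairwise distinct, so no value of g is counted twice. -/
theorem sum_near_norm_sq_shift_le {D : ℕ} (g : ZMod m → ℂ) {a : ZMod m} (ha : a ≠ 0)
    (hD : 3 * D * cycAbs a ≤ m) :
    ∑ b with cycAbs b ≤ cycAbs a, ‖∑ k ∈ range D, g (b - 3 * (k : ZMod m) * a)‖ ^ 2 ≤
      D * ∑ b, ‖g b‖ ^ 2 := by
  calc ∑ b with cycAbs b ≤ cycAbs a, ‖∑ k ∈ range D, g (b - 3 * (k : ZMod m) * a)‖ ^ 2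
      ≤ ∑ b with cycAbs b ≤ cycAbs a, (D : ℝ) * ∑ k ∈ range D, ‖g (b - 3 * (k : ZMod m) * a)‖ ^ 2 := by
        gcongr with b
        simpa using norm_sq_sum_le (range D) fun k : ℕ => g (b - 3 * (k : ZMod m) * a)
    _ = (D : ℝ) * ∑ x ∈ (univ.filter fun b : ZMod m => cycAbs b ≤ cycAbs a) ×ˢ range D,
          ‖g (x.1 - 3 * (x.2 : ZMod m) * a)‖ ^ 2 := by rw [← mul_sum, sum_product]
    _ = (D : ℝ) * ∑ b ∈ ((univ.filter fun b : ZMod m => cycAbs b ≤ cycAbs a) ×ˢ range D).image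
          fun x : ZMod m × ℕ => x.1 - 3 * (x.2 : ZMod m) * a, ‖g b‖ ^ 2 := by
        rw [sum_image]
        rintro ⟨b, k⟩ hx ⟨b', k'⟩ hx' h
        simp only [coe_product, coe_filter, mem_univ, true_and, coe_range, Set.mem_prod,
          Set.mem_ofPred_eq, Set.mem_Iio] at hx hx' h
        have hk := cycAbs_shift_inj ha hD hx.1 hx'.1 hx.2 hx'.2 h
        subst hk
        simpa using h
    _ ≤ _ := by
        gcongr
        exact subset_univ _

theorem norm_sq_dirichletSum_le {D : ℕ} {a : ZMod m} (hD : ¬ 3 * D * cycAbs a ≤ m) :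
    ‖dirichletSum (D ^ 2) a‖ ^ 2 ≤ 9 / 4 * (D : ℝ) ^ 2 := by
  have h := norm_dirichletSum_mul_le (D ^ 2) a
  have h2 : (m : ℝ) < 3 * D * cycAbs a := by exact_mod_cast not_le.1 hD
  have hm : (0 : ℝ) ≤ m := Nat.cast_nonneg m
  have hc : (0 : ℝ) < cycAbs a := by
    by_contra hc
    have : (cycAbs a : ℝ) = 0 := le_antisymm (not_lt.1 hc) (Nat.cast_nonneg _)
    rw [this] at h2
    linarith
  have h3 : ‖dirichletSum (D ^ 2) a‖ ≤ 3 / 2 * D := by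
    by_contra h4
    have := mul_lt_mul_of_pos_right (not_le.1 h4) hc
    linarith
  calc ‖dirichletSum (D ^ 2) a‖ ^ 2 ≤ (3 / 2 * (D : ℝ)) ^ 2 :=
        pow_le_pow_left₀ (norm_nonneg _) h3 2
    _ = _ := by ring

theorem norm_sq_dirichletSum_le_pow (D : ℕ) (a : ZMod m) :
    ‖dirichletSum (D ^ 2) a‖ ^ 2 ≤ (D : ℝ) ^ 4 := by
  calc ‖dirichletSum (D ^ 2) a‖ ^ 2 ≤ ((D ^ 2 : ℕ) : ℝ) ^ 2 :=
        pow_le_pow_left₀ (norm_nonneg _) (norm_dirichletSum_le _ _) 2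
    _ = _ := by push_cast; ring

/-- A factor D is saved over the trivial D⁶ in either case. For 3D|a| ≤ m the shears save it by
`hnear`; otherwise the squared kernel is at most (9/4)D² instead of D⁴, and 9/4 ≤ D. -/
theorem mul_shift_bound {D : ℕ} (hD3 : 3 ≤ D) {a : ZMod m} {s t : ℝ} (ht : 0 ≤ t)
    (hs : s ≤ (D : ℝ) ^ 2 * t) (hs0 : 0 ≤ s) (hnear : 3 * D * cycAbs a ≤ m → s ≤ D * t) :
    ‖dirichletSum (D ^ 2) a‖ ^ 2 * s ≤ (D : ℝ) ^ 5 * t := by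
  have hD3' : (3 : ℝ) ≤ D := by exact_mod_cast hD3
  by_cases h : 3 * D * cycAbs a ≤ m
  · calc _ ≤ (D : ℝ) ^ 4 * (D * t) :=
          mul_le_mul (norm_sq_dirichletSum_le_pow D a) (hnear h) hs0 (by positivity)
      _ = _ := by ring
  · calc _ ≤ (9 / 4 * (D : ℝ) ^ 2) * ((D : ℝ) ^ 2 * t) :=
          mul_le_mul (norm_sq_dirichletSum_le h) hs hs0 (by positivity)
      _ = 9 / 4 * ((D : ℝ) ^ 4 * t) := by ring
      _ ≤ D * ((D : ℝ) ^ 4 * t) := by gcongr; linarith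
      _ = _ := by ring

/-- The transform H after the shear in y is split along |b| ≤ |a|. The part inside the cone gains a
factor D in the following shear in x. The part outside was already small, because the roles of the
coordinates are exchanged in the shear in y and |a| < |b| is in its favourable cone. Each part is
bounded by D⁵ · D⁶, and the factor 4 comes from |u + v|² ≤ 2|u|² + 2|v|². -/
theorem sum_norm_sq_shearSum_shearSum_le {D : ℕ} (hD : 3 ≤ D) (f : ZMod m → ZMod m → ℂ)
    (hf : ∑ x, ∑ y, f x y = 0) :
    ∑ x, ∑ y, ‖shearSum D (fun x y => shearSum D (fun y x => f x y) y x) x y‖ ^ 2 ≤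
      4 * (D : ℝ) ^ 11 * ∑ x, ∑ y, ‖f x y‖ ^ 2 := by
  have hm : (0 : ℝ) < m := by exact_mod_cast Nat.pos_of_ne_zero (NeZero.ne m)
  set F := planeFourier f with hF
  have hF0 : F 0 0 = 0 := by rw [hF, planeFourier_zero, hf]
  set g : ZMod m → ZMod m → ℂ := fun x y => shearSum D (fun y x => f x y) y x with hg
  set H := planeFourier g with hH
  have hHF : ∀ a b, H a b = dirichletSum (D ^ 2) b * ∑ k ∈ range D, F (a - 3 * (k : ZMod m) * b) b := by
    intro a b
    rw [hH, hg, planeFourier_swap (fun y x => shearSum D (fun y x => f x y) y x),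
      planeFourier_shearSum]
    simp only [planeFourier_swap f, hF]
  have hH0 : H 0 0 = 0 := by rw [hHF]; simp [hF0]
  set HA : ZMod m → ZMod m → ℂ := fun a b => if cycAbs b ≤ cycAbs a then H a b else 0 with hHA
  set HB : ZMod m → ZMod m → ℂ := fun a b => if cycAbs b ≤ cycAbs a then 0 else H a b with hHB
  have hAB : ∀ a b, H a b = HA a b + HB a b := by
    intro a b
    simp only [hHA, hHB]
    split_ifs <;> simp
  set N : (ZMod m → ZMod m → ℂ) → ℝ := fun G => ∑ a, ∑ b, ‖G a b‖ ^ 2 with hN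
  set Op : (ZMod m → ZMod m → ℂ) → ZMod m → ZMod m → ℂ := fun G a b =>
    dirichletSum (D ^ 2) a * ∑ k ∈ range D, G a (b - 3 * (k : ZMod m) * a) with hOp
  -- The bound without any gain: D⁴ from the kernel and D² from the shears.
  have hOpN : ∀ G, N (Op G) ≤ (D : ℝ) ^ 6 * N G := by
    intro G
    simp only [hN, hOp, norm_mul, mul_pow]
    rw [mul_sum]
    refine sum_le_sum fun a _ => ?_
    rw [← mul_sum]
    calc _ ≤ (D : ℝ) ^ 4 * ((D : ℝ) ^ 2 * ∑ b, ‖G a b‖ ^ 2) :=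
          mul_le_mul (norm_sq_dirichletSum_le_pow D a) (sum_norm_sq_shift_le D (G a) a)
            (by positivity) (by positivity)
      _ = _ := by ring
  have hHN : N H ≤ (D : ℝ) ^ 6 * N F := by
    have h := hOpN fun b a => F a b
    simp only [hN] at h ⊢
    rw [sum_comm, sum_comm (f := fun a b => ‖F a b‖ ^ 2)]
    simpa only [hHF, hOp] using h
  have hA : N (Op HA) ≤ (D : ℝ) ^ 5 * N H := by
    simp only [hN, hOp, norm_mul, mul_pow]
    rw [mul_sum]
    refine sum_le_sum fun a _ => ?_
    rw [← mul_sum]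
    have hle : ∑ b, ‖HA a b‖ ^ 2 ≤ ∑ b, ‖H a b‖ ^ 2 := by
      refine sum_le_sum fun b _ => ?_
      simp only [hHA]
      split_ifs
      · exact le_rfl
      · simp
    refine le_trans ?_ (mul_le_mul_of_nonneg_left hle (by positivity))
    -- For a = 0 the cone is the origin alone, where H vanishes because f has mean zero.
    by_cases ha : a = 0
    · have hz : ∀ b, HA a b = 0 := by
        intro b
        simp only [hHA]
        split_ifs with hb
        · have : b = 0 := by
            simpa [cycAbs, ha] using hb
          rw [ha, this, hH0]
        · rfl
      simp [hz]
    · refine mul_shift_bound hD (by positivity) (sum_norm_sq_shift_le D (HA a) a) (by positivity)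
        fun h => sum_norm_sq_shift_near_le (HA a) ha h fun b hb => if_neg hb
  have hB : N HB ≤ (D : ℝ) ^ 5 * N F := by
    simp only [hN]
    rw [sum_comm, sum_comm (f := fun a b => ‖F a b‖ ^ 2), mul_sum]
    refine sum_le_sum fun b _ => ?_
    by_cases hb : b = 0
    · have hz : ∀ a, HB a b = 0 := by
        intro a
        simp only [hHB, hb]
        rw [if_pos]
        simp [cycAbs]
      simp only [hz]
      simp only [norm_zero, ne_eq, OfNat.ofNat_ne_zero, not_false_eq_true, zero_pow, sum_const_zero]
      positivity
    · have h1 : ∑ a, ‖HB a b‖ ^ 2 ≤ ‖dirichletSum (D ^ 2) b‖ ^ 2 *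
          ∑ a with cycAbs a ≤ cycAbs b, ‖∑ k ∈ range D, F (a - 3 * (k : ZMod m) * b) b‖ ^ 2 := by
        rw [mul_sum, sum_filter]
        refine sum_le_sum fun a _ => ?_
        simp only [hHB]
        by_cases hab : cycAbs b ≤ cycAbs a
        · rw [if_pos hab, norm_zero]
          have : (0 : ℝ) ≤ ‖dirichletSum (D ^ 2) b‖ ^ 2 *
            ‖∑ k ∈ range D, F (a - 3 * (k : ZMod m) * b) b‖ ^ 2 := by positivity
          split_ifs <;> simp [this]
        · rw [if_neg hab, if_pos (by omega), hHF, norm_mul, mul_pow]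
      refine h1.trans (mul_shift_bound hD (by positivity) ?_ (by positivity) fun h =>
        sum_near_norm_sq_shift_le (fun a => F a b) hb h)
      refine le_trans ?_ (sum_norm_sq_shift_le D (fun a => F a b) b)
      exact sum_le_sum_of_subset_of_nonneg (subset_univ _) fun _ _ _ => by positivity
  have hfin : N (Op H) ≤ 4 * (D : ℝ) ^ 11 * N F := by
    have h1 : N (Op H) ≤ 2 * N (Op HA) + 2 * N (Op HB) := by
      simp only [hN, mul_sum, ← sum_add_distrib]
      refine sum_le_sum fun a _ => sum_le_sum fun b _ => ?_
      have : Op H a b = Op HA a b + Op HB a b := by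
        simp only [hOp, hAB, sum_add_distrib, mul_add]
      rw [this]
      have h2 := pow_le_pow_left₀ (norm_nonneg _) (norm_add_le (Op HA a b) (Op HB a b)) 2
      nlinarith [sq_nonneg (‖Op HA a b‖ - ‖Op HB a b‖)]
    calc N (Op H) ≤ 2 * ((D : ℝ) ^ 5 * ((D : ℝ) ^ 6 * N F)) +
          2 * ((D : ℝ) ^ 6 * ((D : ℝ) ^ 5 * N F)) := by
          refine h1.trans ?_
          gcongr
          · exact hA.trans (by gcongr)
          · exact (hOpN HB).trans (by gcongr)
      _ = _ := by ring
  have hlhs : N (Op H) = m ^ 2 * ∑ x, ∑ y, ‖shearSum D g x y‖ ^ 2 := by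
    rw [← sum_norm_sq_planeFourier]
    simp only [hN, hOp, hH, planeFourier_shearSum]
  have hrhs : N F = m ^ 2 * ∑ x, ∑ y, ‖f x y‖ ^ 2 := sum_norm_sq_planeFourier f
  rw [hlhs, hrhs] at hfin
  refine le_of_mul_le_mul_left ?_ (pow_pos hm 2)
  linarith

end ShearExpander

/-! ### Structured edges: pairwise independent shears -/

section StructuredEdges

open Finset

theorem sum_range_mul {α : Type} [AddCommMonoid α] (a b : ℕ) (f : ℕ → α) :
    ∑ i ∈ range (a * b), f i = ∑ u ∈ range b, ∑ v ∈ range a, f (v + a * u) := by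
  induction b with
  | zero => simp
  | succ b ih =>
    rw [Nat.mul_succ, sum_range_add, ih, sum_range_succ]
    simp only [add_comm]

theorem sum_fin_cons {α β : Type} [AddCommMonoid β] [Fintype α] {n : ℕ}
    (F : (Fin (n + 1) → α) → β) :
    ∑ κ, F κ = ∑ a, ∑ κ' : Fin n → α, F (Fin.cons a κ') := by
  rw [← (Fin.consEquiv fun _ : Fin (n + 1) => α).sum_comp, Fintype.sum_prod_type]
  rfl

theorem sum_range_eq_sum_zmod {α : Type} [AddCommMonoid α] {m : ℕ} [NeZero m] (f : ℕ → α) :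
    ∑ i ∈ range m, f i = ∑ x : ZMod m, f x.val := by
  refine (sum_nbij' (fun x : ZMod m => x.val) (fun i => (i : ZMod m)) ?_ ?_ ?_ ?_ ?_).symm
  · intro x _; simpa using ZMod.val_lt x
  · intro i _; simp
  · intro x _; simp
  · intro i hi; exact ZMod.val_cast_of_lt (mem_range.1 hi)
  · intro x _; rfl

theorem sum_plane_val {α : Type} [AddCommMonoid α] {m : ℕ} [NeZero m] (f : ℕ → α) :
    ∑ x : ZMod m, ∑ y : ZMod m, f (x.val + m * y.val) = ∑ v ∈ range (m * m), f v := by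
  rw [sum_range_mul, sum_comm, sum_range_eq_sum_zmod]
  refine sum_congr rfl fun y _ => ?_
  rw [sum_range_eq_sum_zmod fun i => f (i + m * y.val)]

/-- The first coordinate of the image of a point under the shear-translation with parameters
`κ`. -/
def shearFst (D : ℕ) {m : ℕ} (κ : Fin 6 → ℕ) (x y : ZMod m) : ZMod m :=
  x + 3 * (κ 0 : ZMod m) * y + ((κ 1 + D * κ 2 : ℕ) : ZMod m)

/-- The second coordinate of the image of a point under the shear-translation with parameters
`κ`. -/
def shearSnd (D : ℕ) {m : ℕ} (κ : Fin 6 → ℕ) (x y : ZMod m) : ZMod m :=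
  y + 3 * (κ 3 : ZMod m) * shearFst D κ x y + ((κ 4 + D * κ 5 : ℕ) : ZMod m)

theorem sum_shear {α : Type} [AddCommMonoid α] {m : ℕ} [NeZero m] (D : ℕ) (κ : Fin 6 → ℕ)
    (φ : ZMod m → ZMod m → α) :
    ∑ x, ∑ y, φ (shearFst D κ x y) (shearSnd D κ x y) = ∑ x, ∑ y, φ x y := by
  rw [sum_comm]
  have h1 : ∀ y : ZMod m, ∑ x, φ (shearFst D κ x y) (shearSnd D κ x y) =
      ∑ x, φ x (y + 3 * (κ 3 : ZMod m) * x + ((κ 4 + D * κ 5 : ℕ) : ZMod m)) := by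
    intro y
    rw [← Equiv.sum_comp (Equiv.addRight (3 * (κ 0 : ZMod m) * y + ((κ 1 + D * κ 2 : ℕ) : ZMod m)))
      fun x => φ x (y + 3 * (κ 3 : ZMod m) * x + ((κ 4 + D * κ 5 : ℕ) : ZMod m))]
    simp only [Equiv.coe_addRight, ← add_assoc]
    rfl
  simp only [h1]
  rw [sum_comm]
  refine sum_congr rfl fun x _ => ?_
  rw [← Equiv.sum_comp (Equiv.addRight (3 * (κ 3 : ZMod m) * x + ((κ 4 + D * κ 5 : ℕ) : ZMod m)))
    fun y => φ x y]
  simp only [Equiv.coe_addRight, ← add_assoc]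

/-- The digits of κ 1 + D * κ 2 and κ 4 + D * κ 5 make the two translations run through [0, D²), so
six parameters of the same range [0, D) cover both shears and both translations. -/
theorem sum_shear_eq_shearSum {m : ℕ} [NeZero m] (D : ℕ) (f : ZMod m → ZMod m → ℂ)
    (x y : ZMod m) :
    ∑ κ : Fin 6 → Fin D, f (shearFst D (fun i => κ i) x y) (shearSnd D (fun i => κ i) x y) =
      shearSum D (fun x y => shearSum D (fun y x => f x y) y x) x y := by
  simp only [shearSum, pow_two, sum_range_mul]
  simp only [sum_range, sum_fin_cons, Fintype.sum_unique]
  refine sum_congr rfl fun a _ => ?_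
  rw [sum_comm]
  refine sum_congr rfl fun b _ => sum_congr rfl fun c _ => sum_congr rfl fun d _ => ?_
  rw [sum_comm]
  rfl

theorem sum_sq_sum_shear_le {m D : ℕ} [NeZero m] (hD : 3 ≤ D) (g : ZMod m → ZMod m → ℝ)
    (hg : ∑ x, ∑ y, g x y = 0) :
    ∑ x, ∑ y, (∑ κ : Fin 6 → Fin D,
      g (shearFst D (fun i => κ i) x y) (shearSnd D (fun i => κ i) x y)) ^ 2 ≤
      4 * (D : ℝ) ^ 11 * ∑ x, ∑ y, g x y ^ 2 := by
  have h := sum_norm_sq_shearSum_shearSum_le hD (fun x y => (g x y : ℂ)) (by exact_mod_cast hg)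
  simp only [← sum_shear_eq_shearSum] at h
  simp only [← Complex.ofReal_sum, Complex.norm_real, Real.norm_eq_abs, sq_abs] at h
  exact h

/-- The pairwise independent parameters of the edge `p` for the seed `σ`. -/
def seedHash {D : ℕ} (σ : Fin 12 → Fin D) (p : Fin D) (i : Fin 6) : Fin D :=
  ⟨((σ (Fin.castAdd 6 i)).val * p.val + (σ (Fin.natAdd 6 i)).val) % D, Nat.mod_lt _ p.pos⟩

/-- For each i the seed holds the two coefficients of an affine function over the field with D
elements, which is determined by its values at two different points. Hence the parameters of two
different edges are independent and uniform. -/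
theorem seedHash_pair_bijective {D : ℕ} (hD : D.Prime) {p p' : Fin D} (hp : p ≠ p') :
    Function.Bijective fun σ : Fin 12 → Fin D => (seedHash σ p, seedHash σ p') := by
  rw [Fintype.bijective_iff_injective_and_card]
  constructor
  · intro σ τ h
    have := Fact.mk hD
    simp only [Prod.mk.injEq] at h
    obtain ⟨h1, h2⟩ := h
    have hpz : (p.val : ZMod D) - p'.val ≠ 0 := by
      rw [sub_ne_zero]
      intro h
      have := (ZMod.natCast_eq_natCast_iff' _ _ _).1 h
      rw [Nat.mod_eq_of_lt p.2, Nat.mod_eq_of_lt p'.2] at this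
      exact hp (Fin.ext this)
    have hval : ∀ u v : Fin D, (u.val : ZMod D) = v.val → u = v := by
      intro u v h
      have := (ZMod.natCast_eq_natCast_iff' _ _ _).1 h
      rw [Nat.mod_eq_of_lt u.2, Nat.mod_eq_of_lt v.2] at this
      exact Fin.ext this
    have key : ∀ i : Fin 6, σ (Fin.castAdd 6 i) = τ (Fin.castAdd 6 i) ∧
        σ (Fin.natAdd 6 i) = τ (Fin.natAdd 6 i) := by
      intro i
      have e1 := congrArg Fin.val (congrFun h1 i)
      have e2 := congrArg Fin.val (congrFun h2 i)
      simp only [seedHash] at e1 e2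
      rw [← ZMod.natCast_eq_natCast_iff'] at e1 e2
      push_cast at e1 e2
      have ha : ((σ (Fin.castAdd 6 i)).val : ZMod D) = (τ (Fin.castAdd 6 i)).val := by
        have : (((σ (Fin.castAdd 6 i)).val : ZMod D) - (τ (Fin.castAdd 6 i)).val) *
            ((p.val : ZMod D) - p'.val) = 0 := by linear_combination e1 - e2
        rcases mul_eq_zero.1 this with h | h
        · exact sub_eq_zero.1 h
        · exact absurd h hpz
      refine ⟨hval _ _ ha, hval _ _ ?_⟩
      rw [ha] at e1
      exact add_left_cancel e1
    funext i
    refine Fin.addCases (m := 6) (n := 6) (fun i => (key i).1) (fun i => (key i).2) i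
  · simp only [Fintype.card_fun, Fintype.card_fin, Fintype.card_prod]
    ring

theorem sum_sq_sum {ι κ : Type} [Fintype ι] [Fintype κ] (G : κ → ι → ℝ) :
    ∑ i, (∑ p, G p i) ^ 2 = ∑ p, ∑ p', ∑ i, G p i * G p' i := by
  simp only [pow_two, sum_mul_sum]
  rw [sum_comm]
  exact sum_congr rfl fun p _ => sum_comm

/-- Expand the square over pairs of edges. Each of the D diagonal pairs gives D¹² ∑ g², since every
map permutes the torus. For p ≠ p' the two parameter vectors run over all pairs as the seed varies,
so the term is the squared norm of the full sum over parameters, at most 4D¹¹ ∑ g². The total is (1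
+ 4)D¹³ ∑ g². -/
theorem sum_sq_sum_seedHash_le {m D : ℕ} [NeZero m] (hD : D.Prime) (hD3 : 3 ≤ D)
    (g : ZMod m → ZMod m → ℝ) (hg : ∑ x, ∑ y, g x y = 0) :
    ∑ σ : Fin 12 → Fin D, ∑ x, ∑ y, (∑ p, g (shearFst D (fun i => seedHash σ p i) x y)
      (shearSnd D (fun i => seedHash σ p i) x y)) ^ 2 ≤
      5 * (D : ℝ) ^ 13 * ∑ x, ∑ y, g x y ^ 2 := by
  set G : (Fin 6 → Fin D) → ZMod m → ZMod m → ℝ := fun κ x y =>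
    g (shearFst D (fun i => κ i) x y) (shearSnd D (fun i => κ i) x y) with hG
  set E := ∑ x, ∑ y, g x y ^ 2 with hE
  have hE0 : 0 ≤ E := sum_nonneg fun _ _ => sum_nonneg fun _ _ => sq_nonneg _
  have hexp : ∑ σ : Fin 12 → Fin D, ∑ x, ∑ y, (∑ p, G (seedHash σ p) x y) ^ 2 =
      ∑ p, ∑ p', ∑ σ : Fin 12 → Fin D, ∑ x, ∑ y,
        G (seedHash σ p) x y * G (seedHash σ p') x y := by
    have h := sum_sq_sum fun p (i : (Fin 12 → Fin D) × ZMod m × ZMod m) =>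
      G (seedHash i.1 p) i.2.1 i.2.2
    simpa only [Fintype.sum_prod_type] using h
  have hdiag : ∀ p, ∑ σ : Fin 12 → Fin D, ∑ x, ∑ y,
      G (seedHash σ p) x y * G (seedHash σ p) x y = (D : ℝ) ^ 12 * E := by
    intro p
    have : ∀ σ : Fin 12 → Fin D, ∑ x, ∑ y,
      G (seedHash σ p) x y * G (seedHash σ p) x y = E := by
      intro σ
      rw [hE]
      simp only [hG, ← pow_two]
      exact sum_shear D (fun i => seedHash σ p i) fun x y => g x y ^ 2
    simp [this]
  have hoff : ∀ p p', p ≠ p' → ∑ σ : Fin 12 → Fin D, ∑ x, ∑ y,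
      G (seedHash σ p) x y * G (seedHash σ p') x y ≤ 4 * (D : ℝ) ^ 11 * E := by
    intro p p' hp
    have h1 := (seedHash_pair_bijective hD hp).sum_comp fun κ : (Fin 6 → Fin D) × (Fin 6 → Fin D) =>
      ∑ x, ∑ y, G κ.1 x y * G κ.2 x y
    simp only at h1
    rw [h1, Fintype.sum_prod_type]
    refine le_trans (le_of_eq ?_) (sum_sq_sum_shear_le hD3 g hg)
    have h := sum_sq_sum fun κ (i : ZMod m × ZMod m) => G κ i.1 i.2
    simp only [Fintype.sum_prod_type] at h
    exact h.symm
  refine hexp.trans_le ?_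
  calc ∑ p, ∑ p', ∑ σ : Fin 12 → Fin D, ∑ x, ∑ y,
        G (seedHash σ p) x y * G (seedHash σ p') x y
      ≤ ∑ p : Fin D, ∑ p' : Fin D,
          ((if p = p' then (D : ℝ) ^ 12 * E else 0) + 4 * (D : ℝ) ^ 11 * E) := by
        refine sum_le_sum fun p _ => sum_le_sum fun p' _ => ?_
        split_ifs with h
        · subst h
          rw [hdiag]
          have : 0 ≤ 4 * (D : ℝ) ^ 11 * E := by positivity
          linarith
        · rw [zero_add]
          exact hoff p p' h
    _ = 5 * (D : ℝ) ^ 13 * E := by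
        simp only [sum_add_distrib, sum_ite_eq, mem_univ, if_true, sum_const, card_univ,
          Fintype.card_fin, nsmul_eq_mul]
        ring

/-- The block at the end of the edge `p` of the new coordinate `j`. -/
def edgeBlock (n₁ D m j p : ℕ) : ℕ :=
  let x := j % m
  let y := j / m % m
  let s := j / (m * m)
  let h := fun i : ℕ => (s / D ^ i % D * p + s / D ^ (6 + i) % D) % D
  let x' := (x + 3 * h 0 * y + (h 1 + D * h 2)) % m
  let y' := (y + 3 * h 3 * x' + (h 4 + D * h 5)) % m
  (x' + m * y') % n₁

/-- The seed with number `s`. -/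
def seedOf {D : ℕ} (hD : 0 < D) (s : ℕ) (i : Fin 12) : Fin D :=
  ⟨s / D ^ (i : ℕ) % D, Nat.mod_lt _ hD⟩

theorem edgeBlock_eq {n₁ D m : ℕ} [NeZero m] (hD : 0 < D) (j : ℕ) (p : Fin D) :
    edgeBlock n₁ D m j p =
      ((shearFst D (fun i => seedHash (seedOf hD (j / (m * m))) p i) (j : ZMod m)
          ((j / m : ℕ) : ZMod m)).val +
        m * (shearSnd D (fun i => seedHash (seedOf hD (j / (m * m))) p i) (j : ZMod m)
          ((j / m : ℕ) : ZMod m)).val) % n₁ := by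
  have hF : ∀ κ : Fin 6 → ℕ, (shearFst D κ (j : ZMod m) ((j / m : ℕ) : ZMod m)).val =
      (j % m + 3 * κ 0 * (j / m % m) + (κ 1 + D * κ 2)) % m := by
    intro κ
    rw [← ZMod.val_natCast]
    congr 1
    simp [shearFst]
  have hS : ∀ κ : Fin 6 → ℕ, (shearSnd D κ (j : ZMod m) ((j / m : ℕ) : ZMod m)).val =
      (j / m % m + 3 * κ 3 * (shearFst D κ (j : ZMod m) ((j / m : ℕ) : ZMod m)).val +
        (κ 4 + D * κ 5)) % m := by
    intro κ
    rw [← ZMod.val_natCast]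
    congr 1
    simp [shearSnd]
  rw [hS, hF]
  rfl

/-- A structured coordinate j is the mixed-radix number of a triple (seed, x, y): x is the lowest
digit in base m, y the next, and the twelve base-D digits of the seed follow. -/
theorem sum_decode {α : Type} [AddCommMonoid α] {D m : ℕ} [NeZero m] (hD : 0 < D)
    (Φ : (Fin 12 → Fin D) → ZMod m → ZMod m → α) :
    ∑ j ∈ range (m * m * D ^ 12), Φ (seedOf hD (j / (m * m))) (j : ZMod m) ((j / m : ℕ) : ZMod m) =
      ∑ σ, ∑ x, ∑ y, Φ σ x y := by
  have hm : 0 < m := Nat.pos_of_ne_zero (NeZero.ne m)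
  rw [sum_range_mul]
  have h1 : ∀ s, ∑ v ∈ range (m * m), Φ (seedOf hD ((v + m * m * s) / (m * m)))
      ((v + m * m * s : ℕ) : ZMod m) (((v + m * m * s) / m : ℕ) : ZMod m) =
      ∑ x, ∑ y, Φ (seedOf hD s) x y := by
    intro s
    have : ∀ v ∈ range (m * m), Φ (seedOf hD ((v + m * m * s) / (m * m)))
      ((v + m * m * s : ℕ) : ZMod m) (((v + m * m * s) / m : ℕ) : ZMod m) =
        Φ (seedOf hD s) (v : ZMod m) ((v / m : ℕ) : ZMod m) := by
      intro v hv
      have hv := mem_range.1 hv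
      rw [Nat.add_mul_div_left _ _ (Nat.mul_pos hm hm), Nat.div_eq_of_lt hv, zero_add,
        mul_assoc, Nat.add_mul_div_left _ _ hm]
      simp
    rw [sum_congr rfl this, ← sum_plane_val]
    refine sum_congr rfl fun x _ => sum_congr rfl fun y _ => ?_
    rw [Nat.add_mul_div_left _ _ hm, Nat.div_eq_of_lt (ZMod.val_lt x)]
    simp
  rw [sum_congr rfl fun s _ => h1 s, sum_range]
  rw [← Equiv.sum_comp finFunctionFinEquiv.symm]
  rfl

/-- For a fixed edge number and a fixed seed the edge map permutes the torus. The load of a block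
therefore does not depend on the edge number, which lets all numbers share the same padding. -/
theorem sum_edgeBlock {α : Type} [AddCommMonoid α] {n₁ D m : ℕ} [NeZero m] (p : Fin D)
    (f : ℕ → α) :
    ∑ j ∈ range (m * m * D ^ 12), f (edgeBlock n₁ D m j p) =
      D ^ 12 • ∑ v ∈ range (m * m), f (v % n₁) := by
  simp only [edgeBlock_eq p.pos]
  rw [sum_decode p.pos fun σ x y => f (((shearFst D (fun i => seedHash σ p i) x y).val +
    m * (shearSnd D (fun i => seedHash σ p i) x y).val) % n₁)]
  simp only [sum_shear D _ fun x y : ZMod m => f ((x.val + m * y.val) % n₁)]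
  rw [sum_plane_val fun v => f (v % n₁)]
  simp

theorem sum_sq_sum_edgeBlock_le {n₁ D m : ℕ} [NeZero m] (hD : D.Prime) (hD3 : 3 ≤ D)
    (g : ℕ → ℝ) (hg : ∑ v ∈ range (m * m), g (v % n₁) = 0) :
    ∑ j ∈ range (m * m * D ^ 12), (∑ p : Fin D, g (edgeBlock n₁ D m j p)) ^ 2 ≤
      5 * (D : ℝ) ^ 13 * ∑ v ∈ range (m * m), g (v % n₁) ^ 2 := by
  have h := sum_sq_sum_seedHash_le hD hD3 (fun x y : ZMod m => g ((x.val + m * y.val) % n₁))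
    (by rw [sum_plane_val fun v => g (v % n₁)]; exact hg)
  rw [sum_plane_val fun v => g (v % n₁) ^ 2] at h
  refine le_trans (le_of_eq ?_) h
  simp only [edgeBlock_eq hD.pos]
  exact sum_decode hD.pos fun σ x y => (∑ p, g (((shearFst D (fun i => seedHash σ p i) x y).val +
    m * (shearSnd D (fun i => seedHash σ p i) x y).val) % n₁)) ^ 2

/-- The number of edges with a given number between structured coordinates and the block `b`. -/
def blockLoad (n₁ D m b : ℕ) : ℕ := D ^ 12 * Nat.count (fun v => v % n₁ = b) (m * m)

theorem card_edgeBlock_eq {n₁ D m : ℕ} [NeZero m] (p : Fin D) (b : ℕ) :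
    ((range (m * m * D ^ 12)).filter fun j => edgeBlock n₁ D m j p = b).card =
      blockLoad n₁ D m b := by
  rw [card_filter, sum_edgeBlock p fun i => if i = b then 1 else 0, ← card_filter, blockLoad,
    Nat.count_eq_card_filter_range, smul_eq_mul]

theorem blockLoad_bounds {n₁ D m b : ℕ} (hb : b < n₁) :
    D ^ 12 * (m * m / n₁) ≤ blockLoad n₁ D m b ∧
      blockLoad n₁ D m b ≤ D ^ 12 * (m * m / n₁ + 1) := by
  have h := Nat.count_modEq_card (m * m) (Nat.zero_lt_of_lt hb) b
  have h2 : Nat.count (fun v => v % n₁ = b) (m * m) = Nat.count (· ≡ b [MOD n₁]) (m * m) := by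
    simp only [Nat.ModEq, Nat.mod_eq_of_lt hb]
  unfold blockLoad
  rw [h2, h]
  constructor <;> gcongr <;> split_ifs <;> omega

theorem sum_blockLoad {n₁ : ℕ} (hn₁ : 0 < n₁) (D m : ℕ) :
    ∑ b ∈ range n₁, blockLoad n₁ D m b = m * m * D ^ 12 := by
  simp only [blockLoad, ← mul_sum, Nat.count_eq_card_filter_range]
  rw [mul_comm]
  congr 1
  rw [← card_eq_sum_card_fiberwise (f := fun v => v % n₁)]
  · simp
  · intro v _
    simpa using Nat.mod_lt v hn₁

end StructuredEdges

/-! ### Completing the structured edges to a wiring -/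

section Wiring

open Finset

/-- The first unstructured coordinate that is joined to the block `b`. -/
def blockStart (n₁ D m k b : ℕ) : ℕ := m * m * D ^ 12 + ∑ i ∈ range b, (k - blockLoad n₁ D m i)

/-- The new coordinates joined to the block `b` by edges with number `p`: the structured ones, and
as many unstructured ones as are missing. -/
def blockEdges (n₁ D m k b p : ℕ) : List ℕ :=
  (List.range (m * m * D ^ 12)).filter (fun j => edgeBlock n₁ D m j p = b) ++
    List.range' (blockStart n₁ D m k b) (k - blockLoad n₁ D m b)

variable {n₁ D m k : ℕ}

theorem blockLoad_le (hk : D ^ 12 * (m * m / n₁ + 1) ≤ k) {b : ℕ} (hb : b < n₁) :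
    blockLoad n₁ D m b ≤ k := (blockLoad_bounds hb).2.trans hk

theorem blockStart_succ (n₁ D m k b : ℕ) :
    blockStart n₁ D m k (b + 1) = blockStart n₁ D m k b + (k - blockLoad n₁ D m b) := by
  rw [blockStart, blockStart, sum_range_succ, add_assoc]

theorem blockStart_mono : Monotone (blockStart n₁ D m k) :=
  monotone_nat_of_le_succ fun b => by rw [blockStart_succ]; omega

theorem blockStart_last (hn₁ : 0 < n₁) (hk : D ^ 12 * (m * m / n₁ + 1) ≤ k) :
    blockStart n₁ D m k n₁ = n₁ * k := by
  rw [blockStart, ← sum_blockLoad hn₁ D m, ← sum_add_distrib]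
  rw [sum_congr rfl fun b hb => Nat.add_sub_cancel' (blockLoad_le hk (mem_range.1 hb))]
  simp

theorem mem_blockEdges {b p j : ℕ} : j ∈ blockEdges n₁ D m k b p ↔
    (j < m * m * D ^ 12 ∧ edgeBlock n₁ D m j p = b) ∨
      (blockStart n₁ D m k b ≤ j ∧ j < blockStart n₁ D m k (b + 1)) := by
  rw [blockStart_succ]
  simp [blockEdges, List.mem_range'_1]

theorem length_filter_edgeBlock [NeZero m] {b p : ℕ} (hp : p < D) :
    ((List.range (m * m * D ^ 12)).filter (fun j => edgeBlock n₁ D m j p = b)).length =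
      blockLoad n₁ D m b := by
  have h := card_edgeBlock_eq (n₁ := n₁) (m := m) (⟨p, hp⟩ : Fin D) b
  rw [← h]
  rfl

theorem length_blockEdges [NeZero m] (hk : D ^ 12 * (m * m / n₁ + 1) ≤ k) {b p : ℕ}
    (hb : b < n₁) (hp : p < D) : (blockEdges n₁ D m k b p).length = k := by
  rw [blockEdges, List.length_append, length_filter_edgeBlock hp, List.length_range']
  have := blockLoad_le hk hb
  omega

theorem lt_of_mem_blockEdges (hn₁ : 0 < n₁) (hk : D ^ 12 * (m * m / n₁ + 1) ≤ k) {b p j : ℕ}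
    (hb : b < n₁) (hj : j ∈ blockEdges n₁ D m k b p) : j < n₁ * k := by
  rw [← blockStart_last hn₁ hk]
  rcases mem_blockEdges.1 hj with h | h
  · exact h.1.trans_le (Nat.le_add_right _ _)
  · exact h.2.trans_le (blockStart_mono hb)

theorem nodup_blockEdges (b p : ℕ) : (blockEdges n₁ D m k b p).Nodup := by
  refine List.Nodup.append (List.nodup_range.filter _) List.nodup_range' ?_
  intro j hj hj'
  rw [List.mem_filter, List.mem_range] at hj
  rw [List.mem_range'_1] at hj'
  have : m * m * D ^ 12 ≤ blockStart n₁ D m k b := Nat.le_add_right _ _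
  omega

theorem blockEdges_disjoint {b b' p j : ℕ} (hj : j ∈ blockEdges n₁ D m k b p)
    (hj' : j ∈ blockEdges n₁ D m k b' p) : b = b' := by
  have h0 : ∀ b, m * m * D ^ 12 ≤ blockStart n₁ D m k b := fun b => Nat.le_add_right _ _
  have := h0 b
  have := h0 b'
  rcases mem_blockEdges.1 hj with h | h <;> rcases mem_blockEdges.1 hj' with h' | h'
  · exact h.2.symm.trans h'.2
  · omega
  · omega
  · by_contra hne
    rcases Nat.lt_or_gt_of_ne hne with hlt | hlt
    · have := blockStart_mono (n₁ := n₁) (D := D) (m := m) (k := k) (Nat.succ_le_of_lt hlt)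
      simp only [Nat.succ_eq_add_one] at this
      omega
    · have := blockStart_mono (n₁ := n₁) (D := D) (m := m) (k := k) (Nat.succ_le_of_lt hlt)
      simp only [Nat.succ_eq_add_one] at this
      omega

/-- For each edge number p the lists of the n₁ blocks are disjoint, repetition-free, of length k and
contained in [0, n₁k), hence they partition the new coordinates. Position i of the list for p is the
position i + kp of the block, and its component in the new symbol is p. -/
theorem exists_wiring [NeZero m] {N : ℕ} (hn₁ : 0 < n₁) (hN : N = n₁ * k)
    (hk : D ^ 12 * (m * m / n₁ + 1) ≤ k) :
    ∃ π : Fin n₁ × Fin (D * k) ≃ Fin N × Fin D, ∀ b p i,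
      (π (b, finProdFinEquiv (p, i))).2 = p ∧
      (π (b, finProdFinEquiv (p, i))).1.val = (blockEdges n₁ D m k b p).getD i 0 := by
  have hlen : ∀ (b : Fin n₁) (p : Fin D), (blockEdges n₁ D m k b p).length = k := fun b p =>
    length_blockEdges hk b.2 p.2
  have hget : ∀ (b : Fin n₁) (p : Fin D) (i : Fin k),
      (blockEdges n₁ D m k b p).getD i 0 ∈ blockEdges n₁ D m k b p := by
    intro b p i
    rw [List.getD_eq_getElem _ _ (by rw [hlen]; exact i.2)]
    exact List.getElem_mem _
  let f : Fin n₁ × Fin D × Fin k → Fin N × Fin D := fun x =>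
    (⟨(blockEdges n₁ D m k x.1 x.2.1).getD x.2.2 0, by
      rw [hN]; exact lt_of_mem_blockEdges hn₁ hk x.1.2 (hget _ _ _)⟩, x.2.1)
  have hf : Function.Bijective f := by
    rw [Fintype.bijective_iff_injective_and_card]
    constructor
    · rintro ⟨b, p, i⟩ ⟨b', p', i'⟩ h
      simp only [f, Prod.mk.injEq, Fin.mk.injEq] at h
      obtain ⟨h, rfl⟩ := h
      have hb : b = b' := Fin.ext (blockEdges_disjoint (hget b p i) (h ▸ hget b' p i'))
      subst hb
      have hi : i = i' := by
        rw [List.getD_eq_getElem _ _ (by rw [hlen]; exact i.2),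
          List.getD_eq_getElem _ _ (by rw [hlen]; exact i'.2)] at h
        exact Fin.ext ((nodup_blockEdges _ _).getElem_inj_iff.1 h)
      rw [hi]
    · simp only [Fintype.card_prod, Fintype.card_fin, hN]
      ring
  refine ⟨(Equiv.prodCongr (Equiv.refl _) finProdFinEquiv.symm).trans (Equiv.ofBijective f hf),
    fun b p i => ?_⟩
  simp [f]

theorem map_getD_range {α : Type} (L : List α) (a : α) :
    (List.range L.length).map (fun i => L.getD i a) = L := by
  apply List.ext_getElem
  · simp
  · intro i h1 h2
    simp [h2]

theorem flatMap_range_mul {α : Type} (a b : ℕ) (f : ℕ → List α) :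
    (List.range (b * a)).flatMap f =
      (List.range b).flatMap fun u => (List.range a).flatMap fun v => f (v + a * u) := by
  induction b with
  | zero => simp
  | succ b ih =>
    rw [Nat.succ_mul, List.range_add, List.flatMap_append, ih, List.range_succ,
      List.flatMap_append, List.flatMap_singleton]
    simp only [List.flatMap_map, mul_comm a b, add_comm]

theorem flatMap_finRange {α : Type} (n : ℕ) (f : ℕ → List α) :
    ((List.finRange n).flatMap fun i => f i.val) = (List.range n).flatMap f := by
  rw [← List.map_coe_finRange_eq_range, List.flatMap_map]

theorem wiringTable_eq {N : ℕ} [NeZero m] (hk : D ^ 12 * (m * m / n₁ + 1) ≤ k)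
    (π : Fin n₁ × Fin (D * k) ≃ Fin N × Fin D)
    (hπ : ∀ b p i, (π (b, finProdFinEquiv (p, i))).2 = p ∧
      (π (b, finProdFinEquiv (p, i))).1.val = (blockEdges n₁ D m k b p).getD i 0) :
    wiringTable π = (List.range n₁).flatMap fun b => (List.range D).flatMap fun p =>
      (blockEdges n₁ D m k b p).flatMap fun j => [j, p] := by
  have h : ∀ (b : Fin n₁) (q : Fin (D * k)), [(π (b, q)).1.val, (π (b, q)).2.val] =
      [(blockEdges n₁ D m k b (q.val / k)).getD (q.val % k) 0, q.val / k] := by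
    intro b q
    have h := hπ b (finProdFinEquiv.symm q).1 (finProdFinEquiv.symm q).2
    rw [Prod.mk.eta, Equiv.apply_symm_apply] at h
    rw [h.1, h.2]
    rfl
  simp only [wiringTable, h]
  rw [flatMap_finRange n₁ fun b => (List.finRange (D * k)).flatMap fun q =>
    [(blockEdges n₁ D m k b (q.val / k)).getD (q.val % k) 0, q.val / k]]
  refine List.flatMap_congr fun b hb => ?_
  rw [flatMap_finRange (D * k) fun q =>
    [(blockEdges n₁ D m k b (q / k)).getD (q % k) 0, q / k], flatMap_range_mul]
  refine List.flatMap_congr fun p hp => ?_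
  have hlen := length_blockEdges hk (List.mem_range.1 hb) (List.mem_range.1 hp)
  conv_rhs => rw [← map_getD_range (blockEdges n₁ D m k b p) 0, hlen, List.flatMap_map]
  refine List.flatMap_congr fun i hi => ?_
  have hi := List.mem_range.1 hi
  rw [Nat.add_mul_div_left _ _ (by omega), Nat.div_eq_of_lt hi, zero_add, Nat.add_mul_mod_self_left,
    Nat.mod_eq_of_lt hi]

theorem sum_getD (L : List ℕ) (f : ℕ → ℕ) : ∑ i : Fin L.length, f (L.getD i 0) = (L.map f).sum := by
  rw [Fin.sum_univ_eq_sum_range fun i => f (L.getD i 0)]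
  conv_rhs => rw [← map_getD_range L 0, List.map_map]
  rfl

/-- Padding edges carry no information on the set counted by f, so each is charged the maximal value
1. -/
theorem card_edges_le [NeZero m] (hk : D ^ 12 * (m * m / n₁ + 1) ≤ k) {N : ℕ}
    (π : Fin n₁ × Fin (D * k) ≃ Fin N × Fin D)
    (hπ : ∀ b p i, (π (b, finProdFinEquiv (p, i))).2 = p ∧
      (π (b, finProdFinEquiv (p, i))).1.val = (blockEdges n₁ D m k b p).getD i 0)
    (f : ℕ → ℕ) (hf : ∀ j, f j ≤ 1) (b : Fin n₁) :
    ∑ q, f (π (b, q)).1.val ≤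
      (∑ p : Fin D, ∑ j ∈ range (m * m * D ^ 12), if edgeBlock n₁ D m j p = b then f j else 0) +
        D * (k - blockLoad n₁ D m b) := by
  rw [← finProdFinEquiv.sum_comp, Fintype.sum_prod_type]
  have : D * (k - blockLoad n₁ D m b) = ∑ p : Fin D, (k - blockLoad n₁ D m b) := by simp
  rw [this, ← sum_add_distrib]
  refine sum_le_sum fun p _ => ?_
  simp only [(hπ b p _).2]
  have hlen := length_blockEdges hk b.2 p.2
  have h1 : ∑ i : Fin k, f ((blockEdges n₁ D m k b p).getD i 0) =
      ((blockEdges n₁ D m k b p).map f).sum := by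
    rw [← sum_getD, Fin.sum_univ_eq_sum_range fun i => f ((blockEdges n₁ D m k b p).getD i 0),
      Fin.sum_univ_eq_sum_range fun i => f ((blockEdges n₁ D m k b p).getD i 0), hlen]
  rw [h1, blockEdges, List.map_append, List.sum_append]
  gcongr
  · rw [← sum_filter]
    exact le_rfl
  · refine (List.sum_le_card_nsmul _ 1 ?_).trans (by simp)
    intro x hx
    obtain ⟨j, _, rfl⟩ := List.mem_map.1 hx
    exact hf j

end Wiring

/-! ### The sampling property -/

section WiringSampler

open Finset

/-- The number of vertices of the torus that are mapped to a set `U` of blocks. -/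
noncomputable def torusCount (m n₁ : ℕ) (U : Finset (Fin n₁)) : ℝ :=
  ∑ v ∈ range (m * m), ∑ b ∈ U, if v % n₁ = b.val then (1 : ℝ) else 0

theorem torusCount_le {n₁ m : ℕ} (hn₁ : 0 < n₁) (U : Finset (Fin n₁)) :
    torusCount m n₁ U ≤ U.card * ((m : ℝ) ^ 2 / n₁ + 1) := by
  have hcount : ∀ b : Fin n₁, ∑ v ∈ range (m * m), (if v % n₁ = b.val then (1 : ℝ) else 0) ≤
      (m : ℝ) ^ 2 / n₁ + 1 := by
    intro b
    have h := Nat.count_modEq_card (m * m) hn₁ b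
    have h2 : Nat.count (fun v => v % n₁ = b.val) (m * m) = Nat.count (· ≡ b [MOD n₁]) (m * m) := by
      simp only [Nat.ModEq, Nat.mod_eq_of_lt b.2]
    rw [sum_boole, ← Nat.count_eq_card_filter_range, h2, h]
    have h3 : ((m * m / n₁ : ℕ) : ℝ) ≤ (m : ℝ) ^ 2 / n₁ := by
      refine Nat.cast_div_le.trans (le_of_eq ?_)
      push_cast
      ring
    push_cast
    split_ifs <;> linarith
  calc torusCount m n₁ U = ∑ b ∈ U, ∑ v ∈ range (m * m), (if v % n₁ = b.val then (1 : ℝ) else 0) := by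
        rw [torusCount, sum_comm]
    _ ≤ ∑ b ∈ U, ((m : ℝ) ^ 2 / n₁ + 1) := sum_le_sum fun b _ => hcount b
    _ = _ := by rw [sum_const, nsmul_eq_mul]

theorem torusCount_nonneg {n₁ m : ℕ} (U : Finset (Fin n₁)) : 0 ≤ torusCount m n₁ U :=
  sum_nonneg fun _ _ => sum_nonneg fun _ _ => by split_ifs <;> norm_num

/-- As in the expander mixing lemma: pair f with the indicator of U pulled back along the edges and
centred to mean zero on the torus, apply Cauchy–Schwarz over the structured coordinates, and use the
second-moment bound. -/
theorem sq_edge_discrepancy_le {n₁ D m : ℕ} [NeZero m] (hD : D.Prime) (hD3 : 3 ≤ D)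
    (f : ℕ → ℕ) (hf1 : ∀ j, f j ≤ 1) (U : Finset (Fin n₁)) :
    (∑ b ∈ U, ((∑ p : Fin D, ∑ j ∈ range (m * m * D ^ 12),
        if edgeBlock n₁ D m j p = b then f j else 0 : ℕ) : ℝ) -
      torusCount m n₁ U / m ^ 2 * (D * ∑ j ∈ range (m * m * D ^ 12), (f j : ℝ))) ^ 2 ≤
    ((m * m * D ^ 12 : ℕ) : ℝ) * (5 * (D : ℝ) ^ 13 * torusCount m n₁ U) := by
  classical
  have hm : (0 : ℝ) < m := by exact_mod_cast Nat.pos_of_ne_zero (NeZero.ne m)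
  set J := m * m * D ^ 12 with hJ
  set χ : ℕ → ℝ := fun i => ∑ b ∈ U, if i = b.val then 1 else 0 with hχ
  have hχ2 : ∀ i, χ i ^ 2 = χ i := by
    intro i
    by_cases h : ∃ b ∈ U, i = b.val
    · obtain ⟨b, hb, rfl⟩ := h
      have : χ b.val = 1 := by
        simp only [hχ]
        rw [sum_eq_single_of_mem b hb fun b' _ hne => if_neg fun h => hne (Fin.ext h.symm)]
        simp
      rw [this]; norm_num
    · push Not at h
      have : χ i = 0 := sum_eq_zero fun b hb => if_neg (h b hb)
      rw [this]; norm_num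
  set w := torusCount m n₁ U with hw'
  have hw : w = ∑ v ∈ range (m * m), χ (v % n₁) := rfl
  have hw0 : 0 ≤ w := torusCount_nonneg U
  set g : ℕ → ℝ := fun i => χ i - w / m ^ 2 with hg
  have hg0 : ∑ v ∈ range (m * m), g (v % n₁) = 0 := by
    simp only [hg, sum_sub_distrib, sum_const, card_range, nsmul_eq_mul]
    push_cast
    rw [← hw]
    field_simp
    ring
  -- The variance of an indicator is at most its total mass.
  have hg2 : ∑ v ∈ range (m * m), g (v % n₁) ^ 2 ≤ w := by
    have : ∀ v, g (v % n₁) ^ 2 = χ (v % n₁) - (w / m ^ 2) * g (v % n₁) - (w / m ^ 2) * χ (v % n₁) := by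
      intro v
      simp only [hg]
      nlinarith [hχ2 (v % n₁)]
    simp only [this, sum_sub_distrib, ← mul_sum, hg0, ← hw]
    have : 0 ≤ w / m ^ 2 * w := by positivity
    linarith
  set s : Fin n₁ → ℕ := fun b => ∑ p : Fin D, ∑ j ∈ range J,
    if edgeBlock n₁ D m j p = b then f j else 0 with hs
  set S : ℝ := ∑ j ∈ range J, (f j : ℝ) * ∑ p : Fin D, g (edgeBlock n₁ D m j p) with hS
  have h1 : S = ∑ b ∈ U, (s b : ℝ) - w / m ^ 2 * (D * ∑ j ∈ range J, (f j : ℝ)) := by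
    have e1 : ∑ b ∈ U, (s b : ℝ) =
        ∑ j ∈ range J, (f j : ℝ) * ∑ p : Fin D, χ (edgeBlock n₁ D m j p) := by
      simp only [hs, hχ, mul_sum]
      push_cast
      rw [sum_comm]
      simp only [mul_ite, mul_one, mul_zero]
      rw [sum_congr rfl fun p _ => sum_comm, sum_comm]
    rw [e1, hS, mul_sum, mul_sum, ← sum_sub_distrib]
    refine sum_congr rfl fun j _ => ?_
    simp only [hg, sum_sub_distrib, sum_const, card_univ, Fintype.card_fin, nsmul_eq_mul]
    ring
  rw [← h1]
  have h0 : S ^ 2 ≤ (∑ j ∈ range J, (f j : ℝ) ^ 2) *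
      ∑ j ∈ range J, (∑ p : Fin D, g (edgeBlock n₁ D m j p)) ^ 2 :=
    sum_mul_sq_le_sq_mul_sq _ _ _
  refine h0.trans ?_
  have h1 : ∑ j ∈ range J, (f j : ℝ) ^ 2 ≤ J := by
    calc ∑ j ∈ range J, (f j : ℝ) ^ 2 ≤ ∑ j ∈ range J, 1 := by
          refine sum_le_sum fun j _ => ?_
          have : (f j : ℝ) ≤ 1 := by exact_mod_cast hf1 j
          exact pow_le_one₀ (by positivity) this
      _ = J := by simp
  have h2 := sum_sq_sum_edgeBlock_le (n₁ := n₁) (m := m) hD hD3 g hg0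
  have h3 : 5 * (D : ℝ) ^ 13 * ∑ v ∈ range (m * m), g (v % n₁) ^ 2 ≤ 5 * (D : ℝ) ^ 13 * w :=
    mul_le_mul_of_nonneg_left hg2 (by positivity)
  exact mul_le_mul h1 (h2.trans h3) (sum_nonneg fun _ _ => sq_nonneg _) (Nat.cast_nonneg _)

/-- Each of the c exceptional blocks exceeds its expected share by εDk, so S grows linearly in c,
while S² is bounded linearly in c. With w ≤ 2cQ this gives cε²D ≤ 10n₁, where 10 = 5 · 2; hence the
10 in `hDε`. -/
theorem exceptional_le {c Q n₁ k D ε γ w J S : ℝ} (hUn : 0 ≤ c) (hn : 0 < n₁) (hDpos : 0 < D)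
    (hε : 0 < ε) (hDε : 10 ≤ D * ε ^ 2 * γ) (hQ1 : 1 ≤ Q) (hwU : w ≤ c * (Q + 1))
    (hJ0 : J = Q * n₁ * D ^ 12) (hkm : D ^ 12 * Q ≤ k)
    (hSlow : c * (ε * (D * k)) ≤ S) (hSup : S ^ 2 ≤ J * (5 * D ^ 13 * w)) : c ≤ γ * n₁ := by
  rcases hUn.eq_or_lt with h0 | hUpos
  · rw [← h0]
    have : 0 < γ := by
      by_contra h
      have : D * ε ^ 2 * γ ≤ 0 := mul_nonpos_of_nonneg_of_nonpos (by positivity) (not_lt.1 h)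
      linarith
    positivity
  have hQ0 : 0 < Q := by linarith
  have hJpos : 0 ≤ J := by rw [hJ0]; positivity
  have hk0 : 0 ≤ k := le_trans (by positivity) hkm
  have hmain : (c * (ε * (D * (D ^ 12 * Q)))) ^ 2 ≤
      (Q * n₁ * D ^ 12) * (5 * D ^ 13 * (c * (2 * Q))) := by
    calc (c * (ε * (D * (D ^ 12 * Q)))) ^ 2 ≤ (c * (ε * (D * k))) ^ 2 := by gcongr
      _ ≤ S ^ 2 := pow_le_pow_left₀ (by positivity) hSlow 2
      _ ≤ J * (5 * D ^ 13 * w) := hSup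
      _ ≤ J * (5 * D ^ 13 * (c * (Q + 1))) := by gcongr
      _ ≤ J * (5 * D ^ 13 * (c * (2 * Q))) := by gcongr; linarith
      _ = _ := by rw [hJ0]
  have hfin : c * (ε ^ 2 * D) ≤ 10 * n₁ := by
    have hc : 0 < c * Q ^ 2 * D ^ 25 := by positivity
    refine le_of_mul_le_mul_left ?_ hc
    calc _ = (c * (ε * (D * (D ^ 12 * Q)))) ^ 2 := by ring
      _ ≤ _ := hmain
      _ = _ := by ring
  have : c * (ε ^ 2 * D) ≤ γ * n₁ * (ε ^ 2 * D) := by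
    calc _ ≤ 10 * n₁ := hfin
      _ ≤ (D * ε ^ 2 * γ) * n₁ := by gcongr
      _ = _ := by ring
  exact le_of_mul_le_mul_right this (by positivity)

/-- The three ε are spent as follows: at most a fraction ε of the edges of a block is padding
(`hfull`); the uneven sizes of the residue classes modulo n₁ raise the expected share from β to at
most β + ε (`hsmall`); the last ε is the deviation that `exceptional_le` allows in few blocks only.
-/
theorem isWiringSampler_of_blockEdges {n₁ D m k N : ℕ} [NeZero m] (hD : D.Prime) (hD3 : 3 ≤ D) (hn₁ : 0 < n₁)
    (hN : N = n₁ * k) (hk : D ^ 12 * (m * m / n₁ + 1) ≤ k) {ε γ : ℝ} (hε : 0 < ε) (hε1 : ε < 1)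
    (hDε : 10 ≤ D * ε ^ 2 * γ)
    (hfull : (k : ℝ) ≤ D ^ 12 * ((m * m / n₁ : ℕ) : ℝ) + ε * k)
    (hsmall : (n₁ : ℝ) ≤ ε * m ^ 2)
    (π : Fin n₁ × Fin (D * k) ≃ Fin N × Fin D)
    (hπ : ∀ b p i, (π (b, finProdFinEquiv (p, i))).2 = p ∧
      (π (b, finProdFinEquiv (p, i))).1.val = (blockEdges n₁ D m k b p).getD i 0)
    {β : ℝ} (hβ1 : β ≤ 1) : IsWiringSampler π β (β + 3 * ε) γ := by
  classical
  intro X hX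
  have hm : (0 : ℝ) < m := by exact_mod_cast Nat.pos_of_ne_zero (NeZero.ne m)
  have hn : (0 : ℝ) < n₁ := by exact_mod_cast hn₁
  have hDpos : (0 : ℝ) < D := by exact_mod_cast hD.pos
  have hkpos : 0 < k := lt_of_lt_of_le (Nat.mul_pos (pow_pos hD.pos 12) (Nat.succ_pos _)) hk
  have hkR : (0 : ℝ) < k := by exact_mod_cast hkpos
  -- For negative β no X exists, so the existence of X gives the sign.
  have hβ0 : 0 ≤ β := le_trans (by positivity) hX
  set J := m * m * D ^ 12 with hJ
  have hJN : J ≤ N := by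
    rw [hN, ← blockStart_last hn₁ hk]
    exact Nat.le_add_right _ _
  set f : ℕ → ℕ := fun j => if ∃ h : j < N, (⟨j, h⟩ : Fin N) ∈ X then 1 else 0 with hf
  have hf1 : ∀ j, f j ≤ 1 := fun j => by simp only [hf]; split_ifs <;> norm_num
  have hfX : ∑ j ∈ range N, f j = X.ncard := by
    rw [Finset.sum_range]
    simp only [hf, Fin.is_lt, exists_true_left, Fin.eta]
    rw [← card_filter, ← Set.ncard_coe_finset]
    congr 1
    ext
    simp
  have hfJ : (D : ℝ) * ∑ j ∈ range J, (f j : ℝ) ≤ β * (n₁ * (D * k)) := by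
    have h1 : (∑ j ∈ range J, (f j : ℝ)) ≤ β * N := by
      have hNpos : (0 : ℝ) < N := by rw [hN]; push_cast; positivity
      rw [div_le_iff₀ hNpos, ← hfX] at hX
      refine le_trans ?_ hX
      push_cast
      exact sum_le_sum_of_subset_of_nonneg (range_subset_range.2 hJN) fun _ _ _ => by positivity
    calc _ ≤ D * (β * N) := by gcongr
      _ = _ := by rw [hN]; push_cast; ring
  set U : Finset (Fin n₁) := univ.filter fun b =>
    ¬ (({q | (π (b, q)).1 ∈ X} : Set (Fin (D * k))).ncard : ℝ) / ((D * k : ℕ) : ℝ) ≤ β + 3 * ε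
    with hU
  have hUset : ({b | ¬ (({q | (π (b, q)).1 ∈ X} : Set (Fin (D * k))).ncard : ℝ) /
      ((D * k : ℕ) : ℝ) ≤ β + 3 * ε} : Set (Fin n₁)).ncard = U.card := by
    rw [← Set.ncard_coe_finset]
    congr 1
    ext
    simp [hU]
  rw [hUset, div_le_iff₀ hn]
  set s : Fin n₁ → ℕ := fun b => ∑ p : Fin D, ∑ j ∈ range J,
    if edgeBlock n₁ D m j p = b then f j else 0 with hs
  have hsU : ∀ b ∈ U, (β + 2 * ε) * (D * k) ≤ s b := by
    intro b hb
    have h1 := (mem_filter.1 hb).2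
    rw [not_le, lt_div_iff₀ (by push_cast; positivity)] at h1
    have h2 : ({q | (π (b, q)).1 ∈ X} : Set (Fin (D * k))).ncard = ∑ q, f (π (b, q)).1.val := by
      simp only [hf, Fin.is_lt, exists_true_left, Fin.eta]
      rw [← card_filter, ← Set.ncard_coe_finset]
      congr 1
      ext
      simp
    have h3 := card_edges_le hk π hπ f hf1 b
    rw [← h2] at h3
    have h4 : ((k - blockLoad n₁ D m b : ℕ) : ℝ) ≤ ε * k := by
      rw [Nat.cast_sub (blockLoad_le hk b.2)]
      have : ((D ^ 12 * (m * m / n₁) : ℕ) : ℝ) ≤ blockLoad n₁ D m b := by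
        exact_mod_cast (blockLoad_bounds b.2).1
      push_cast at this hfull ⊢
      linarith
    have h5 : (({q | (π (b, q)).1 ∈ X} : Set (Fin (D * k))).ncard : ℝ) ≤
        s b + D * ((k - blockLoad n₁ D m b : ℕ) : ℝ) := by exact_mod_cast h3
    have h6 : D * ((k - blockLoad n₁ D m b : ℕ) : ℝ) ≤ D * (ε * k) := by gcongr
    push_cast at h1
    linarith
  set w := torusCount m n₁ U with hw
  have hwU := torusCount_le (m := m) hn₁ U
  set S : ℝ := ∑ b ∈ U, (s b : ℝ) - w / m ^ 2 * (D * ∑ j ∈ range J, (f j : ℝ)) with hS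
  have hSup : S ^ 2 ≤ (J : ℝ) * (5 * (D : ℝ) ^ 13 * w) := sq_edge_discrepancy_le hD hD3 f hf1 U
  have hSlow : U.card * (ε * (D * k)) ≤ S := by
    have h2 : U.card * ((β + 2 * ε) * (D * k)) ≤ ∑ b ∈ U, (s b : ℝ) := by
      rw [← nsmul_eq_mul]
      exact card_nsmul_le_sum _ _ _ hsU
    have h3 : w / m ^ 2 * (D * ∑ j ∈ range J, (f j : ℝ)) ≤ U.card * ((β + ε) * (D * k)) := by
      calc _ ≤ (U.card * ((m : ℝ) ^ 2 / n₁ + 1)) / m ^ 2 * (β * (n₁ * (D * k))) := by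
            gcongr
        _ = U.card * ((β + β * (n₁ / m ^ 2)) * (D * k)) := by
            field_simp
        _ ≤ _ := by
            have h4 : (n₁ : ℝ) / m ^ 2 ≤ ε := by rw [div_le_iff₀ (by positivity)]; exact hsmall
            have h5 : β * (n₁ / m ^ 2) ≤ ε :=
              (mul_le_of_le_one_left (by positivity) hβ1).trans h4
            gcongr
    have h6 : (U.card : ℝ) * ((β + 2 * ε) * (D * k)) =
        U.card * ((β + ε) * (D * k)) + U.card * (ε * (D * k)) := by ring
    linarith
  have hkm : (D : ℝ) ^ 12 * ((m : ℝ) ^ 2 / n₁) ≤ k := by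
    have h1 : (m : ℝ) ^ 2 / n₁ ≤ ((m * m / n₁ : ℕ) : ℝ) + 1 := by
      have h := Nat.lt_div_mul_add (a := m * m) hn₁
      rw [div_le_iff₀ hn]
      have h' : ((m * m : ℕ) : ℝ) < ((m * m / n₁ * n₁ + n₁ : ℕ) : ℝ) := by exact_mod_cast h
      push_cast at h'
      nlinarith
    calc _ ≤ (D : ℝ) ^ 12 * (((m * m / n₁ : ℕ) : ℝ) + 1) := by gcongr
      _ ≤ (k : ℝ) := by exact_mod_cast hk
  refine exceptional_le (Q := (m : ℝ) ^ 2 / n₁) (Nat.cast_nonneg _) hn hDpos hε hDε ?_ hwU ?_ hkm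
    hSlow hSup
  · rw [le_div_iff₀ hn]
    nlinarith [sq_nonneg (m : ℝ)]
  · rw [hJ]
    push_cast
    field_simp

/-- The side length of the torus on which the structured coordinates live. -/
theorem exists_torus (n₁ D k : ℕ) (hn₁ : 0 < n₁) (hD : 0 < D) (hk : D ^ 12 ≤ k) :
    ∃ m, m * m ≤ n₁ * k ∧ (∀ i ≤ m, D ^ 12 * (i * i / n₁ + 1) ≤ k) ∧
      k < D ^ 12 * ((m + 1) * (m + 1) / n₁ + 1) := by
  classical
  have hex : ∃ m, ¬ D ^ 12 * ((m + 1) * (m + 1) / n₁ + 1) ≤ k := by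
    refine ⟨n₁ * k, not_le.2 ?_⟩
    have h1 : k ≤ (n₁ * k + 1) * (n₁ * k + 1) / n₁ := by
      rw [Nat.le_div_iff_mul_le hn₁]
      nlinarith
    calc k < (n₁ * k + 1) * (n₁ * k + 1) / n₁ + 1 := Nat.lt_succ_of_le h1
      _ ≤ _ := Nat.le_mul_of_pos_left _ (pow_pos hD 12)
  have hall : ∀ i ≤ Nat.find hex, D ^ 12 * (i * i / n₁ + 1) ≤ k := by
    intro i hi
    rcases i with _ | i
    · simpa using hk
    · have := Nat.find_min hex (Nat.lt_of_succ_le hi)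
      push Not at this
      exact this
  refine ⟨Nat.find hex, ?_, hall, not_le.1 (Nat.find_spec hex)⟩
  have h1 := hall _ le_rfl
  have h2 : Nat.find hex * Nat.find hex / n₁ + 1 ≤ k :=
    (Nat.le_mul_of_pos_left _ (pow_pos hD 12)).trans h1
  have h3 := Nat.lt_div_mul_add (a := Nat.find hex * Nat.find hex) hn₁
  nlinarith

/-- Since m + 1 is already too large and k ≥ 100D¹⁴, m is at least 4D and m² at least 24D²n₁.
Passing from m to m + 1 adds 2m + 1 to m², and rounding adds at most multiples of n₁; together this
is at most m²/D ≤ εm², so little padding is left. -/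
theorem torus_bounds {n₁ D k m : ℕ} (hn₁ : 0 < n₁) (hD : 0 < D) (hk : 100 * D ^ 14 ≤ k)
    (hm : D ^ 12 * (m * m / n₁ + 1) ≤ k) (hm' : k < D ^ 12 * ((m + 1) * (m + 1) / n₁ + 1)) {ε : ℝ}
    (hε : 1 ≤ ε * D) :
    0 < m ∧ (k : ℝ) ≤ D ^ 12 * ((m * m / n₁ : ℕ) : ℝ) + ε * k ∧ (n₁ : ℝ) ≤ ε * m ^ 2 := by
  have hn : (1 : ℝ) ≤ n₁ := by exact_mod_cast hn₁
  have hDR : (1 : ℝ) ≤ D := by exact_mod_cast hD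
  have hkR : 100 * (D : ℝ) ^ 14 ≤ k := by exact_mod_cast hk
  have hε0 : 0 < ε := by
    by_contra h
    nlinarith
  set Q : ℝ := ((m * m / n₁ : ℕ) : ℝ) with hQ
  set Q' : ℝ := (((m + 1) * (m + 1) / n₁ : ℕ) : ℝ) with hQ'
  have h1 : (D : ℝ) ^ 12 * (Q + 1) ≤ k := by rw [hQ]; exact_mod_cast hm
  have h2 : (k : ℝ) < D ^ 12 * (Q' + 1) := by rw [hQ']; exact_mod_cast hm'
  have h3 : Q' * n₁ ≤ (m + 1) ^ 2 := by
    have : (((m + 1) * (m + 1) / n₁ * n₁ : ℕ) : ℝ) ≤ (((m + 1) * (m + 1) : ℕ) : ℝ) := by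
      exact_mod_cast Nat.div_mul_le_self _ _
    push_cast at this
    rw [hQ']
    linarith
  have h4 : (m : ℝ) ^ 2 ≤ (Q + 1) * n₁ := by
    have h := (Nat.lt_div_mul_add (a := m * m) hn₁).le
    have h' : ((m * m : ℕ) : ℝ) ≤ ((m * m / n₁ * n₁ + n₁ : ℕ) : ℝ) := by exact_mod_cast h
    push_cast at h'
    rw [hQ]
    linarith
  have hD12 : (0 : ℝ) < (D : ℝ) ^ 12 := by positivity
  have h5 : 100 * (D : ℝ) ^ 2 < Q' + 1 := by
    refine lt_of_mul_lt_mul_left ?_ hD12.le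
    calc (D : ℝ) ^ 12 * (100 * (D : ℝ) ^ 2) = 100 * (D : ℝ) ^ 14 := by ring
      _ ≤ (k : ℝ) := hkR
      _ < _ := h2
  have h6 : 99 * (D : ℝ) ^ 2 * n₁ ≤ (m + 1) ^ 2 := by
    refine le_trans ?_ h3
    gcongr
    nlinarith
  have hm0 : 0 < m := by
    rcases Nat.eq_zero_or_pos m with h | h
    · rw [h] at h6
      have : (1 : ℝ) ≤ (D : ℝ) ^ 2 * n₁ := one_le_mul_of_one_le_of_one_le (one_le_pow₀ hDR) hn
      norm_num at h6
      nlinarith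
    · exact h
  have hmR : (1 : ℝ) ≤ m := by exact_mod_cast hm0
  have h7 : 24 * (D : ℝ) ^ 2 * n₁ ≤ m ^ 2 := by nlinarith
  have h8 : 4 * (D : ℝ) ≤ m := by
    have : (4 * (D : ℝ)) ^ 2 ≤ (m : ℝ) ^ 2 := by
      refine le_trans ?_ h7
      have : (D : ℝ) ^ 2 * 1 ≤ (D : ℝ) ^ 2 * n₁ := by gcongr
      nlinarith [sq_nonneg (D : ℝ)]
    exact (sq_le_sq₀ (by positivity) (by positivity)).1 this
  have hDn : (D : ℝ) * n₁ ≤ (D : ℝ) ^ 2 * n₁ := by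
    gcongr
    nlinarith
  have h9 : (D : ℝ) * (2 * m + 1 + 2 * n₁) ≤ m ^ 2 := by
    have e1 : (D : ℝ) * (2 * m + 1) ≤ D * (3 * m) := by gcongr; linarith
    have e2 : (4 * (D : ℝ)) * m ≤ m * m := by gcongr
    nlinarith
  have h10 : 2 * (m : ℝ) + 1 + 2 * n₁ ≤ ε * m ^ 2 := by
    calc 2 * (m : ℝ) + 1 + 2 * n₁ ≤ (ε * D) * (2 * (m : ℝ) + 1 + 2 * n₁) :=
          le_mul_of_one_le_left (by positivity) hε
      _ = ε * (D * (2 * m + 1 + 2 * n₁)) := by ring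
      _ ≤ _ := by gcongr
  refine ⟨hm0, ?_, by linarith⟩
  have h11 : (Q' - Q) * n₁ + n₁ ≤ ε * ((Q + 1) * n₁) := by
    have : ε * (m : ℝ) ^ 2 ≤ ε * ((Q + 1) * n₁) := by gcongr
    nlinarith
  have h12 : Q' - Q + 1 ≤ ε * (Q + 1) := by
    refine le_of_mul_le_mul_right ?_ (lt_of_lt_of_le one_pos hn)
    linarith
  have h13 : ε * (D ^ 12 * (Q + 1)) ≤ ε * k := by gcongr
  have h14 : (D : ℝ) ^ 12 * (Q' - Q + 1) ≤ D ^ 12 * (ε * (Q + 1)) := by gcongr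
  linarith

end WiringSampler

/-! ## Compiling arithmetic expressions to while-programs -/

/-- Arithmetic expressions over registers. -/
inductive AExpr
  | reg (x : ℕ)
  | lit (v : ℕ)
  | op (o : ArithOp) (e₁ e₂ : AExpr)

namespace AExpr

/-- The value of an expression. -/
def eval (ρ : ℕ → ℕ) : AExpr → ℕ
  | reg x => ρ x
  | lit v => v
  | op o e₁ e₂ => o.apply (eval ρ e₁) (eval ρ e₂)

/-- All registers that occur have numbers below `T`. -/
def RegsLt (T : ℕ) : AExpr → Prop
  | reg x => x < T
  | lit _ => True
  | op _ e₁ e₂ => RegsLt T e₁ ∧ RegsLt T e₂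

/-- The code that writes the value of an expression into register `t`; registers below `t` are
left unchanged. -/
def compile : AExpr → ℕ → WhileProg
  | reg x, t => .seq (.const t 0) (.arith .add t x t)
  | lit v, t => .const t v
  | op o e₁ e₂, t => .seq (compile e₁ t) (.seq (compile e₂ (t + 1)) (.arith o t t (t + 1)))

/-- A factor in the bound for the bit length of the value. -/
def sizeCoef : AExpr → ℕ
  | reg _ => 1
  | lit v => v.size
  | op _ e₁ e₂ => sizeCoef e₁ + sizeCoef e₂ + 1

/-- A factor in the bound for the running time. -/
def timeCoef : AExpr → ℕ
  | reg _ => 3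
  | lit v => v.size + 1
  | op _ e₁ e₂ => timeCoef e₁ + timeCoef e₂ + 2 * sizeCoef e₁ + 2 * sizeCoef e₂ + 2

theorem eval_congr {T : ℕ} {ρ ρ' : ℕ → ℕ} (h : ∀ r < T, ρ r = ρ' r) {e : AExpr}
    (he : e.RegsLt T) : e.eval ρ = e.eval ρ' := by
  induction e with
  | reg x => exact h x he
  | lit v => rfl
  | op o e₁ e₂ h₁ h₂ => simp only [eval, h₁ he.1, h₂ he.2]

end AExpr

theorem natSize_le_self (n : ℕ) : n.size ≤ n := Nat.size_le.2 n.lt_two_pow_self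

theorem ArithOp.size_apply_le (o : ArithOp) (y z : ℕ) :
    (o.apply y z).size ≤ y.size + z.size + 1 := by
  have hy := Nat.lt_size_self y
  have hz := Nat.lt_size_self z
  have hmono : ∀ w, w ≤ y → w.size ≤ y.size + z.size + 1 := fun w hw =>
    (Nat.size_le_size hw).trans (by omega)
  cases o with
  | add =>
    refine Nat.size_le.2 (show y + z < _ from ?_)
    calc y + z < 2 ^ y.size + 2 ^ z.size := add_lt_add hy hz
      _ ≤ 2 ^ (y.size + z.size) + 2 ^ (y.size + z.size) :=
        add_le_add (Nat.pow_le_pow_right two_pos (by omega)) (Nat.pow_le_pow_right two_pos (by omega))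
      _ = _ := by ring
  | sub => exact hmono _ (Nat.sub_le _ _)
  | mul =>
    refine Nat.size_le.2 (show y * z < _ from ?_)
    calc y * z ≤ 2 ^ y.size * 2 ^ z.size := Nat.mul_le_mul hy.le hz.le
      _ = 2 ^ (y.size + z.size) := by rw [pow_add]
      _ < _ := Nat.pow_lt_pow_right one_lt_two (by omega)
  | div => exact hmono _ (Nat.div_le_self _ _)
  | mod => exact hmono _ (Nat.mod_le _ _)

namespace AExpr

/-- Bit lengths of registers are bounded by the register values themselves. This wastes an
exponential, but the values are polynomial in n₁n₀, and so is the resulting bound. -/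
theorem size_eval_le {T V : ℕ} {ρ : ℕ → ℕ} (h : ∀ r < T, ρ r ≤ V) {e : AExpr}
    (he : e.RegsLt T) : (e.eval ρ).size ≤ e.sizeCoef * (V + 1) := by
  induction e with
  | reg x =>
    have := h x he
    have := natSize_le_self (ρ x)
    simp only [eval, sizeCoef]
    omega
  | lit v => exact Nat.le_mul_of_pos_right _ (Nat.succ_pos _)
  | op o e₁ e₂ h₁ h₂ =>
    refine (o.size_apply_le _ _).trans ?_
    have := h₁ he.1
    have := h₂ he.2
    simp only [sizeCoef, add_mul, one_mul]
    omega

/-- Registers from t upwards serve as a stack: the second operand is computed above the first and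
cannot disturb it, nor the program variables below T. -/
theorem run_compile {T V : ℕ} {e : AExpr} (he : e.RegsLt T) {t : ℕ} (hT : T ≤ t)
    (s : MachineState) (h : ∀ r < T, s.reg r ≤ V) :
    ∃ s' k, WhileProg.Run (e.compile t) s s' k ∧ (∀ r < t, s'.reg r = s.reg r) ∧
      s'.reg t = e.eval s.reg ∧ s'.out = s.out ∧ k ≤ e.timeCoef * (V + 1) := by
  induction e generalizing t s with
  | reg x =>
    have hx : x ≠ t := by
      have : x < T := he
      omega
    refine ⟨_, _, .seq (.const t 0 s) (.arith .add t x t _), ?_, ?_, rfl, ?_⟩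
    · intro r hr
      have : r ≠ t := by omega
      simp [MachineState.set, this]
    · simp [MachineState.set, hx, ArithOp.apply, eval]
    · have h1 := h x he
      have h2 := natSize_le_self (s.reg x)
      simp only [MachineState.set, Function.update_self, Function.update_of_ne hx, ArithOp.apply,
        Nat.size_zero, timeCoef, add_zero]
      omega
  | lit v =>
    refine ⟨_, _, .const t v s, ?_, ?_, rfl, ?_⟩
    · intro r hr
      have : r ≠ t := by omega
      simp [MachineState.set, this]
    · simp [MachineState.set, eval]
    · rw [timeCoef, add_comm]
      exact Nat.le_mul_of_pos_right _ (Nat.succ_pos _)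
  | op o e₁ e₂ h₁ h₂ =>
    obtain ⟨s₁, k₁, r₁, a₁, b₁, c₁, d₁⟩ := h₁ he.1 hT s h
    obtain ⟨s₂, k₂, r₂, a₂, b₂, c₂, d₂⟩ := h₂ he.2 (Nat.le_succ_of_le hT) s₁ fun r hr => by
      rw [a₁ r (by omega)]; exact h r hr
    have e1 : s₂.reg t = e₁.eval s.reg := by rw [a₂ t (by omega), b₁]
    have e2 : s₂.reg (t + 1) = e₂.eval s.reg := by
      rw [b₂]
      exact eval_congr (fun r hr => a₁ r (by omega)) he.2
    refine ⟨_, _, .seq r₁ (.seq r₂ (.arith o t t (t + 1) s₂)), ?_, ?_, ?_, ?_⟩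
    · intro r hr
      have : r ≠ t := by omega
      simp only [MachineState.set, Function.update_of_ne this]
      rw [a₂ r (by omega), a₁ r hr]
    · simp [MachineState.set, e1, e2, eval]
    · simp [MachineState.set, c₂, c₁]
    · rw [e1, e2]
      have f1 := size_eval_le h he.1
      have f2 := size_eval_le h he.2
      have f3 := o.size_apply_le (e₁.eval s.reg) (e₂.eval s.reg)
      simp only [timeCoef, add_mul, mul_assoc]
      omega

end AExpr

/-- `p` transforms the contents `ρ` of the registers below `T` into `ρ'`, writes `w`, and takes at
most `c` steps. -/
def WhileProg.Exec (T : ℕ) (p : WhileProg) (ρ ρ' w : List ℕ) (c : ℕ) : Prop :=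
  ∀ s : MachineState, (∀ r < T, s.reg r = ρ.getD r 0) →
    ∃ s' k, WhileProg.Run p s s' k ∧ (∀ r < T, s'.reg r = ρ'.getD r 0) ∧ s'.out = s.out ++ w ∧ k ≤ c

namespace WhileProg

theorem Exec.seq {T : ℕ} {p q : WhileProg} {ρ ρ' ρ'' w w' : List ℕ} {c c' : ℕ}
    (h : Exec T p ρ ρ' w c) (h' : Exec T q ρ' ρ'' w' c') :
    Exec T (.seq p q) ρ ρ'' (w ++ w') (c + c') := by
  intro s hs
  obtain ⟨s₁, k₁, r₁, a₁, o₁, d₁⟩ := h s hs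
  obtain ⟨s₂, k₂, r₂, a₂, o₂, d₂⟩ := h' s₁ a₁
  exact ⟨s₂, _, .seq r₁ r₂, a₂, by rw [o₂, o₁, List.append_assoc], by omega⟩

theorem Exec.mono {T : ℕ} {p : WhileProg} {ρ ρ' w : List ℕ} {c c' : ℕ}
    (h : Exec T p ρ ρ' w c) (hc : c ≤ c') : Exec T p ρ ρ' w c' := by
  intro s hs
  obtain ⟨s₁, k₁, r₁, a₁, o₁, d₁⟩ := h s hs
  exact ⟨s₁, k₁, r₁, a₁, o₁, d₁.trans hc⟩

/-- The whole sequence of register contents is given in advance as σ, so the number of rounds is n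
as soon as the loop register first vanishes in σ n. -/
theorem Exec.loop {T : ℕ} {x : ℕ} {body : WhileProg} {c : ℕ} (hx : x < T) (n : ℕ)
    (σ w : ℕ → List ℕ) (hne : ∀ i < n, (σ i).getD x 0 ≠ 0) (h0 : (σ n).getD x 0 = 0)
    (hbody : ∀ i < n, Exec T body (σ i) (σ (i + 1)) (w i) c) :
    Exec T (.loop x body) (σ 0) (σ n) ((List.range n).flatMap w) (n * (c + 1) + 1) := by
  induction n generalizing σ w with
  | zero =>
    intro s hs
    exact ⟨s, 1, .loop_exit (by rw [hs x hx, h0]), hs, by simp, by simp⟩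
  | succ n ih =>
    intro s hs
    obtain ⟨s₁, k₁, r₁, a₁, o₁, d₁⟩ := hbody 0 (Nat.succ_pos n) s hs
    obtain ⟨s₂, k₂, r₂, a₂, o₂, d₂⟩ := ih (fun i => σ (i + 1)) (fun i => w (i + 1))
      (fun i hi => hne (i + 1) (by omega)) h0 (fun i hi => hbody (i + 1) (by omega)) s₁ a₁
    refine ⟨s₂, _, .loop_next (by rw [hs x hx]; exact hne 0 (Nat.succ_pos n)) r₁ r₂, a₂, ?_, ?_⟩
    · rw [o₂, o₁, List.range_succ_eq_map, List.flatMap_cons, List.flatMap_map, List.append_assoc]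
    · rw [Nat.succ_mul]
      omega

theorem getD_set {ρ : List ℕ} {x v r : ℕ} (hx : x < ρ.length) :
    (ρ.set x v).getD r 0 = if r = x then v else ρ.getD r 0 := by
  simp only [List.getD_eq_getElem?_getD, List.getElem?_set]
  by_cases h : x = r
  · subst h; simp [hx]
  · simp [h, Ne.symm h]

/-- The assignment `x := v`. -/
theorem exec_const {T x v : ℕ} {ρ : List ℕ} (hx : x < ρ.length) :
    Exec T (.const x v) ρ (ρ.set x v) [] (1 + v) := by
  intro s hs
  refine ⟨_, _, .const x v s, fun r hr => ?_, by simp [MachineState.set], ?_⟩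
  · rw [getD_set hx, ← hs r hr]
    simp [MachineState.set, Function.update_apply]
  · have := natSize_le_self v
    omega

/-- The assignment of the value of an expression to a register below `T`. -/
def assign (T x : ℕ) (e : AExpr) : WhileProg :=
  .seq (e.compile T) (.seq (.const x 0) (.arith .add x T x))

/-- The output of the value of an expression. -/
def emitE (T : ℕ) (e : AExpr) : WhileProg := .seq (e.compile T) (.emit T)

/-- A bound for the cost of assigning or writing the value of an expression. -/
def exprCost (e : AExpr) : ℕ := e.timeCoef + 2 * e.sizeCoef + 2

theorem exec_assign {T x V : ℕ} {e : AExpr} {ρ : List ℕ} (he : e.RegsLt T) (hx : x < ρ.length)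
    (hxT : x < T) (hV : ∀ v ∈ ρ, v ≤ V) :
    Exec T (assign T x e) ρ (ρ.set x (e.eval fun r => ρ.getD r 0)) [] (exprCost e * (V + 1)) := by
  intro s hs
  have hV' : ∀ r < T, s.reg r ≤ V := by
    intro r hr
    rw [hs r hr]
    by_cases h : r < ρ.length
    · rw [List.getD_eq_getElem _ _ h]; exact hV _ (List.getElem_mem _)
    · rw [List.getD_eq_default _ _ (not_lt.1 h)]; exact Nat.zero_le _
  obtain ⟨s₁, k₁, r₁, a₁, b₁, c₁, d₁⟩ := AExpr.run_compile he le_rfl s hV'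
  have hev : e.eval s.reg = e.eval fun r => ρ.getD r 0 := AExpr.eval_congr hs he
  have hsz := AExpr.size_eval_le hV' he
  have hTx : T ≠ x := by omega
  refine ⟨_, _, .seq r₁ (.seq (.const x 0 s₁) (.arith .add x T x _)), fun r hr => ?_, ?_, ?_⟩
  · rw [getD_set hx, ← hev, ← b₁]
    by_cases h : r = x
    · subst h; simp [MachineState.set, ArithOp.apply, hTx]
    · simp [MachineState.set, h, a₁ r hr, hs r hr]
  · simp [MachineState.set, c₁]
  · simp only [MachineState.set, Function.update_self, Function.update_of_ne hTx, ArithOp.apply,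
      Nat.size_zero, add_zero, b₁, exprCost, add_mul, mul_assoc]
    omega

theorem exec_emitE {T V : ℕ} {e : AExpr} {ρ : List ℕ} (he : e.RegsLt T)
    (hV : ∀ v ∈ ρ, v ≤ V) :
    Exec T (emitE T e) ρ ρ [e.eval fun r => ρ.getD r 0] (exprCost e * (V + 1)) := by
  intro s hs
  have hV' : ∀ r < T, s.reg r ≤ V := by
    intro r hr
    rw [hs r hr]
    by_cases h : r < ρ.length
    · rw [List.getD_eq_getElem _ _ h]; exact hV _ (List.getElem_mem _)
    · rw [List.getD_eq_default _ _ (not_lt.1 h)]; exact Nat.zero_le _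
  obtain ⟨s₁, k₁, r₁, a₁, b₁, c₁, d₁⟩ := AExpr.run_compile he le_rfl s hV'
  have hev : e.eval s.reg = e.eval fun r => ρ.getD r 0 := AExpr.eval_congr hs he
  have hsz := AExpr.size_eval_le hV' he
  refine ⟨_, _, .seq r₁ (.emit T s₁), fun r hr => ?_, ?_, ?_⟩
  · simp [a₁ r hr, hs r hr]
  · simp [c₁, b₁, hev]
  · simp only [b₁, exprCost, add_mul, mul_assoc]
    omega

end WhileProg

/-! ### The program that writes the wiring table -/

section WiringProgram

open AExpr WhileProg

namespace AExpr

/-- Powers. -/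
def powE (e : AExpr) : ℕ → AExpr
  | 0 => lit 1
  | i + 1 => op .mul (powE e i) e

theorem eval_powE (ρ : ℕ → ℕ) (e : AExpr) (i : ℕ) : (powE e i).eval ρ = e.eval ρ ^ i := by
  induction i with
  | zero => rfl
  | succ i ih => rw [powE, eval, ih, pow_succ]; rfl

theorem regsLt_powE {T : ℕ} {e : AExpr} (he : e.RegsLt T) (i : ℕ) : (powE e i).RegsLt T := by
  induction i with
  | zero => trivial
  | succ i ih => exact ⟨ih, he⟩

/-- The parameter with number `i` of the edge `p` for the seed `s`. -/
def hashE (D s p : AExpr) (i : ℕ) : AExpr :=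
  op .mod (op .add (op .mul (op .mod (op .div s (powE D i)) D) p)
    (op .mod (op .div s (powE D (6 + i))) D)) D

/-- The block at the end of an edge. -/
def edgeBlockE (n₁ D m j p : AExpr) : AExpr :=
  let x := op .mod j m
  let y := op .mod (op .div j m) m
  let s := op .div j (op .mul m m)
  let h := hashE D s p
  let x' := op .mod (op .add (op .add x (op .mul (op .mul (lit 3) (h 0)) y))
    (op .add (h 1) (op .mul D (h 2)))) m
  let y' := op .mod (op .add (op .add y (op .mul (op .mul (lit 3) (h 3)) x'))
    (op .add (h 4) (op .mul D (h 5)))) m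
  op .mod (op .add x' (op .mul m y')) n₁

theorem eval_edgeBlockE (ρ : ℕ → ℕ) (n₁ D m j p : AExpr) :
    (edgeBlockE n₁ D m j p).eval ρ =
      edgeBlock (n₁.eval ρ) (D.eval ρ) (m.eval ρ) (j.eval ρ) (p.eval ρ) := by
  simp only [edgeBlockE, hashE, eval, ArithOp.apply, eval_powE]
  rfl

theorem regsLt_hashE {T : ℕ} {D s p : AExpr} (hD : D.RegsLt T) (hs : s.RegsLt T)
    (hp : p.RegsLt T) (i : ℕ) : (hashE D s p i).RegsLt T :=
  ⟨⟨⟨⟨⟨hs, regsLt_powE hD i⟩, hD⟩, hp⟩, ⟨hs, regsLt_powE hD _⟩, hD⟩, hD⟩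

theorem regsLt_edgeBlockE {T : ℕ} {n₁ D m j p : AExpr} (hn : n₁.RegsLt T) (hD : D.RegsLt T)
    (hm : m.RegsLt T) (hj : j.RegsLt T) (hp : p.RegsLt T) : (edgeBlockE n₁ D m j p).RegsLt T := by
  have h := fun s hs => regsLt_hashE (T := T) (s := s) hD hs hp
  have hs : (op .div j (op .mul m m)).RegsLt T := ⟨hj, hm, hm⟩
  have h := h _ hs
  refine ⟨⟨?_, hm, ?_⟩, hn⟩
  · exact ⟨⟨⟨⟨hj, hm⟩, ⟨trivial, h 0⟩, ⟨hj, hm⟩, hm⟩, h 1, hD, h 2⟩, hm⟩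
  · exact ⟨⟨⟨⟨⟨hj, hm⟩, hm⟩, ⟨trivial, h 3⟩, ⟨⟨⟨hj, hm⟩, ⟨trivial, h 0⟩, ⟨hj, hm⟩, hm⟩,
      h 1, hD, h 2⟩, hm⟩, h 4, hD, h 5⟩, hm⟩

/-- The number of edges of a block with a given number. -/
def widthE : AExpr := op .div (reg 1) (reg 2)

/-- The number of structured coordinates. -/
def structuredE : AExpr := op .mul (op .mul (reg 3) (reg 3)) (powE (reg 2) 12)

/-- Positive as long as the side length of the torus is to be increased. -/
def growE : AExpr :=
  -- Truncated subtraction from k + 1 makes the flag positive exactly when side length m + 1 is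
  -- still admissible.
  op .sub (op .add widthE (lit 1)) (op .mul (powE (reg 2) 12)
    (op .add (op .div (op .mul (op .add (reg 3) (lit 1)) (op .add (reg 3) (lit 1))) (reg 0))
      (lit 1)))

/-- The present block. -/
def blockE : AExpr := op .sub (reg 0) (reg 4)

/-- The present edge number. -/
def edgeE : AExpr := op .sub (reg 2) (reg 5)

/-- The present structured coordinate. -/
def coordE : AExpr := op .sub structuredE (reg 7)

/-- The block of the present edge. -/
def ownerE : AExpr := edgeBlockE (reg 0) (reg 2) (reg 3) coordE edgeE

/-- Whether the present edge ends in the present block. -/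
def testE : AExpr :=
  -- The two truncated differences add up to the distance of the numbers, so the result is 1 for
  -- equal blocks and 0 otherwise.
  op .sub (lit 1) (op .add (op .sub ownerE blockE) (op .sub blockE ownerE))

/-- A decremented register. -/
def decE (x : ℕ) : AExpr := op .sub (reg x) (lit 1)

/-- An incremented register. -/
def incE (x : ℕ) : AExpr := op .add (reg x) (lit 1)

theorem regsLt_reg {x T : ℕ} (h : x < T) : (reg x).RegsLt T := h

theorem regsLt_structuredE : structuredE.RegsLt 11 :=
  ⟨⟨regsLt_reg (by decide), regsLt_reg (by decide)⟩, regsLt_powE (regsLt_reg (by decide)) 12⟩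

theorem regsLt_growE : growE.RegsLt 11 :=
  ⟨⟨⟨regsLt_reg (by decide), regsLt_reg (by decide)⟩, trivial⟩, regsLt_powE (regsLt_reg (by decide)) 12,
    ⟨⟨⟨regsLt_reg (by decide), trivial⟩, regsLt_reg (by decide), trivial⟩, regsLt_reg (by decide)⟩, trivial⟩

theorem regsLt_blockE : blockE.RegsLt 11 := ⟨regsLt_reg (by decide), regsLt_reg (by decide)⟩

theorem regsLt_edgeE : edgeE.RegsLt 11 := ⟨regsLt_reg (by decide), regsLt_reg (by decide)⟩

theorem regsLt_coordE : coordE.RegsLt 11 := ⟨regsLt_structuredE, regsLt_reg (by decide)⟩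

theorem regsLt_ownerE : ownerE.RegsLt 11 :=
  regsLt_edgeBlockE (regsLt_reg (by decide)) (regsLt_reg (by decide)) (regsLt_reg (by decide)) regsLt_coordE
    regsLt_edgeE

theorem regsLt_testE : testE.RegsLt 11 :=
  ⟨trivial, ⟨regsLt_ownerE, regsLt_blockE⟩, regsLt_blockE, regsLt_ownerE⟩

end AExpr

/-- Registers: 0, 1, 2 hold `n₁`, `n₀`, `D`; 3 the side length of the torus; 4, 5, 7 the numbers of
blocks, edge numbers and structured coordinates that are still to be treated; 6 the number of
missing edges; 8, 9 the next unstructured coordinate; 10 a flag. -/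
def torusProg : WhileProg :=
  .seq (assign 11 10 growE)
    (.loop 10 (.seq (assign 11 3 (incE 3)) (assign 11 10 growE)))

/-- Treats one structured coordinate. -/
def structuredStep : WhileProg :=
  .seq (assign 11 10 testE)
    -- A loop whose body clears its own flag acts as a conditional.
    (.seq (.loop 10 (.seq (emitE 11 coordE) (.seq (emitE 11 edgeE)
      (.seq (assign 11 6 (decE 6)) (.const 10 0)))))
      (assign 11 7 (decE 7)))

/-- Writes one edge to an unstructured coordinate. -/
def unstructuredStep : WhileProg :=
  .seq (emitE 11 (reg 9)) (.seq (emitE 11 edgeE) (.seq (assign 11 9 (incE 9))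
    (assign 11 6 (decE 6))))

/-- Writes the edges of one block with one number. -/
def edgeStep : WhileProg :=
  -- Every edge number of a block uses the same padding coordinates, so the pointer in register 9
  -- restarts from register 8; only `blockStep` moves register 8 forward.
  .seq (assign 11 9 (reg 8)) (.seq (assign 11 6 widthE) (.seq (assign 11 7 structuredE)
    (.seq (.loop 7 structuredStep) (.seq (.loop 6 unstructuredStep) (assign 11 5 (decE 5))))))

/-- Writes the edges of one block. -/
def blockStep : WhileProg :=
  .seq (assign 11 5 (reg 2)) (.seq (.loop 5 edgeStep)
    (.seq (assign 11 8 (reg 9)) (assign 11 4 (decE 4))))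

/-- Clears the working registers. -/
def clearProg : WhileProg :=
  .seq (.const 3 0) (.seq (.const 4 0) (.seq (.const 5 0) (.seq (.const 6 0) (.seq (.const 7 0)
    (.seq (.const 8 0) (.seq (.const 9 0) (.const 10 0)))))))

/-- Writes the table of the wiring. -/
def wiringProg : WhileProg :=
  .seq clearProg (.seq torusProg (.seq (assign 11 8 structuredE) (.seq (assign 11 9 (reg 8))
    (.seq (assign 11 4 (reg 0)) (.loop 4 blockStep)))))

/-- A bound for the costs of all expressions in the program. -/
def wiringCoef : ℕ :=
  exprCost growE + exprCost (incE 3) + exprCost testE + exprCost coordE + exprCost edgeE +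
    exprCost (decE 6) + exprCost (decE 7) + exprCost (reg 9) + exprCost (incE 9) +
    exprCost (reg 8) + exprCost widthE + exprCost structuredE + exprCost (decE 5) +
    exprCost (reg 2) + exprCost (decE 4) + exprCost (reg 0) + 1

section Run

variable {n₁ D m k V : ℕ}

theorem exec_assign_wiring {ρ ρ' : List ℕ} {x : ℕ} {e : AExpr} (he : e.RegsLt 11)
    (hx : x < ρ.length) (hx11 : x < 11) (hV : ∀ v ∈ ρ, v ≤ V) (hc : exprCost e ≤ wiringCoef)
    (hρ : ρ.set x (e.eval fun r => ρ.getD r 0) = ρ') :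
    Exec 11 (assign 11 x e) ρ ρ' [] (wiringCoef * (V + 1)) := by
  rw [← hρ]
  exact (exec_assign he hx hx11 hV).mono (Nat.mul_le_mul_right _ hc)

theorem exec_emitE_wiring {ρ : List ℕ} {v : ℕ} {e : AExpr} (he : e.RegsLt 11)
    (hV : ∀ v ∈ ρ, v ≤ V) (hc : exprCost e ≤ wiringCoef)
    (hv : (e.eval fun r => ρ.getD r 0) = v) :
    Exec 11 (emitE 11 e) ρ ρ [v] (wiringCoef * (V + 1)) := by
  rw [← hv]
  exact (exec_emitE he hV).mono (Nat.mul_le_mul_right _ hc)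

theorem wiringCoef_pos : 1 ≤ wiringCoef := by unfold wiringCoef; omega

/-- The values of the expressions that occur in the program. -/
theorem eval_structuredE (ρ : List ℕ) : (structuredE.eval fun r => ρ.getD r 0) =
    ρ.getD 3 0 * ρ.getD 3 0 * ρ.getD 2 0 ^ 12 := by
  simp [structuredE, eval, ArithOp.apply, eval_powE]

theorem eval_growE (ρ : List ℕ) : (growE.eval fun r => ρ.getD r 0) =
    (ρ.getD 1 0 / ρ.getD 2 0 + 1) -
      ρ.getD 2 0 ^ 12 * ((ρ.getD 3 0 + 1) * (ρ.getD 3 0 + 1) / ρ.getD 0 0 + 1) := by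
  simp [growE, widthE, eval, ArithOp.apply, eval_powE]

theorem eval_testE {b p j : ℕ} (ρ : List ℕ) (hb : ρ.getD 0 0 - ρ.getD 4 0 = b)
    (hp : ρ.getD 2 0 - ρ.getD 5 0 = p)
    (hj : ρ.getD 3 0 * ρ.getD 3 0 * ρ.getD 2 0 ^ 12 - ρ.getD 7 0 = j) :
    (testE.eval fun r => ρ.getD r 0) =
      if edgeBlock (ρ.getD 0 0) (ρ.getD 2 0) (ρ.getD 3 0) j p = b then 1 else 0 := by
  have hj' : (coordE.eval fun r => ρ.getD r 0) = j := by
    rw [coordE, eval, eval_structuredE]; exact hj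
  have hp' : (edgeE.eval fun r => ρ.getD r 0) = p := hp
  have hb' : (blockE.eval fun r => ρ.getD r 0) = b := hb
  simp only [testE, ownerE, eval, eval_edgeBlockE, hj', hp', hb', ArithOp.apply]
  split_ifs with h <;> omega

theorem exec_structuredStep {b p rb rp rc re F G j : ℕ}
    (hV : ∀ v ∈ [n₁, D * k, D, m, rb, rp, rc, re, F, G, 1], v ≤ V)
    (hb : n₁ - rb = b) (hp : D - rp = p) (hj : m * m * D ^ 12 - re = j) :
    Exec 11 structuredStep [n₁, D * k, D, m, rb, rp, rc, re, F, G, 0]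
      [n₁, D * k, D, m, rb, rp, rc - (if edgeBlock n₁ D m j p = b then 1 else 0), re - 1, F, G, 0]
      (if edgeBlock n₁ D m j p = b then [j, p] else []) (8 * (wiringCoef * (V + 1))) := by
  set W := wiringCoef * (V + 1) with hW
  have hW1 : 1 ≤ W := Nat.mul_pos wiringCoef_pos (Nat.succ_pos V)
  simp only [List.forall_mem_cons, List.not_mem_nil, false_imp_iff, implies_true, and_true] at hV
  obtain ⟨v0, v1, v2, v3, v4, v5, v6, v7, v8, v9, v10⟩ := hV
  set t := if edgeBlock n₁ D m j p = b then 1 else 0 with ht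
  have ht1 : t ≤ 1 := by rw [ht]; split_ifs <;> omega
  have h1 : Exec 11 (assign 11 10 testE) [n₁, D * k, D, m, rb, rp, rc, re, F, G, 0]
      [n₁, D * k, D, m, rb, rp, rc, re, F, G, t] [] W :=
    exec_assign_wiring regsLt_testE (by simp) (by simp) (by simp; omega)
      (by unfold wiringCoef; omega) (by
        rw [eval_testE [n₁, D * k, D, m, rb, rp, rc, re, F, G, 0] hb hp hj]
        rfl)
  have h2 : ∀ rc', rc' ≤ V → Exec 11 (.seq (emitE 11 coordE) (.seq (emitE 11 edgeE)
      (.seq (assign 11 6 (decE 6)) (.const 10 0)))) [n₁, D * k, D, m, rb, rp, rc', re, F, G, 1]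
      [n₁, D * k, D, m, rb, rp, rc' - 1, re, F, G, 0] [j, p] (W + (W + (W + (1 + 0)))) := by
    intro rc' hrc'
    have e1 : Exec 11 (emitE 11 coordE) [n₁, D * k, D, m, rb, rp, rc', re, F, G, 1]
        [n₁, D * k, D, m, rb, rp, rc', re, F, G, 1] [j] W :=
      exec_emitE_wiring regsLt_coordE (by simp; omega) (by unfold wiringCoef; omega) (by
        rw [coordE, eval, eval_structuredE]; exact hj)
    have e2 : Exec 11 (emitE 11 edgeE) [n₁, D * k, D, m, rb, rp, rc', re, F, G, 1]
        [n₁, D * k, D, m, rb, rp, rc', re, F, G, 1] [p] W :=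
      exec_emitE_wiring regsLt_edgeE (by simp; omega) (by unfold wiringCoef; omega) hp
    have e3 : Exec 11 (assign 11 6 (decE 6)) [n₁, D * k, D, m, rb, rp, rc', re, F, G, 1]
        [n₁, D * k, D, m, rb, rp, rc' - 1, re, F, G, 1] [] W :=
      exec_assign_wiring ⟨regsLt_reg (by decide), trivial⟩ (by simp) (by simp) (by simp; omega)
        (by unfold wiringCoef; omega) rfl
    exact e1.seq (e2.seq (e3.seq (exec_const (by simp))))
  have h3 : Exec 11 (.loop 10 (.seq (emitE 11 coordE) (.seq (emitE 11 edgeE)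
      (.seq (assign 11 6 (decE 6)) (.const 10 0)))))
      [n₁, D * k, D, m, rb, rp, rc, re, F, G, t]
      [n₁, D * k, D, m, rb, rp, rc - t, re, F, G, 0]
      (if edgeBlock n₁ D m j p = b then [j, p] else []) (1 * (W + (W + (W + (1 + 0))) + 1) + 1) := by
    by_cases h : edgeBlock n₁ D m j p = b
    · have ht' : t = 1 := if_pos h
      rw [if_pos h, ht']
      have := Exec.loop (T := 11) (x := 10) (by decide) 1
        (fun i => [n₁, D * k, D, m, rb, rp, rc - i, re, F, G, 1 - i]) (fun _ => [j, p])
        (fun i hi => by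
          have : i = 0 := by omega
          subst this; simp) (by simp)
        (fun i hi => by
          have : i = 0 := by omega
          subst this; exact h2 rc v6)
      simpa using this
    · have ht' : t = 0 := if_neg h
      rw [if_neg h, ht']
      have := Exec.loop (T := 11) (x := 10) (c := W + (W + (W + (1 + 0)))) (by decide) 0
        (fun _ => [n₁, D * k, D, m, rb, rp, rc, re, F, G, 0]) (fun _ => [j, p])
        (fun i hi => by omega) (by simp) (fun i hi => by omega)
        (body := (.seq (emitE 11 coordE) (.seq (emitE 11 edgeE)
          (.seq (assign 11 6 (decE 6)) (.const 10 0)))))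
      exact this.mono (by omega)
  have h4 : Exec 11 (assign 11 7 (decE 7)) [n₁, D * k, D, m, rb, rp, rc - t, re, F, G, 0]
      [n₁, D * k, D, m, rb, rp, rc - t, re - 1, F, G, 0] [] W :=
    exec_assign_wiring ⟨regsLt_reg (by decide), trivial⟩ (by simp) (by simp) (by simp; omega)
      (by unfold wiringCoef; omega) rfl
  have h5 := h1.seq (h3.seq h4)
  simp only [List.nil_append, List.append_nil] at h5
  exact h5.mono (by omega)

end Run

end WiringProgram

/-! ### Correctness and running time of the program -/

section WiringProgramRun

open AExpr WhileProg

variable {n₁ D m k V : ℕ}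

theorem flatMap_filter_eq {α β : Type} (P : α → Prop) [DecidablePred P] (f : α → List β)
    (L : List α) :
    (L.flatMap fun a => if P a then f a else []) = (L.filter fun a => P a).flatMap f := by
  induction L with
  | nil => rfl
  | cons a L ih =>
    by_cases h : P a
    · simp [h, ih]
    · simp [h, ih]

theorem exec_structuredLoop [NeZero m] {b p F : ℕ} (hk : D ^ 12 * (m * m / n₁ + 1) ≤ k)
    (hb : b < n₁) (hp : p < D) (hV0 : n₁ ≤ V) (hV1 : D * k ≤ V) (hVm : m ≤ V)
    (hJV : m * m * D ^ 12 ≤ V) (hFV : F ≤ V) :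
    Exec 11 (.loop 7 structuredStep)
      [n₁, D * k, D, m, n₁ - b, D - p, k, m * m * D ^ 12, F, F, 0]
      [n₁, D * k, D, m, n₁ - b, D - p, k - blockLoad n₁ D m b, 0, F, F, 0]
      (((List.range (m * m * D ^ 12)).filter fun j => edgeBlock n₁ D m j p = b).flatMap
        fun j => [j, p]) (V * (8 * (wiringCoef * (V + 1)) + 1) + 1) := by
  have hk0 : 0 < k := lt_of_lt_of_le
    (Nat.mul_pos (pow_pos (Nat.zero_lt_of_lt hp) 12) (Nat.succ_pos _)) hk
  have hDV : D ≤ V := (Nat.le_mul_of_pos_right D hk0).trans hV1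
  have hkV : k ≤ V := (Nat.le_mul_of_pos_left k (Nat.zero_lt_of_lt hp)).trans hV1
  set J := m * m * D ^ 12 with hJ
  -- Register 6 starts at k and drops at every structured edge found, so what remains after the scan
  -- is the number of padding edges.
  set cnt : ℕ → ℕ := fun i =>
    ((List.range i).filter fun j => edgeBlock n₁ D m j p = b).length with hcnt
  have hcnt1 : ∀ i, cnt (i + 1) = cnt i + if edgeBlock n₁ D m i p = b then 1 else 0 := by
    intro i
    simp only [hcnt, List.range_succ, List.filter_append, List.length_append]
    split_ifs with h <;> simp [h]
  have hcntJ : cnt J = blockLoad n₁ D m b := length_filter_edgeBlock hp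
  have h := Exec.loop (T := 11) (x := 7) (body := structuredStep)
    (c := 8 * (wiringCoef * (V + 1))) (by decide) J
    (fun i => [n₁, D * k, D, m, n₁ - b, D - p, k - cnt i, J - i, F, F, 0])
    (fun i => if edgeBlock n₁ D m i p = b then [i, p] else [])
    (fun i hi => by simp; omega) (by simp)
    (fun i hi => by
      have e := exec_structuredStep (n₁ := n₁) (D := D) (m := m) (k := k) (V := V) (b := b)
        (p := p) (rb := n₁ - b) (rp := D - p) (rc := k - cnt i) (re := J - i) (F := F) (G := F)
        (j := i) (by simp; omega) (by omega) (by omega) (by omega)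
      rw [Nat.sub_sub, ← hcnt1, Nat.sub_sub] at e
      exact e)
  rw [flatMap_filter_eq (fun i => edgeBlock n₁ D m i p = b) fun j => [j, p]] at h
  simp only [hcntJ, Nat.sub_self, Nat.sub_zero] at h
  have h0 : cnt 0 = 0 := by simp [hcnt]
  rw [h0, Nat.sub_zero] at h
  exact h.mono (by gcongr)

theorem exec_unstructuredStep {rb rp p rc F G : ℕ} (hp : D - rp = p)
    (hV : ∀ v ∈ [n₁, D * k, D, m, rb, rp, rc, 0, F, G + 1, 0], v ≤ V) :
    Exec 11 unstructuredStep [n₁, D * k, D, m, rb, rp, rc, 0, F, G, 0]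
      [n₁, D * k, D, m, rb, rp, rc - 1, 0, F, G + 1, 0] [G, p] (4 * (wiringCoef * (V + 1))) := by
  set W := wiringCoef * (V + 1) with hW
  simp only [List.forall_mem_cons, List.not_mem_nil, false_imp_iff, implies_true, and_true] at hV
  obtain ⟨v0, v1, v2, v3, v4, v5, v6, v7, v8, v9⟩ := hV
  have e1 : Exec 11 (emitE 11 (reg 9)) [n₁, D * k, D, m, rb, rp, rc, 0, F, G, 0]
      [n₁, D * k, D, m, rb, rp, rc, 0, F, G, 0] [G] W :=
    exec_emitE_wiring (regsLt_reg (by decide)) (by simp; omega) (by unfold wiringCoef; omega) rfl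
  have e2 : Exec 11 (emitE 11 edgeE) [n₁, D * k, D, m, rb, rp, rc, 0, F, G, 0]
      [n₁, D * k, D, m, rb, rp, rc, 0, F, G, 0] [p] W :=
    exec_emitE_wiring regsLt_edgeE (by simp; omega) (by unfold wiringCoef; omega) hp
  have e3 : Exec 11 (assign 11 9 (incE 9)) [n₁, D * k, D, m, rb, rp, rc, 0, F, G, 0]
      [n₁, D * k, D, m, rb, rp, rc, 0, F, G + 1, 0] [] W :=
    exec_assign_wiring ⟨regsLt_reg (by decide), trivial⟩ (by simp) (by simp) (by simp; omega)
      (by unfold wiringCoef; omega) rfl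
  have e4 : Exec 11 (assign 11 6 (decE 6)) [n₁, D * k, D, m, rb, rp, rc, 0, F, G + 1, 0]
      [n₁, D * k, D, m, rb, rp, rc - 1, 0, F, G + 1, 0] [] W :=
    exec_assign_wiring ⟨regsLt_reg (by decide), trivial⟩ (by simp) (by simp) (by simp; omega)
      (by unfold wiringCoef; omega) rfl
  exact (e1.seq (e2.seq (e3.seq e4))).mono (by omega)

theorem exec_unstructuredLoop {rb rp p r F : ℕ} (hp : D - rp = p) (hrV : r ≤ V)
    (hV : ∀ v ∈ [n₁, D * k, D, m, rb, rp, F + r], v ≤ V) :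
    Exec 11 (.loop 6 unstructuredStep) [n₁, D * k, D, m, rb, rp, r, 0, F, F, 0]
      [n₁, D * k, D, m, rb, rp, 0, 0, F, F + r, 0]
      ((List.range' F r).flatMap fun j => [j, p]) (V * (4 * (wiringCoef * (V + 1)) + 1) + 1) := by
  simp only [List.forall_mem_cons, List.not_mem_nil, false_imp_iff, implies_true, and_true] at hV
  obtain ⟨v0, v1, v2, v3, v4, v5, v6⟩ := hV
  have h := Exec.loop (T := 11) (x := 6) (body := unstructuredStep)
    (c := 4 * (wiringCoef * (V + 1))) (by decide) r
    (fun i => [n₁, D * k, D, m, rb, rp, r - i, 0, F, F + i, 0])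
    (fun i => [F + i, p])
    (fun i hi => by simp; omega) (by simp)
    (fun i hi => by
      have e := exec_unstructuredStep (n₁ := n₁) (D := D) (m := m) (k := k) (V := V) (rb := rb)
        (F := F) (G := F + i) (rc := r - i) hp (by simp; omega)
      rw [Nat.sub_sub] at e
      exact e)
  simp only [Nat.sub_self, Nat.sub_zero, add_zero] at h
  rw [List.range'_eq_map_range, List.flatMap_map]
  exact h.mono (by gcongr)

theorem exec_edgeStep [NeZero m] {b p G : ℕ} (hk : D ^ 12 * (m * m / n₁ + 1) ≤ k)
    (hb : b < n₁) (hp : p < D) (hV0 : n₁ ≤ V) (hV1 : D * k ≤ V) (hVm : m ≤ V)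
    (hV2 : n₁ * k ≤ V) (hGV : G ≤ V) :
    Exec 11 edgeStep
      [n₁, D * k, D, m, n₁ - b, D - p, 0, 0, blockStart n₁ D m k b, G, 0]
      [n₁, D * k, D, m, n₁ - b, D - (p + 1), 0, 0, blockStart n₁ D m k b,
        blockStart n₁ D m k (b + 1), 0]
      ((blockEdges n₁ D m k b p).flatMap fun j => [j, p]) (20 * V * (wiringCoef * (V + 1))) := by
  have hn₁ : 0 < n₁ := Nat.zero_lt_of_lt hb
  have hD0 : 0 < D := Nat.zero_lt_of_lt hp
  have hk0 : 0 < k := lt_of_lt_of_le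
    (Nat.mul_pos (pow_pos (Nat.zero_lt_of_lt hp) 12) (Nat.succ_pos _)) hk
  have hDV : D ≤ V := (Nat.le_mul_of_pos_right D hk0).trans hV1
  have hkV : k ≤ V := (Nat.le_mul_of_pos_left k (Nat.zero_lt_of_lt hp)).trans hV1
  have hFle : ∀ i ≤ n₁, blockStart n₁ D m k i ≤ V := fun i hi =>
    (blockStart_mono hi).trans ((blockStart_last hn₁ hk).le.trans hV2)
  have hFb := hFle b hb.le
  have hFb1 := hFle (b + 1) hb
  have hJV : m * m * D ^ 12 ≤ V := le_trans (Nat.le_add_right _ _) hFb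
  have hdiv : D * k / D = k := Nat.mul_div_cancel_left k hD0
  rw [blockStart_succ] at hFb1 ⊢
  set F := blockStart n₁ D m k b with hF
  set r := k - blockLoad n₁ D m b with hr
  set J := m * m * D ^ 12 with hJ
  set W := wiringCoef * (V + 1) with hW
  have hW1 : 1 ≤ W := Nat.mul_pos wiringCoef_pos (Nat.succ_pos V)
  have e1 : Exec 11 (assign 11 9 (reg 8)) [n₁, D * k, D, m, n₁ - b, D - p, 0, 0, F, G, 0]
      [n₁, D * k, D, m, n₁ - b, D - p, 0, 0, F, F, 0] [] W :=
    exec_assign_wiring (regsLt_reg (by decide)) (by simp) (by simp) (by simp; omega)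
      (by unfold wiringCoef; omega) rfl
  have e2 : Exec 11 (assign 11 6 widthE) [n₁, D * k, D, m, n₁ - b, D - p, 0, 0, F, F, 0]
      [n₁, D * k, D, m, n₁ - b, D - p, k, 0, F, F, 0] [] W :=
    exec_assign_wiring ⟨regsLt_reg (by decide), regsLt_reg (by decide)⟩ (by simp) (by simp)
      (by simp; omega) (by unfold wiringCoef; omega) (by
        rw [show (widthE.eval fun r => [n₁, D * k, D, m, n₁ - b, D - p, 0, 0, F, F, 0].getD r 0) =
          D * k / D from rfl, hdiv]
        rfl)
  have e3 : Exec 11 (assign 11 7 structuredE) [n₁, D * k, D, m, n₁ - b, D - p, k, 0, F, F, 0]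
      [n₁, D * k, D, m, n₁ - b, D - p, k, J, F, F, 0] [] W :=
    exec_assign_wiring regsLt_structuredE (by simp) (by simp)
      (by simp; omega) (by unfold wiringCoef; omega) (by rw [eval_structuredE]; rfl)
  have e4 := exec_structuredLoop hk hb hp hV0 hV1 hVm hJV hFb
  have e5 := exec_unstructuredLoop (n₁ := n₁) (D := D) (m := m) (k := k) (V := V) (rb := n₁ - b)
    (rp := D - p) (p := p) (r := r) (F := F) (by omega) (by omega) (by simp; omega)
  have e6 : Exec 11 (assign 11 5 (decE 5)) [n₁, D * k, D, m, n₁ - b, D - p, 0, 0, F, F + r, 0]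
      [n₁, D * k, D, m, n₁ - b, D - (p + 1), 0, 0, F, F + r, 0] [] W :=
    exec_assign_wiring ⟨regsLt_reg (by decide), trivial⟩ (by simp) (by simp) (by simp; omega)
      (by unfold wiringCoef; omega) rfl
  rw [← hW] at e4 e5
  have e := e1.seq (e2.seq (e3.seq (e4.seq (e5.seq e6))))
  simp only [List.nil_append, List.append_nil, ← List.flatMap_append] at e
  refine e.mono ?_
  have hVW : V * 1 ≤ V * W := Nat.mul_le_mul_left _ hW1
  have hWV : 1 * W ≤ V * W := Nat.mul_le_mul_right _ (by omega)
  have : V * (8 * W + 1) = 8 * (V * W) + V := by ring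
  have : V * (4 * W + 1) = 4 * (V * W) + V := by ring
  have : 20 * V * W = 20 * (V * W) := by ring
  omega

theorem exec_blockStep [NeZero m] {b : ℕ} (hk : D ^ 12 * (m * m / n₁ + 1) ≤ k)
    (hD : 0 < D) (hb : b < n₁) (hV0 : n₁ ≤ V) (hV1 : D * k ≤ V) (hVm : m ≤ V) (hV2 : n₁ * k ≤ V) :
    Exec 11 blockStep
      [n₁, D * k, D, m, n₁ - b, 0, 0, 0, blockStart n₁ D m k b, blockStart n₁ D m k b, 0]
      [n₁, D * k, D, m, n₁ - (b + 1), 0, 0, 0, blockStart n₁ D m k (b + 1),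
        blockStart n₁ D m k (b + 1), 0]
      ((List.range D).flatMap fun p => (blockEdges n₁ D m k b p).flatMap fun j => [j, p])
      (25 * V ^ 2 * (wiringCoef * (V + 1))) := by
  have hn₁ : 0 < n₁ := Nat.zero_lt_of_lt hb
  have hk0 : 0 < k := lt_of_lt_of_le
    (Nat.mul_pos (pow_pos hD 12) (Nat.succ_pos _)) hk
  have hDV : D ≤ V := (Nat.le_mul_of_pos_right D hk0).trans hV1
  have hFle : ∀ i ≤ n₁, blockStart n₁ D m k i ≤ V := fun i hi =>
    (blockStart_mono hi).trans ((blockStart_last hn₁ hk).le.trans hV2)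
  have hFb := hFle b hb.le
  have hFb1 := hFle (b + 1) hb
  set F := blockStart n₁ D m k b with hF
  set F' := blockStart n₁ D m k (b + 1) with hF'
  set W := wiringCoef * (V + 1) with hW
  have hW1 : 1 ≤ W := Nat.mul_pos wiringCoef_pos (Nat.succ_pos V)
  have e1 : Exec 11 (assign 11 5 (reg 2)) [n₁, D * k, D, m, n₁ - b, 0, 0, 0, F, F, 0]
      [n₁, D * k, D, m, n₁ - b, D, 0, 0, F, F, 0] [] W :=
    exec_assign_wiring (regsLt_reg (by decide)) (by simp) (by simp) (by simp; omega)
      (by unfold wiringCoef; omega) rfl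
  -- Register 9 holds the start of the padding before the first edge number and its end after each
  -- one, hence the case distinction.
  have e2 := Exec.loop (T := 11) (x := 5) (body := edgeStep) (c := 20 * V * W) (by decide) D
    (fun i => [n₁, D * k, D, m, n₁ - b, D - i, 0, 0, F, if i = 0 then F else F', 0])
    (fun p => (blockEdges n₁ D m k b p).flatMap fun j => [j, p])
    (fun i hi => by simp; omega) (by simp)
    (fun i hi => exec_edgeStep hk hb hi hV0 hV1 hVm hV2 (by split_ifs <;> omega))
  simp only [Nat.sub_zero, if_true, if_neg hD.ne', Nat.sub_self] at e2
  have e3 : Exec 11 (assign 11 8 (reg 9)) [n₁, D * k, D, m, n₁ - b, 0, 0, 0, F, F', 0]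
      [n₁, D * k, D, m, n₁ - b, 0, 0, 0, F', F', 0] [] W :=
    exec_assign_wiring (regsLt_reg (by decide)) (by simp) (by simp) (by simp; omega)
      (by unfold wiringCoef; omega) rfl
  have e4 : Exec 11 (assign 11 4 (decE 4)) [n₁, D * k, D, m, n₁ - b, 0, 0, 0, F', F', 0]
      [n₁, D * k, D, m, n₁ - (b + 1), 0, 0, 0, F', F', 0] [] W :=
    exec_assign_wiring ⟨regsLt_reg (by decide), trivial⟩ (by simp) (by simp) (by simp; omega)
      (by unfold wiringCoef; omega) rfl
  have e := e1.seq (e2.seq (e3.seq e4))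
  simp only [List.nil_append, List.append_nil] at e
  refine e.mono ?_
  have hV1' : 1 ≤ V := by omega
  have h1 : D * (20 * V * W + 1) ≤ V * (20 * V * W + 1) := Nat.mul_le_mul_right _ hDV
  have h2 : V * (20 * V * W + 1) = 20 * (V ^ 2 * W) + V := by ring
  have h3 : V * 1 ≤ V * (V * W) := Nat.mul_le_mul_left _ (Nat.mul_pos hV1' hW1)
  have h4 : V * (V * W) = V ^ 2 * W := by ring
  have h5 : 1 * W ≤ V ^ 2 * W := Nat.mul_le_mul_right _ (Nat.pow_pos hV1')
  have h6 : 25 * V ^ 2 * W = 25 * (V ^ 2 * W) := by ring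
  omega

theorem exec_torusProg (hn₁ : 0 < n₁) (hD : 0 < D)
    (hall : ∀ i ≤ m, D ^ 12 * (i * i / n₁ + 1) ≤ k)
    (hm' : k < D ^ 12 * ((m + 1) * (m + 1) / n₁ + 1))
    (hV0 : n₁ ≤ V) (hV1 : D * k ≤ V) (hVm : m ≤ V) (hkV : k + 1 ≤ V) :
    Exec 11 torusProg [n₁, D * k, D, 0, 0, 0, 0, 0, 0, 0, 0] [n₁, D * k, D, m, 0, 0, 0, 0, 0, 0, 0]
      [] (5 * V * (wiringCoef * (V + 1))) := by
  have hk0 : 0 < k := lt_of_lt_of_le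
    (Nat.mul_pos (pow_pos hD 12) (Nat.succ_pos _)) (hall 0 (Nat.zero_le _))
  have hDV : D ≤ V := (Nat.le_mul_of_pos_right D hk0).trans hV1
  have hdiv : D * k / D = k := Nat.mul_div_cancel_left k hD
  set W := wiringCoef * (V + 1) with hW
  have hW1 : 1 ≤ W := Nat.mul_pos wiringCoef_pos (Nat.succ_pos V)
  set g : ℕ → ℕ := fun i => (k + 1) - D ^ 12 * ((i + 1) * (i + 1) / n₁ + 1) with hg
  have hgV : ∀ i, g i ≤ V := fun i => (Nat.sub_le _ _).trans hkV
  have hgm : g m = 0 := by simp only [hg]; omega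
  have e1 : ∀ i f, i ≤ V → f ≤ V → Exec 11 (assign 11 10 growE)
      [n₁, D * k, D, i, 0, 0, 0, 0, 0, 0, f] [n₁, D * k, D, i, 0, 0, 0, 0, 0, 0, g i] [] W := by
    intro i f hi hf
    refine exec_assign_wiring regsLt_growE (by simp) (by simp) (by simp; omega)
      (by unfold wiringCoef; omega) ?_
    rw [eval_growE]
    simp only [List.getD_cons_zero, List.getD_cons_succ, hdiv]
    rfl
  have e2 := Exec.loop (T := 11) (x := 10)
    (body := .seq (assign 11 3 (incE 3)) (assign 11 10 growE)) (c := W + W) (by decide) m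
    (fun i => [n₁, D * k, D, i, 0, 0, 0, 0, 0, 0, g i]) (fun _ => [])
    (fun i hi => by
      have := hall (i + 1) hi
      simp [hg]
      omega) (by simp [hgm])
    (fun i hi => by
      have e3 : Exec 11 (assign 11 3 (incE 3)) [n₁, D * k, D, i, 0, 0, 0, 0, 0, 0, g i]
          [n₁, D * k, D, i + 1, 0, 0, 0, 0, 0, 0, g i] [] W := by
        have := hgV i
        exact exec_assign_wiring ⟨regsLt_reg (by decide), trivial⟩ (by simp) (by simp)
          (by simp; omega) (by unfold wiringCoef; omega) rfl
      exact e3.seq (e1 (i + 1) (g i) (by omega) (hgV i)))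
  have e := (e1 0 0 (Nat.zero_le _) (Nat.zero_le _)).seq e2
  simp only [hgm, List.nil_append] at e
  have hnil : ((List.range m).flatMap fun _ => ([] : List ℕ)) = [] := by simp
  rw [hnil] at e
  refine e.mono ?_
  have h1 : m * (W + W + 1) ≤ V * (W + W + 1) := Nat.mul_le_mul_right _ hVm
  have h2 : V * (W + W + 1) = 2 * (V * W) + V := by ring
  have h3 : V * 1 ≤ V * W := Nat.mul_le_mul_left _ hW1
  have h4 : 1 * W ≤ V * W := Nat.mul_le_mul_right _ (by omega)
  have h5 : 5 * V * W = 5 * (V * W) := by ring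
  omega

theorem exec_clearProg (a b c d e f g h i j l : ℕ) :
    Exec 11 clearProg [a, b, c, d, e, f, g, h, i, j, l] [a, b, c, 0, 0, 0, 0, 0, 0, 0, 0] [] 8 := by
  have e := (exec_const (T := 11) (x := 3) (v := 0) (ρ := [a, b, c, d, e, f, g, h, i, j, l])
      (by simp)).seq
    ((exec_const (x := 4) (v := 0) (by simp)).seq ((exec_const (x := 5) (v := 0) (by simp)).seq
    ((exec_const (x := 6) (v := 0) (by simp)).seq ((exec_const (x := 7) (v := 0) (by simp)).seq
    ((exec_const (x := 8) (v := 0) (by simp)).seq ((exec_const (x := 9) (v := 0) (by simp)).seq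
    (exec_const (x := 10) (v := 0) (by simp))))))))
  exact e

/-- The working registers L are arbitrary because the program also has to run after another one that
leaves them dirty. -/
theorem exec_wiringProg [NeZero m] (hn₁ : 0 < n₁) (hD : 0 < D)
    (hmm : m * m ≤ n₁ * k) (hall : ∀ i ≤ m, D ^ 12 * (i * i / n₁ + 1) ≤ k)
    (hm' : k < D ^ 12 * ((m + 1) * (m + 1) / n₁ + 1)) (L : List ℕ) (hL : L.length = 8) :
    ∃ ρ, Exec 11 wiringProg (n₁ :: (D * k) :: D :: L) ρ
      ((List.range n₁).flatMap fun b => (List.range D).flatMap fun p =>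
        (blockEdges n₁ D m k b p).flatMap fun j => [j, p])
      (100 * wiringCoef * (n₁ * (D * k) + 1) ^ 4) := by
  set V := n₁ * (D * k) + 1 with hV
  have hk := hall m le_rfl
  have hk0 : 0 < k := lt_of_lt_of_le
    (Nat.mul_pos (pow_pos hD 12) (Nat.succ_pos _)) hk
  have hV0 : n₁ ≤ V := (Nat.le_mul_of_pos_right n₁ (Nat.mul_pos hD hk0)).trans (Nat.le_succ _)
  have hV1 : D * k ≤ V := (Nat.le_mul_of_pos_left _ hn₁).trans (Nat.le_succ _)
  have hV2 : n₁ * k ≤ V :=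
    (Nat.mul_le_mul_left _ (Nat.le_mul_of_pos_left k hD)).trans (Nat.le_succ _)
  have hVm : m ≤ V := by
    rcases Nat.eq_zero_or_pos m with h | h
    · omega
    · exact (Nat.le_mul_of_pos_left m h).trans (hmm.trans hV2)
  have hkV : k + 1 ≤ V := Nat.succ_le_succ
    ((Nat.le_mul_of_pos_left k hD).trans (Nat.le_mul_of_pos_left _ hn₁))
  have hDV : D ≤ V := (Nat.le_mul_of_pos_right D hk0).trans hV1
  have hJ0 : blockStart n₁ D m k 0 = m * m * D ^ 12 := by simp [blockStart]
  have hJV : m * m * D ^ 12 ≤ V :=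
    hJ0.symm.le.trans ((blockStart_mono (Nat.zero_le n₁)).trans
      ((blockStart_last hn₁ hk).le.trans hV2))
  set W := wiringCoef * (V + 1) with hW
  have hW1 : 1 ≤ W := Nat.mul_pos wiringCoef_pos (Nat.succ_pos V)
  obtain ⟨a3, a4, a5, a6, a7, a8, a9, a10, rfl⟩ :
      ∃ a b c d e f g h, L = [a, b, c, d, e, f, g, h] := by
    match L, hL with
    | [a, b, c, d, e, f, g, h], _ => exact ⟨a, b, c, d, e, f, g, h, rfl⟩
  set J := m * m * D ^ 12 with hJ
  have e0 := exec_clearProg n₁ (D * k) D a3 a4 a5 a6 a7 a8 a9 a10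
  have e1 := exec_torusProg hn₁ hD hall hm' hV0 hV1 hVm hkV
  have e2 : Exec 11 (assign 11 8 structuredE) [n₁, D * k, D, m, 0, 0, 0, 0, 0, 0, 0]
      [n₁, D * k, D, m, 0, 0, 0, 0, J, 0, 0] [] W :=
    exec_assign_wiring regsLt_structuredE (by simp) (by simp) (by simp; omega)
      (by unfold wiringCoef; omega) (by rw [eval_structuredE]; rfl)
  have e3 : Exec 11 (assign 11 9 (reg 8)) [n₁, D * k, D, m, 0, 0, 0, 0, J, 0, 0]
      [n₁, D * k, D, m, 0, 0, 0, 0, J, J, 0] [] W :=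
    exec_assign_wiring (regsLt_reg (by decide)) (by simp) (by simp) (by simp; omega)
      (by unfold wiringCoef; omega) rfl
  have e4 : Exec 11 (assign 11 4 (reg 0)) [n₁, D * k, D, m, 0, 0, 0, 0, J, J, 0]
      [n₁, D * k, D, m, n₁, 0, 0, 0, J, J, 0] [] W :=
    exec_assign_wiring (regsLt_reg (by decide)) (by simp) (by simp) (by simp; omega)
      (by unfold wiringCoef; omega) rfl
  have e5 := Exec.loop (T := 11) (x := 4) (body := blockStep) (c := 25 * V ^ 2 * W) (by decide) n₁
    (fun b => [n₁, D * k, D, m, n₁ - b, 0, 0, 0, blockStart n₁ D m k b, blockStart n₁ D m k b, 0])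
    (fun b => (List.range D).flatMap fun p => (blockEdges n₁ D m k b p).flatMap fun j => [j, p])
    (fun i hi => by simp; omega) (by simp)
    (fun i hi => exec_blockStep hk hD hi hV0 hV1 hVm hV2)
  simp only [Nat.sub_zero, hJ0] at e5
  rw [← hW] at e1
  have e := e0.seq (e1.seq (e2.seq (e3.seq (e4.seq e5))))
  simp only [List.nil_append] at e
  refine ⟨_, e.mono ?_⟩
  have hV1' : 1 ≤ V := by omega
  have h1 : n₁ * (25 * V ^ 2 * W + 1) ≤ V * (25 * V ^ 2 * W + 1) := Nat.mul_le_mul_right _ hV0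
  have h2 : V * (25 * V ^ 2 * W + 1) = 25 * (V ^ 3 * W) + V := by ring
  have h3 : V * 1 ≤ V * (V ^ 2 * W) := Nat.mul_le_mul_left _ (Nat.mul_pos (Nat.pow_pos hV1') hW1)
  have h4 : V * (V ^ 2 * W) = V ^ 3 * W := by ring
  have h5 : 1 * W ≤ V ^ 3 * W := Nat.mul_le_mul_right _ (Nat.pow_pos hV1')
  have h6 : 5 * V * W ≤ 5 * (V ^ 3 * W) := by
    calc 5 * V * W = 5 * (V ^ 1 * W) := by ring
      _ ≤ _ := Nat.mul_le_mul_left _ (Nat.mul_le_mul_right _ (Nat.pow_le_pow_right hV1' (by norm_num)))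
  have h7 : 50 * (V ^ 3 * W) ≤ 100 * wiringCoef * V ^ 4 := by
    calc 50 * (V ^ 3 * W) ≤ 50 * (V ^ 3 * (wiringCoef * (V + V))) := by rw [hW]; gcongr
      _ = _ := by ring
  omega

end WiringProgramRun

/-! ### Parameters, rates and assembly -/

section FinalAssembly

open WhileProg

theorem Nat.size_le_self (n : ℕ) : n.size ≤ n := Nat.size_le.2 Nat.lt_two_pow_self

/-- The wiring `π` exists, is a sampler, and its table is printed by `wiringProg`. -/
theorem exists_sampling_wiring {D n₁ k : ℕ} (hD : D.Prime) (hD3 : 3 ≤ D) {ε γ : ℝ} (hε : 0 < ε)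
    (hε1 : ε < 1) (hDε : 10 ≤ D * ε ^ 2 * γ) (hεD : 1 ≤ ε * D) (hn₁ : 0 < n₁)
    (hk : 100 * D ^ 14 ≤ k) :
    ∃ π : Fin n₁ × Fin (D * k) ≃ Fin (n₁ * (D * k) / D) × Fin D,
      (∀ b q, (π (b, q)).2 = (finProdFinEquiv.symm q).1) ∧
      (∀ β ≤ 1, IsWiringSampler π β (β + 3 * ε) γ) ∧
      ∀ L : List ℕ, L.length = 8 → ∃ ρ, Exec 11 wiringProg (n₁ :: (D * k) :: D :: L) ρ
        (wiringTable π) (100 * wiringCoef * (n₁ * (D * k) + 1) ^ 4) := by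
  have hN : n₁ * (D * k) / D = n₁ * k := by
    rw [Nat.mul_left_comm, Nat.mul_div_cancel_left _ hD.pos]
  have hk12 : D ^ 12 ≤ k := by
    have : D ^ 12 ≤ D ^ 14 := Nat.pow_le_pow_right hD.pos (by norm_num)
    omega
  obtain ⟨m, hmm, hall, hm'⟩ := exists_torus n₁ D k hn₁ hD.pos hk12
  obtain ⟨hm0, hfull, hsmall⟩ := torus_bounds hn₁ hD.pos hk (hall m le_rfl) hm' hεD
  have : NeZero m := ⟨hm0.ne'⟩
  obtain ⟨π, hπ⟩ := exists_wiring (D := D) (m := m) hn₁ hN (hall m le_rfl)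
  refine ⟨π, fun b q => ?_, fun β hβ => ?_, fun L hL => ?_⟩
  · have h := (hπ b (finProdFinEquiv.symm q).1 (finProdFinEquiv.symm q).2).1
    rwa [Prod.mk.eta, Equiv.apply_symm_apply] at h
  · exact isWiringSampler_of_blockEdges hD hD3 hn₁ hN (hall m le_rfl) hε hε1 hDε hfull hsmall π hπ
      hβ
  · rw [wiringTable_eq (hall m le_rfl) π hπ]
    exact exec_wiringProg hn₁ hD.pos hmm hall hm' L hL

theorem WhileProg.Exec.outputs {P : WhileProg} {a b c C : ℕ} {w : List ℕ}
    (h : ∀ L : List ℕ, L.length = 8 → ∃ ρ, Exec 11 P (a :: b :: c :: L) ρ w C) :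
    P.Outputs [a, b, c] w C := by
  obtain ⟨ρ, h⟩ := h (List.replicate 8 0) (by simp)
  obtain ⟨s, k, hrun, -, hout, hk⟩ := h { reg := fun i => [a, b, c].getD i 0, out := [] }
    (fun r hr => by interval_cases r <;> rfl)
  exact ⟨s, k, hrun, by simpa using hout, hk⟩

/-- Running a program with three inputs after another program. -/
theorem WhileProg.Exec.exists_outputs_append {P Q : WhileProg} {a b c C T : ℕ} {w desc : List ℕ}
    (h : ∀ L : List ℕ, L.length = 8 → ∃ ρ, Exec 11 P (a :: b :: c :: L) ρ w C)
    (hQ : Q.Outputs [] desc T) :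
    ∃ Q' : WhileProg, Q'.Outputs [] (desc ++ w) (T + (3 + a + b + c + C)) := by
  obtain ⟨s, k, hrun, hout, hk⟩ := hQ
  set s₁ := ((s.set 0 a).set 1 b).set 2 c with hs₁
  obtain ⟨ρ, h⟩ := h [s.reg 3, s.reg 4, s.reg 5, s.reg 6, s.reg 7, s.reg 8, s.reg 9, s.reg 10]
    (by simp)
  obtain ⟨s', k', hrun', -, hout', hk'⟩ := h s₁ (fun r hr => by interval_cases r <;> rfl)
  refine ⟨.seq Q (.seq (.const 0 a) (.seq (.const 1 b) (.seq (.const 2 c) P))), s', _,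
    .seq hrun (.seq (.const 0 a s) (.seq (.const 1 b _) (.seq (.const 2 c _) hrun'))), ?_, ?_⟩
  · rw [hout', hs₁]
    simp [MachineState.set, hout]
  · have ha := Nat.size_le_self a
    have hb := Nat.size_le_self b
    have hc := Nat.size_le_self c
    omega

theorem WhileProg.Outputs.mono {P : WhileProg} {i w : List ℕ} {T T' : ℕ} (h : P.Outputs i w T)
    (hT : T ≤ T') : P.Outputs i w T' := by
  obtain ⟨s, k, hrun, hout, hk⟩ := h
  exact ⟨s, k, hrun, hout, hk.trans hT⟩

/-- Bertrand's postulate above ⌈10/x⌉: the prime is at most 2(10/x + 1) ≤ 22/x because x ≤ 1. -/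
theorem exists_prime_degree {x : ℝ} (hx : 0 < x) (hx1 : x ≤ 1) :
    ∃ D : ℕ, D.Prime ∧ 10 ≤ D * x ∧ D * x ≤ 22 := by
  have h10 : 10 ≤ 10 / x := by rw [le_div_iff₀ hx]; linarith
  have hlt := Nat.ceil_lt_add_one (by positivity : 0 ≤ 10 / x)
  have hle := Nat.le_ceil (10 / x)
  obtain ⟨D, hD, h1, h2⟩ := Nat.exists_prime_lt_and_le_two_mul ⌈10 / x⌉₊
    (Nat.ceil_pos.2 (by positivity)).ne'
  have h1' : ((⌈10 / x⌉₊ : ℕ) : ℝ) < D := by exact_mod_cast h1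
  have h2' : (D : ℝ) ≤ 2 * (⌈10 / x⌉₊ : ℕ) := by exact_mod_cast h2
  refine ⟨D, hD, ?_, ?_⟩
  · rw [← div_le_iff₀ hx]
    linarith
  · rw [← le_div_iff₀ hx, show 22 / x = 2.2 * (10 / x) by ring]
    linarith

/-- The number of repetitions that makes a union bound over `D` events work. -/
theorem exists_repetitions {D : ℕ} (hD : 0 < D) {x : ℝ} (hx : 0 < x) (hx1 : x ≤ 1)
    (hDx : D * x ^ 3 ≤ 22) :
    ∃ r : ℕ, 0 < r ∧ 2 * r < 100 * D ∧ (D : ℝ) * (8 / 9) ^ r ≤ 1 / 3 ∧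
      2 * (r : ℝ) ≤ 130 * Real.log (2 / x) := by
  have hD1 : (1 : ℝ) ≤ D := by exact_mod_cast hD
  have hDpos : (0 : ℝ) < 3 * D := by linarith
  have hlog : 0 < Real.log (3 * D) := Real.log_pos (by linarith)
  have hlt := Nat.ceil_lt_add_one (by positivity : 0 ≤ 9 * Real.log (3 * D))
  have hle := Nat.le_ceil (9 * Real.log (3 * D))
  have hlogle := Real.log_le_sub_one_of_pos hDpos
  -- Since 8/9 ≤ exp(-1/9), this r makes (8/9) ^ r at most 1/(3D).
  set r := ⌈9 * Real.log (3 * D)⌉₊ with hr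
  have hlog2 : (1 : ℝ) / 2 ≤ Real.log (2 / x) := by
    have h1 : Real.log 2 ≤ Real.log (2 / x) :=
      Real.log_le_log (by norm_num) (by rw [le_div_iff₀ hx]; linarith)
    linarith [Real.log_two_gt_d9]
  refine ⟨r, Nat.ceil_pos.2 (by positivity), ?_, ?_, ?_⟩
  · have : (2 : ℝ) * r < 100 * D := by linarith
    exact_mod_cast this
  · have h1 : (8 / 9 : ℝ) ^ r ≤ Real.exp (-(Real.log (3 * D))) := by
      calc (8 / 9 : ℝ) ^ r ≤ (Real.exp (-(1 / 9))) ^ r := by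
            gcongr
            linarith [Real.add_one_le_exp (-(1 / 9) : ℝ)]
        _ = Real.exp (-(r / 9)) := by rw [← Real.exp_nat_mul]; ring_nf
        _ ≤ _ := Real.exp_le_exp.2 (by linarith)
    rw [Real.exp_neg, Real.exp_log hDpos] at h1
    calc (D : ℝ) * (8 / 9) ^ r ≤ D * (3 * (D : ℝ))⁻¹ := by gcongr
      _ = 1 / 3 := by field_simp
  -- From 3D ≤ 66/x³ ≤ (2/x)⁷. Then 2r ≤ 126 log(2/x) + 2, and the 2 is at most 4 log(2/x).
  · have h2 : Real.log (3 * D) ≤ 7 * Real.log (2 / x) := by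
      rw [← Real.log_rpow (by positivity)]
      refine Real.log_le_log hDpos ?_
      rw [show ((7 : ℝ)) = ((7 : ℕ) : ℝ) by norm_num, Real.rpow_natCast, div_pow,
        le_div_iff₀ (by positivity)]
      have h4 : x ^ 7 ≤ x ^ 3 := pow_le_pow_of_le_one hx.le hx1 (by norm_num)
      nlinarith
    linarith

/-- Turns quotients of logarithms into n₀. The positive rate excludes zero denominators, for which
`codeRate` would be 0 by convention. -/
theorem log_card_div_of_codeRate {A₀ A₁ : Type} [Fintype A₀] [Fintype A₁] {n₀ : ℕ}
    {E₀ : A₁ → Fin n₀ → A₀} (h₀ : Function.Injective E₀) {R : ℝ} (hR : 0 < R)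
    (h : codeRate (Set.range E₀) = R) :
    Real.log (Fintype.card A₁) / (R * Real.log (Fintype.card A₀)) = n₀ := by
  have hc : (Set.range E₀).ncard = Fintype.card A₁ := by
    rw [← Set.image_univ, Set.ncard_image_of_injective _ h₀, Set.ncard_univ,
      Nat.card_eq_fintype_card]
  unfold codeRate at h
  rw [hc] at h
  have hne : (n₀ : ℝ) * Real.log (Fintype.card A₀) ≠ 0 := by
    intro h0
    rw [h0, div_zero] at h
    exact hR.ne h
  rw [div_eq_iff hne] at h
  rw [h, div_eq_iff (mul_ne_zero hR.ne' (right_ne_zero_of_mul hne))]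
  ring

theorem codeRate_wiredEncoder {M A₀ A₁ : Type} [Fintype M] [Fintype A₀] [Fintype A₁]
    {n₁ n₀ N D : ℕ} (π : Fin n₁ × Fin n₀ ≃ Fin N × Fin D) {E₁ : M → Fin n₁ → A₁}
    {E₀ : A₁ → Fin n₀ → A₀} (h₁ : Function.Injective E₁) (h₀ : Function.Injective E₀) {ρ R : ℝ}
    (hρ : 0 < ρ) (hρ₁ : codeRate (Set.range E₁) = ρ) (hR₀ : codeRate (Set.range E₀) = R) :
    codeRate (Set.range (wiredEncoder π E₁ E₀)) = ρ * R := by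
  have hN : n₁ * n₀ = N * D := by simpa using Fintype.card_congr π
  have hN' : (n₁ : ℝ) * n₀ = N * D := by exact_mod_cast hN
  have hcard : ∀ {α β : Type} [Fintype α] (f : α → β), Function.Injective f →
      (Set.range f).ncard = Fintype.card α := by
    intro α β _ f hf
    rw [← Set.image_univ, Set.ncard_image_of_injective _ hf, Set.ncard_univ,
      Nat.card_eq_fintype_card]
  unfold codeRate at *
  rw [hcard _ h₁] at hρ₁
  rw [hcard _ h₀] at hR₀
  rw [hcard _ (wiredEncoder_injective h₁ h₀), Fintype.card_fun, Fintype.card_fin, Nat.cast_pow,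
    Real.log_pow, ← mul_assoc, ← hN', ← hρ₁, ← hR₀]
  have hne : (n₁ : ℝ) * Real.log (Fintype.card A₁) ≠ 0 := by
    intro h0
    rw [h0, div_zero] at hρ₁
    exact hρ.ne hρ₁
  rw [div_mul_div_comm, show (n₁ : ℝ) * Real.log (Fintype.card A₁) *
      (n₀ * Real.log (Fintype.card A₀)) =
      n₁ * n₀ * Real.log (Fintype.card A₀) * Real.log (Fintype.card A₁) by ring,
    mul_div_mul_right _ _ (right_ne_zero_of_mul hne)]

end FinalAssembly

theorem theorem6p3 :
    ∃ (K : ℕ) (P : WhileProg),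
    ∀ ε γ : ℝ, 0 < ε → ε < 1 → 0 < γ → γ < 1 →
    -- `D` is the exponent of the new alphabet, `d` the least admissible inner block length
    ∃ D d : ℕ, 0 < D ∧ (D : ℝ) ≤ K / (ε ^ 3 * γ) ∧ (d : ℝ) ≤ K / (ε * γ) ^ K ∧
    ∀ n₁ n₀ : ℕ, 0 < n₁ → d ≤ n₀ → D ∣ n₀ →
    ∃ π : Fin n₁ × Fin n₀ ≃ Fin (n₁ * n₀ / D) × Fin D,
      -- construction time
      P.Outputs [n₁, n₀, D] (wiringTable π) (K * (n₁ * n₀ + 1) ^ K) ∧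
      (∀ (Q : WhileProg) (desc : List ℕ) (T : ℕ), Q.Outputs [] desc T →
        ∃ Q' : WhileProg,
          Q'.Outputs [] (desc ++ wiringTable π) (T + K * (n₁ * n₀ + 1) ^ K)) ∧
      ∀ (ζ R : ℝ), 0 < ζ → ζ < 1 → 0 < R → R < 1 →
      ∀ (M A₀ A₁ : Type) [Fintype M] [Fintype A₀] [Fintype A₁]
        (E₁ : M → Fin n₁ → A₁) (E₀ : A₁ → Fin n₀ → A₀),
      Function.Injective E₁ → Function.Injective E₀ →
      codeRate (Set.range E₁) = 1 - ζ → codeRate (Set.range E₀) = R →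
        Function.Injective (wiredEncoder π E₁ E₀) ∧
        -- rate, alphabet size and block length
        codeRate (Set.range (wiredEncoder π E₁ E₀)) = (1 - ζ) * R ∧
        Fintype.card (Fin D → A₀) = Fintype.card A₀ ^ D ∧
        ((n₁ * n₀ / D : ℕ) : ℝ) ≤
          K * (n₁ * Real.log (Fintype.card A₁) * ε ^ 3 * γ / (R * Real.log (Fintype.card A₀))) ∧
        -- global list-recovery, as a combinatorial property
        (∀ ℓ ℓ₁ L : ℕ,
          ListRecoverable (Set.range E₀) (1 - R - ε) ℓ ℓ₁ →
          ListRecoverable (Set.range E₁) γ ℓ₁ L →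
          ListRecoverable (Set.range (wiredEncoder π E₁ E₀)) (1 - R - 4 * ε) ℓ L) ∧
        -- list-recovery algorithms
        ∀ (B : ℕ) (μ : Type) [Fintype μ] (e₀ : WordEnc A₀ Unit B) (e₁ : WordEnc A₁ Unit B)
          (eM : WordEnc M μ B) (ℓ ℓ₁ T₀ : ℕ), n₁ * n₀ ≤ B →
          ListRecoverableInTime E₀ e₀ e₁ (1 - R - ε) ℓ ℓ₁ T₀ →
          (∀ L T₁ : ℕ,
            ListRecoverableInTime E₁ e₁ eM γ ℓ₁ L T₁ →
            ListRecoverableInTime (wiredEncoder π E₁ E₀) (e₀.vec D) eM (1 - R - 4 * ε) ℓ L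
              (K * (n₁ * T₀ + T₁))) ∧
          (∀ t L T₁ : ℕ,
            LocallyListRecoverableInTime (Set.range E₁) e₁ t γ ℓ₁ L T₁ →
            ∃ t' T' : ℕ,
              (t' : ℝ) ≤ K * (Real.log (2 / (ε * γ)) / (ε ^ 3 * γ)) *
                (t * Real.log (Fintype.card A₁) / (R * Real.log (Fintype.card A₀))) ∧
              (T' : ℝ) ≤ K * (Real.log (2 / (ε * γ)) / (ε ^ 3 * γ)) *
                (t * (n₀ + T₀) + T₁ + 1) ∧
              LocallyListRecoverableInTime (Set.range (wiredEncoder π E₁ E₀)) (e₀.vec D)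
                t' (1 - R - 4 * ε) ℓ L T') := by
  -- The first summand serves the bound on d, where D ^ 15 ≤ (22/(ε³γ)) ^ 15; the second the running
  -- time of the table; the 6 the loading of the three inputs.
  set K : ℕ := 100 * 22 ^ 15 + 100 * wiringCoef + 6 with hK
  have hKbig : 100 * 22 ^ 15 ≤ K := by omega
  have hKw : 100 * wiringCoef + 6 ≤ K := by omega
  clear_value K
  refine ⟨K, wiringProg, fun ε γ hε hε1 hγ hγ1 => ?_⟩
  have hKR : (100 * 22 ^ 15 : ℝ) ≤ K := by exact_mod_cast hKbig
  have hK1 : (1 : ℝ) ≤ K := le_trans (by norm_num) hKR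
  have hεγ : 0 < ε * γ := mul_pos hε hγ
  have hεγ1 : ε * γ ≤ 1 := mul_le_one₀ hε1.le hγ.le hγ1.le
  have hx : 0 < ε ^ 3 * γ := by positivity
  have hx1 : ε ^ 3 * γ ≤ 1 := mul_le_one₀ (pow_le_one₀ hε.le hε1.le) hγ.le hγ1.le
  have hxle : (ε * γ) ^ 3 ≤ ε ^ 3 * γ := by
    rw [mul_pow]
    exact mul_le_mul_of_nonneg_left (pow_le_of_le_one hγ.le hγ1.le (by norm_num)) (by positivity)
  obtain ⟨D, hD, hD10, hD22⟩ := exists_prime_degree hx hx1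
  have hDpos : (0 : ℝ) < D := by exact_mod_cast hD.pos
  have hD3 : 3 ≤ D := by
    have : (10 : ℝ) ≤ D := hD10.trans (mul_le_of_le_one_right hDpos.le hx1)
    have : 10 ≤ D := by exact_mod_cast this
    omega
  have hDle : (D : ℝ) ≤ 22 / (ε ^ 3 * γ) := (le_div_iff₀ hx).2 hD22
  -- The sampler needs only ε²γ here; the larger degree is what makes the block length proportional
  -- to ε³γ.
  have hDε : 10 ≤ D * ε ^ 2 * γ := by
    refine hD10.trans ?_
    rw [mul_assoc]
    gcongr ?_ * (?_ * _)
    exact pow_le_pow_of_le_one hε.le hε1.le (by norm_num)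
  have hεD : 1 ≤ ε * D := by
    have : D * (ε ^ 3 * γ) ≤ D * (ε * 1) := by
      gcongr
      exact pow_le_of_le_one hε.le hε1.le (by norm_num)
    linarith
  obtain ⟨r, hr, hrD', hrD, hrlog⟩ := exists_repetitions hD.pos hεγ hεγ1
    ((mul_le_mul_of_nonneg_left hxle hDpos.le).trans hD22)
  -- This d ensures k = n₀/D ≥ 100D¹⁴, as `torus_bounds` requires.
  refine ⟨D, 100 * D ^ 15, hD.pos, hDle.trans ?_, ?_, fun n₁ n₀ hn₁ hn₀ hdvd => ?_⟩
  · gcongr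
    exact le_trans (by norm_num) hKR
  · have hD45 : (D : ℝ) * (ε * γ) ^ 3 ≤ 22 := (mul_le_mul_of_nonneg_left hxle hDpos.le).trans hD22
    rw [le_div_iff₀ (by positivity)]
    push_cast
    calc 100 * (D : ℝ) ^ 15 * (ε * γ) ^ K ≤ 100 * (D : ℝ) ^ 15 * (ε * γ) ^ 45 := by
          gcongr 100 * (D : ℝ) ^ 15 * ?_
          exact pow_le_pow_of_le_one hεγ.le hεγ1 (le_trans (by norm_num) hKbig)
      _ = 100 * ((D : ℝ) * (ε * γ) ^ 3) ^ 15 := by ring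
      _ ≤ 100 * 22 ^ 15 := by gcongr
      _ ≤ K := hKR
  obtain ⟨k, rfl⟩ := hdvd
  have hk : 100 * D ^ 14 ≤ k := by
    refine Nat.le_of_mul_le_mul_left (le_trans (le_of_eq ?_) hn₀) hD.pos
    ring
  obtain ⟨π, hcomp, hsamp, hprog⟩ := exists_sampling_wiring hD hD3 hε hε1 hDε hεD hn₁ hk
  have hDk : D ≤ D * k := Nat.le_mul_of_pos_right D
    (lt_of_lt_of_le (Nat.mul_pos (by norm_num) (pow_pos hD.pos 14)) hk)
  have hDkn : D * k ≤ n₁ * (D * k) := Nat.le_mul_of_pos_left _ hn₁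
  have hnn : n₁ ≤ n₁ * (D * k) := Nat.le_mul_of_pos_right n₁ (hD.pos.trans_le hDk)
  have hcost : 3 + n₁ + D * k + D + 100 * wiringCoef * (n₁ * (D * k) + 1) ^ 4 ≤
      K * (n₁ * (D * k) + 1) ^ K := by
    set V := n₁ * (D * k) + 1 with hV
    have hV1 : V ≤ V ^ 4 := Nat.le_self_pow (by norm_num) V
    have hV4 : V ^ 4 ≤ V ^ K := Nat.pow_le_pow_right (by omega) (by omega)
    calc 3 + n₁ + D * k + D + 100 * wiringCoef * V ^ 4
        ≤ 6 * V ^ 4 + 100 * wiringCoef * V ^ 4 := by gcongr; omega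
      _ = (100 * wiringCoef + 6) * V ^ 4 := by ring
      _ ≤ K * V ^ K := Nat.mul_le_mul hKw hV4
  refine ⟨π, (WhileProg.Exec.outputs hprog).mono (le_trans (by omega) hcost), fun Q desc T hQ => ?_, ?_⟩
  · obtain ⟨Q', hQ'⟩ := WhileProg.Exec.exists_outputs_append hprog hQ
    exact ⟨Q', hQ'.mono (Nat.add_le_add_left hcost T)⟩
  intro ζ R hζ hζ1 hR hR1 M A₀ A₁ _ _ _ E₁ E₀ hE₁ hE₀ hr₁ hr₀
  have hn₀eq := log_card_div_of_codeRate hE₀ hR hr₀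
  have hsampler : IsWiringSampler π (1 - R - 4 * ε) (1 - R - ε) γ := by
    have h := hsamp (1 - R - 4 * ε) (by linarith)
    rwa [show 1 - R - 4 * ε + 3 * ε = 1 - R - ε by ring] at h
  refine ⟨wiredEncoder_injective hE₁ hE₀,
    codeRate_wiredEncoder π hE₁ hE₀ (by linarith) hr₁ hr₀, by simp, ?_,
    fun ℓ ℓ₁ L h₀ h₁ => hsampler.listRecoverable hE₀ h₀ h₁, ?_⟩
  · have e : (n₁ * Real.log (Fintype.card A₁) * ε ^ 3 * γ / (R * Real.log (Fintype.card A₀))) =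
        n₁ * (D * k : ℕ) * (ε ^ 3 * γ) := by
      rw [← hn₀eq]
      ring
    rw [e, Nat.mul_left_comm, Nat.mul_div_cancel_left _ hD.pos]
    push_cast
    calc (n₁ : ℝ) * k ≤ n₁ * k * (D * (ε ^ 3 * γ)) :=
          le_mul_of_one_le_right (by positivity) (by linarith)
      _ = n₁ * (D * k) * (ε ^ 3 * γ) := by ring
      _ ≤ K * (n₁ * (D * k) * (ε ^ 3 * γ)) := le_mul_of_one_le_left (by positivity) hK1
  intro B μ _ e₀ e₁ eM ℓ ℓ₁ T₀ hB h₀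
  constructor
  · intro L T₁ h₁
    obtain ⟨p, hp, h⟩ := hsampler.listRecoverableInTime h₀ h₁
    exact ⟨p, hp.trans (Nat.le_mul_of_pos_left _ (by omega)), h⟩
  · intro t L T₁ h₁
    have hNB : n₁ * (D * k) / D ≤ B := (Nat.div_le_self _ _).trans hB
    -- The vote counter fits into a word: 2r < 100D ≤ 100D¹⁵ ≤ n₀ ≤ B.
    have hrB : 2 * r < B := by
      have : D * 1 ≤ D ^ 15 := by
        rw [mul_one]
        exact Nat.le_self_pow (by norm_num) D
      omega
    refine ⟨_, _, ?_, ?_, hsampler.locallyListRecoverableInTime hn₁ hD.pos hcomp hNB hr hrB hrD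
      h₀ h₁⟩
    · rw [mul_div_assoc, hn₀eq]
      push_cast
      have hlog : 0 ≤ Real.log (2 / (ε * γ)) := by
        have : (0 : ℝ) ≤ r := Nat.cast_nonneg r
        linarith
      -- The constant is 22 · 130 = 2860, from the bounds on D and 2r; the time bound below has a
      -- further factor 7.
      calc (D : ℝ) * (2 * r) * (t * (D * k))
          ≤ (22 / (ε ^ 3 * γ)) * (130 * Real.log (2 / (ε * γ))) * (t * (D * k)) := by gcongr
        _ = 2860 * (Real.log (2 / (ε * γ)) / (ε ^ 3 * γ)) * (t * (D * k)) := by ring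
        _ ≤ K * (Real.log (2 / (ε * γ)) / (ε ^ 3 * γ)) * (t * (D * k)) := by
          gcongr
          exact le_trans (by norm_num) hKR
    · push_cast
      have hlog : 0 ≤ Real.log (2 / (ε * γ)) := by
        have : (0 : ℝ) ≤ r := Nat.cast_nonneg r
        linarith
      calc (D : ℝ) * (2 * r) * (7 * (t * (D * k + T₀) + T₁ + 1))
          ≤ (22 / (ε ^ 3 * γ)) * (130 * Real.log (2 / (ε * γ))) *
            (7 * (t * (D * k + T₀) + T₁ + 1)) := by gcongr
        _ = 20020 * (Real.log (2 / (ε * γ)) / (ε ^ 3 * γ)) *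
            (t * (D * k + T₀) + T₁ + 1) := by ring
        _ ≤ K * (Real.log (2 / (ε * γ)) / (ε ^ 3 * γ)) * (t * (D * k + T₀) + T₁ + 1) := by
          gcongr
          exact le_trans (by norm_num) hKR
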